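/- Notation. Let $G$ be a finite group. For subgroups $H,K\le G$ let $\chi_H(K)$ be the number of cosets of $H$ in $G$ fixed by $K$. Subgroups $H_1,H_2\le G$ are \emph{solvably equivalent} if $\chi_{H_1}(K)=\chi_{H_2}(K)$ for every solvable $K\le G$; \emph{integrally equivalent} if $\mathbf Z[H_1\backslash G]\simeq\mathbf Z[H_2\backslash G]$ as $\mathbf Z[G]$-modules; \emph{locally integrally equivalent} if $\mathbf Z_p[H_1\backslash G]\simeq\mathbf Z_p[H_2\backslash G]$ as $\mathbf Z_p[G]$-modules for every prime $p$. Number fields $K_1,K_2$ with the same Galois closure $L$ over $\mathbf Q$ are called solvably (integrally) equivalent if $\operatorname{Gal}(L/K_1)$ and $\operatorname{Gal}(L/K_2)$ are so in $\operatorname{Gal}(L/\mathbf Q)$. The \emph{rank} of $G$ acting on a finite set $\Omega$ is the number of $G$-orbits on $\Omega\times\Omega$. Let $V\simeq\mathbf F_2^4$ be the space of even-weight vectors in $\mathbf F_2^6$ modulo $\langle(1,1,1,1,1,1)\rangle$, on which $A_6$ acts by permuting coordinates, and let $G=V\rtimes A_6$ (the transitive group \texttt{16T1654}) be the group of all permutations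 $w\mapsto\sigma w+b$ of the 16 points of $V$, with $\sigma\in A_6$, $b\in V$. Then $G$ is transitive of order $5760$, and there are subgroups $H_1,H_2\le G$ with the following properties. (1) $H_1$ and $H_2$ are nonconjugate, isomorphic to $A_5$, and of index $96$. There are exactly five conjugacy classes of subgroups of $G$ isomorphic to $A_5$, and for nonconjugate subgroups $A,A'$ isomorphic to $A_5$, every proper subgroup of $A$ is conjugate in $G$ to a proper subgroup of $A'$ if and only if $A$ and $A'$ are, in some order, conjugate to $H_1$ and $H_2$. (2) $H_1$ and $H_2$ are solvably equivalent but not integrally equivalent. There are five double cosets $D_1,\dots,D_5$ in $H_1\backslash G/H_2$, consisting of $5,6,10,15,60$ right cosets of $H_1$, respectively. Accordingly, the $\mathbf Z[G]$-homomorphisms $\mathbf Z[H_1\backslash G]\to\mathbf Z[H_2\backslash G]$ correspond bijectively to $x=(x_1,\dots,x_5)\in\mathbf Z^5$, the matrix $M$ of the homomorphism given by $x$ having entry $x_k$ at $(H_1a,H_2b)$ when $ab^{-1}\in D_k$; and for suitable orderings of $H_1\backslash G$ and $H_2\backslash G$ we have, for all $x\in\mathbf Z^5$, \begin{align*} \det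 M=-\,&(5x_1+6x_2+10x_3+15x_4+60x_5)\,(x_1-6x_2-10x_3+3x_4+12x_5)^5\\ \cdot\,&(3x_1+2x_2-2x_3-7x_4+4x_5)^{15}\,(3x_1-2x_2+2x_3+x_4-4x_5)^{30}\,(x_1+2x_2-2x_3+3x_4-4x_5)^{45}. \end{align*} No $x\in\mathbf Z^5$ makes all five linear forms equal to $\pm1$. (3) There are infinitely many Galois number fields $L/\mathbf Q$ (in a fixed algebraic closure of $\mathbf Q$) with an isomorphism $\operatorname{Gal}(L/\mathbf Q)\simeq G$ under which the fixed fields $K_1,K_2$ of $H_1,H_2$ are nonisomorphic number fields of degree $96$ with Galois closure $L$ that are solvably but not integrally equivalent. The splitting field over $\mathbf Q$ of $$x^{16}-2x^{15}+3x^{14}-16x^{13}+18x^{12}-10x^{10}+40x^9-39x^8+54x^7+23x^6+16x^5-140x^4-188x^3-28x^2+104x-4$$ is such a field $L$. (4) $G$ acts with rank $5$ on $H_1\backslash G$ and on $H_2\backslash G$, and $H_1,H_2$ are locally integrally equivalent, but $H_1\backslash G$ and $H_2\backslash G$ are not isomorphic as $G$-sets. (So local integral equivalence of permutation modules does not imply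 isomorphism of $G$-sets in rank $5$, which addresses a question of Scott.) -/

import Mathlib

open Polynomial

/-! ### The transitive group `16T1654`

The group is the split extension `2⁴ : A₆` in its affine action on the `16` points of
`2⁴ = {even-weight vectors of 𝔽₂⁶} / ⟨(1,1,1,1,1,1)⟩`, where `A₆` permutes coordinates.
Every class has a unique representative with last coordinate `0`; it is determined by its first
four coordinates, which are free.  So the `16` points are the vectors of `𝔽₂⁴`. -/

/-- The `16` points. -/
abbrev Pt : Type := Fin 4 → ZMod 2

/-- The even-weight representative with last coordinate `0`. -/
def evenRep (w : Pt) : Fin 6 → ZMod 2 :=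
  ![w 0, w 1, w 2, w 3, w 0 + w 1 + w 2 + w 3, 0]

/-- The class of an even-weight vector modulo the all-one vector. -/
def ptClass (u : Fin 6 → ZMod 2) : Pt :=
  ![u 0 - u 5, u 1 - u 5, u 2 - u 5, u 3 - u 5]

/-- The action of a permutation of the six coordinates on the points. -/
def coordAct (σ : Equiv.Perm (Fin 6)) (w : Pt) : Pt :=
  ptClass (fun i => evenRep w (σ⁻¹ i))

lemma evenRep_sum (w : Pt) : ∑ i, evenRep w i = 0 := by
  revert w; decide

lemma evenRep_ptClass (u : Fin 6 → ZMod 2) (hu : ∑ i, u i = 0) (i : Fin 6) :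
    evenRep (ptClass u) i = u i - u 5 := by
  revert u; revert i; decide

lemma ptClass_evenRep (w : Pt) : ptClass (evenRep w) = w := by
  revert w; decide

lemma coordAct_one (w : Pt) : coordAct 1 w = w := ptClass_evenRep w

lemma coordAct_mul (σ τ : Equiv.Perm (Fin 6)) (w : Pt) :
    coordAct (σ * τ) w = coordAct σ (coordAct τ w) := by
  have h : ∀ i, evenRep (coordAct τ w) i = evenRep w (τ⁻¹ i) - evenRep w (τ⁻¹ 5) := by
    intro i
    refine evenRep_ptClass _ ?_ i
    rw [Equiv.sum_comp τ⁻¹ (evenRep w)]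
    exact evenRep_sum w
  change ptClass (fun i => evenRep w ((σ * τ)⁻¹ i)) =
    ptClass (fun i => evenRep (coordAct τ w) (σ⁻¹ i))
  ext i
  fin_cases i <;> simp [ptClass, h]

lemma coordAct_add (σ : Equiv.Perm (Fin 6)) (v w : Pt) :
    coordAct σ (v + w) = coordAct σ v + coordAct σ w := by
  have h : ∀ i, evenRep (v + w) i = evenRep v i + evenRep w i := by
    revert v w; decide
  ext i
  fin_cases i <;> simp [coordAct, ptClass, h] <;> ring

/-- The group `16T1654`: all permutations `w ↦ σ·w + b` of the `16` points, with `σ ∈ A₆`. -/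
def T1654 : Subgroup (Equiv.Perm Pt) where
  carrier := {π | ∃ σ ∈ alternatingGroup (Fin 6), ∃ b : Pt, ∀ w, π w = coordAct σ w + b}
  one_mem' := ⟨1, one_mem _, 0, fun w => by simp [coordAct_one]⟩
  mul_mem' := by
    rintro π ρ ⟨σ, hσ, b, hπ⟩ ⟨τ, hτ, c, hρ⟩
    refine ⟨σ * τ, mul_mem hσ hτ, coordAct σ c + b, fun w => ?_⟩
    rw [Equiv.Perm.mul_apply, hπ, hρ, coordAct_add, coordAct_mul, add_assoc]
  inv_mem' := by
    rintro π ⟨σ, hσ, b, hπ⟩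
    refine ⟨σ⁻¹, inv_mem hσ, coordAct σ⁻¹ b, fun w => ?_⟩
    rw [Equiv.Perm.inv_eq_iff_eq, hπ, coordAct_add, ← coordAct_mul, ← coordAct_mul,
      mul_inv_cancel, coordAct_one, coordAct_one, add_assoc, CharTwo.add_self_eq_zero, add_zero]

/-! ### Equivalences of subgroups of a finite group -/

section Equivalences

variable {G : Type*} [Group G]

/-- `K` is conjugate in `G` to `H`. -/
def ConjSubgroups (H K : Subgroup G) : Prop :=
  ∃ g : G, H.map (MulAut.conj g).toMonoidHom = K

/-- The mark `χ_H(K)`: the number of cosets of `H` in `G` that are fixed by `K`. -/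
noncomputable def mark (H K : Subgroup G) : ℕ :=
  Nat.card (MulAction.fixedPoints K (G ⧸ H))

/-- Solvable equivalence: equal marks at every solvable subgroup. -/
def SolvablyEquivalent (H₁ H₂ : Subgroup G) : Prop :=
  ∀ K : Subgroup G, Group.IsSolvable K → mark H₁ K = mark H₂ K

/-- The permutation module of `G` on the cosets of `H`, as an `R[G]`-module. -/
abbrev PermModule (R : Type*) [CommRing R] (H : Subgroup G) : Type _ :=
  (Representation.ofMulAction R G (G ⧸ H)).asModule

/-- Isomorphism of the permutation modules as `R[G]`-modules. -/
def EquivalentOver (R : Type*) [CommRing R] (H₁ H₂ : Subgroup G) : Prop :=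
  Nonempty (PermModule R H₁ ≃ₗ[MonoidAlgebra R G] PermModule R H₂)

/-- Integral equivalence. -/
def IntegrallyEquivalent (H₁ H₂ : Subgroup G) : Prop := EquivalentOver ℤ H₁ H₂

/-- Local integral equivalence: isomorphism over `ℤ_p[G]` for every prime `p`. -/
def LocallyIntegrallyEquivalent (H₁ H₂ : Subgroup G) : Prop :=
  ∀ (p : ℕ) [Fact p.Prime], EquivalentOver ℤ_[p] H₁ H₂

/-- The entries of a homomorphism of integral permutation modules, in the bases of cosets:
the coefficient at `b` of the image of the basis vector `a`. -/
noncomputable def homMatrix {H₁ H₂ : Subgroup G}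
    (φ : PermModule ℤ H₁ →ₗ[MonoidAlgebra ℤ G] PermModule ℤ H₂) :
    Matrix (G ⧸ H₁) (G ⧸ H₂) ℤ :=
  Matrix.of fun a b =>
    ((Representation.ofMulAction ℤ G (G ⧸ H₂)).asModuleEquiv
      (φ ((Representation.ofMulAction ℤ G (G ⧸ H₁)).asModuleEquiv.symm
        (MonoidAlgebra.single a 1)))).coeff b

/-- The set of right cosets of `H` that are contained in `D`. -/
def rightCosetsIn (H : Subgroup G) (D : Set G) : Set (Set G) :=
  {R | (∃ g : G, R = {x | ∃ h ∈ H, x = h * g}) ∧ R ⊆ D}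

/-- The rank of a group acting on `Ω`: the number of orbits on `Ω × Ω`. -/
noncomputable def actionRank (G Ω : Type*) [Group G] [MulAction G Ω] : ℕ :=
  Nat.card (MulAction.orbitRel.Quotient G (Ω × Ω))

/-- Isomorphism of `G`-sets. -/
def IsoGSets (G Ω Ω' : Type*) [Group G] [MulAction G Ω] [MulAction G Ω'] : Prop :=
  ∃ e : Ω ≃ Ω', ∀ (g : G) (x : Ω), e (g • x) = g • e x

end Equivalences

/-! ### Number fields -/

/-- `K₁` and `K₂` are number fields with the same Galois closure `L` over `ℚ`, and
`Gal(L/K₁)` and `Gal(L/K₂)` are solvably equivalent in `Gal(L/ℚ)`. -/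
def SolvablyEquivalentFields {L : Type*} [Field L] [CharZero L]
    (K₁ K₂ : IntermediateField ℚ L) : Prop :=
  NumberField L ∧ IsNormalClosure ℚ K₁ L ∧ IsNormalClosure ℚ K₂ L ∧
    SolvablyEquivalent K₁.fixingSubgroup K₂.fixingSubgroup

/-- `L` is Galois over `ℚ` with group `G`, and the subfields `K₁`, `K₂` with `Gal(L/K₁) = H₁` and
`Gal(L/K₂) = H₂` are nonisomorphic solvably equivalent number fields of degree `96`
that are not integrally equivalent. -/
def RealizesPair {G : Type*} [Group G] (H₁ H₂ : Subgroup G)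
    (L : Type*) [Field L] [CharZero L] : Prop :=
  NumberField L ∧ IsGalois ℚ L ∧
  ∃ (φ : (L ≃ₐ[ℚ] L) ≃* G) (K₁ K₂ : IntermediateField ℚ L),
    K₁.fixingSubgroup = H₁.comap φ.toMonoidHom ∧
    K₂.fixingSubgroup = H₂.comap φ.toMonoidHom ∧
    Module.finrank ℚ K₁ = 96 ∧ Module.finrank ℚ K₂ = 96 ∧
    SolvablyEquivalentFields K₁ K₂ ∧
    ¬ IntegrallyEquivalent K₁.fixingSubgroup K₂.fixingSubgroup ∧
    ¬ Nonempty (K₁ ≃ₐ[ℚ] K₂)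

/-- The polynomial of degree `16` whose splitting field is the explicit example. -/
noncomputable def poly16 : ℚ[X] :=
  X ^ 16 - 2 * X ^ 15 + 3 * X ^ 14 - 16 * X ^ 13 + 18 * X ^ 12 - 10 * X ^ 10 + 40 * X ^ 9
    - 39 * X ^ 8 + 54 * X ^ 7 + 23 * X ^ 6 + 16 * X ^ 5 - 140 * X ^ 4 - 188 * X ^ 3
    - 28 * X ^ 2 + 104 * X - 4

/-! ### The five linear forms -/

/-- The numbers of right cosets of `H₁` in the five double cosets. -/
def cosetCounts : Fin 5 → ℕ := ![5, 6, 10, 15, 60]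

/-- The five linear forms in the factorization of the determinant. -/
def linForm (x : Fin 5 → ℤ) : Fin 5 → ℤ :=
  ![5 * x 0 + 6 * x 1 + 10 * x 2 + 15 * x 3 + 60 * x 4,
    x 0 - 6 * x 1 - 10 * x 2 + 3 * x 3 + 12 * x 4,
    3 * x 0 + 2 * x 1 - 2 * x 2 - 7 * x 3 + 4 * x 4,
    3 * x 0 - 2 * x 1 + 2 * x 2 + x 3 - 4 * x 4,
    x 0 + 2 * x 1 - 2 * x 2 + 3 * x 3 - 4 * x 4]

/-!
The two subgroups are the stabilizers `a5Sub 0` and `a5Sub 1` of two sets of six among the sixteen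
points. Each of these sets has `96` images, which stand for the cosets, and the number of points
that an image of the first set shares with an image of the second is one of `0, 1, 3, 4, 2`; these
five numbers distinguish the double cosets (`exists_smul_pair`, `colEquiv`).

*Subgroups.* Each of the stabilizers `a5Sub i` acts as `A₅` on a family of five sets of points. A
subgroup isomorphic to `A₅` is generated by an involution and an element of order three with product
of order five. The latter can be taken from a list of representatives, and then a search finds
a common fixed object in one of five orbits, so that there are at most five classes
(`exists_conj_a5Sub`). A proper subgroup of `A₅` fixes one of five letters, or a pair of letters, or
normalizes a subgroup of order five. In `a5Sub 0` each of these subgroups fixes an image of the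
second set that meets the first set in `0`, `1` or `3` points, and conversely
(`exists_fixed_hexad`). This gives the embeddings of the proper subgroups; certain four-groups
exclude all other pairs of classes (`exists_klein`). For solvable equivalence, a solvable subgroup
that fixes a coset lies in the common stabilizer of such a pair of sets. This common stabilizer
leaves invariant a bijection between the two orbits of sets (`mark_eq_of_fixed_pair`), so the
numbers of fixed points agree.

*Modules.* Homomorphisms of the permutation modules are invariant matrices, hence given by five
coefficients (`colHom`). In the basis dual to the five linear forms, the products `F m (F n)ᵀ` of
the five matrices are `0` for `m ≠ n`, and the `F m (F m)ᵀ` are proportional to idempotents of ranks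
`1, 5, 15, 30, 45` with sum `1`. Such a family has the determinant stated, up to a sign
(`det_sum_smul_of_orthogonal`), which is then arranged by the choice of the orderings. An
isomorphism over `ℤ` would make all five forms units, which is impossible
(`not_forall_linForm_eq`). For every prime there are coefficients that make all five forms units
modulo that prime, so the modules are locally isomorphic.

*Fields.* Let `θ i` be six numbers that the absolute Galois group permutes evenly, and let `s i` be
numbers that it permutes in the same way up to signs, with a fixed product (`IsSqrtTower`). Then the
Galois group acts through `T1654`, the signs giving the translations, and it acts through all
of `T1654` if it induces `A₆` on the `θ i` and some automorphism fixes the `θ i` but not all products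
`s i * s j`; for `A₆` permutes the nonzero translations transitively (`IsSqrtTower.hom_surjective`).
The `θ i` used here are the roots of the polynomial `sextic`. Its discriminant is a square, and
Frobenius elements at `17`, `3` and `5` supply a three-cycle, a five-cycle and a permutation without
fixed points, so the group is `A₆` (`IsSexticRoots.exists_auto`).

For the splitting field of `poly16` the `s i` are square roots of the conjugates of a unit. The
roots of `poly16` are explicit polynomials in the `θ i` and `s i`, up to a factor `736`
(`exists_sqrtTower_bigRoot`). This, the value of the discriminant, and the norm of the unit
reduce to statements about rational integers, and such an integer is identified by a bound on its
absolute value together with its residue modulo a power of a prime that splits completely; the prime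
`94057` serves, and all numbers are approximated modulo its fortieth power
(`eq_zero_of_fixed`).

For infinitely many fields the `s i` are square roots of the products `pairProd` of the numbers
`t - (θ i + θ c)` over `c ≠ i`, for integers `t`. The product of all six is a square, since each
pair sum occurs twice. Given a number field `M` that contains the `θ i`, there is an embedding of
`M` in some `ℚ_p` in which the relevant differences of pair sums are units. With `t` close to
`θ 0 + θ 2 + p`, the product `(s 0 * s 1) ^ 2` has valuation one, so `s 0 * s 1` is not in `M`
(`exists_not_isSquare`). Hence no number field contains all the fields obtained.
-/

open scoped Pointwise


/-! ### Permutations of the sixteen points as numbers -/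


/-- The number of a point, its coordinates read as binary digits. -/
def ptCode (w : Pt) : ℕ := (w 0).val + 2 * (w 1).val + 4 * (w 2).val + 8 * (w 3).val

/-- The point with a given number. -/
def ptOf (n : ℕ) : Pt := ![(n : ZMod 2), (n / 2 : ℕ), (n / 4 : ℕ), (n / 8 : ℕ)]

lemma ptOf_ptCode (w : Pt) : ptOf (ptCode w) = w := by revert w; decide +kernel

lemma ptCode_lt (w : Pt) : ptCode w < 16 := by revert w; decide +kernel

lemma ptCode_ptOf {n : ℕ} (hn : n < 16) : ptCode (ptOf n) = n := by
  revert n; decide +kernel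

lemma ptCode_injective : Function.Injective ptCode := fun v w h => by
  rw [← ptOf_ptCode v, h, ptOf_ptCode]

lemma ptCode_add (v w : Pt) : ptCode (v + w) = ptCode v ^^^ ptCode w := by
  revert v w; decide +kernel

/-- The `n`-th hexadecimal digit of `c`. -/
def ap (c n : ℕ) : ℕ := Nat.mod (Nat.div c (Nat.pow 16 n)) 16

lemma ap_def (c n : ℕ) : ap c n = c / 16 ^ n % 16 := rfl

lemma ap_lt (c n : ℕ) : ap c n < 16 := Nat.mod_lt _ (by norm_num)

lemma ap_xor (c d n : ℕ) : ap (c ^^^ d) n = ap c n ^^^ ap d n := by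
  have h16 : (16 : ℕ) = 2 ^ 4 := rfl
  simp only [ap_def, h16, ← pow_mul, Nat.xor_div_two_pow, Nat.xor_mod_two_pow]

/-- The number whose hexadecimal digits are the numbers of the images of the points. -/
def permCode (f : Pt → Pt) : ℕ :=
  (List.range 16).foldr (fun n c => ptCode (f (ptOf n)) + 16 * c) 0

lemma ap_foldr (a : ℕ → ℕ) (ha : ∀ n, a n < 16) (l : List ℕ) (n : ℕ) :
    ap (l.foldr (fun k c => a k + 16 * c) 0) n = (l.map a).getD n 0 := by
  induction l generalizing n with
  | nil => simp [ap_def]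
  | cons k l ih =>
    cases n with
    | zero => simp [ap_def, Nat.add_mul_mod_self_left, Nat.mod_eq_of_lt (ha k)]
    | succ n =>
      have := ih n
      simp only [ap_def, List.foldr_cons, List.map_cons, List.getD_cons_succ] at this ⊢
      rw [← this, pow_succ', ← Nat.div_div_eq_div_mul]
      congr 2
      have := ha k
      omega

lemma ap_permCode (f : Pt → Pt) {n : ℕ} (hn : n < 16) :
    ap (permCode f) n = ptCode (f (ptOf n)) := by
  rw [permCode, ap_foldr (fun n => ptCode (f (ptOf n))) (fun n => ptCode_lt _)]
  simp [List.getD_eq_getElem?_getD, hn]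

lemma foldr_lt (a : ℕ → ℕ) (ha : ∀ n, a n < 16) (l : List ℕ) :
    l.foldr (fun k c => a k + 16 * c) 0 < 16 ^ l.length := by
  induction l with
  | nil => simp
  | cons k l ih =>
    have := ha k
    simp only [List.foldr_cons, List.length_cons, pow_succ]
    omega

lemma permCode_lt (f : Pt → Pt) : permCode f < 16 ^ 16 := by
  exact (foldr_lt (fun n => ptCode (f (ptOf n))) (fun n => ptCode_lt _)
    (List.range 16)).trans_eq (by rw [List.length_range])

lemma eq_of_ap {c d : ℕ} (hc : c < 16 ^ 16) (hd : d < 16 ^ 16)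
    (h : ∀ n < 16, ap c n = ap d n) : c = d := by
  apply Nat.eq_of_testBit_eq
  intro k
  have key : ∀ c : ℕ, c.testBit k = (ap c (k / 4)).testBit (k % 4) := by
    intro c
    have h16 : (16 : ℕ) = 2 ^ 4 := rfl
    have hk : k % 4 < 4 := Nat.mod_lt _ (by norm_num)
    simp only [ap_def, h16, ← pow_mul, Nat.testBit_mod_two_pow, Nat.testBit_div_two_pow, hk,
      decide_true, Bool.true_and]
    congr 1
    omega
  by_cases hk : k / 4 < 16
  · rw [key, key, h _ hk]
  · have h64 : (16 : ℕ) ^ 16 ≤ 2 ^ k := by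
      calc (16 : ℕ) ^ 16 = 2 ^ 64 := by norm_num
        _ ≤ 2 ^ k := Nat.pow_le_pow_right (by norm_num) (by omega)
    rw [Nat.testBit_lt_two_pow (hc.trans_le h64), Nat.testBit_lt_two_pow (hd.trans_le h64)]

/-- The code of an element of the group. -/
def code (g : T1654) : ℕ := permCode (fun w => g • w)

lemma ap_code (g : T1654) (w : Pt) : ap (code g) (ptCode w) = ptCode (g • w) := by
  rw [code, ap_permCode _ (ptCode_lt w), ptOf_ptCode]

lemma code_injective : Function.Injective code := fun g h e => by
  apply Subtype.ext
  ext1 w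
  apply ptCode_injective
  have := ap_code g w
  rw [e, ap_code] at this
  exact this.symm

def linearCodes : List ℕ :=
  [0x1247fca98bde6530, 0x128b47defc65a930, 0x12fc8b6547a9de30, 0x13579bdfeca86420,
   0x139bec6457dfa820, 0x13ec57a89b64df20, 0x14278dbefac96350, 0x148dfa6327bec950,
   0x14fa27c98d63be50, 0x1537eac89dbf6240, 0x159d37bfea62c840, 0x15ea9d6237c8bf40,
   0x182bf6c54d7ea390, 0x184d2b7ef6a3c590, 0x18f64da32bc57e90, 0x193b5d7fe6c4a280,
   0x195de6a23b7fc480, 0x19e63bc45da27f80, 0x1e3c96b45a78d2f0, 0x1e5a3c7896d2b4f0,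
   0x1e965ad23cb478f0, 0x1f2c4a7986b5d3e0, 0x1f4a86d32c79b5e0, 0x1f862cb54ad379e0,
   0x21478bedfc9a5630, 0x218bfc5647ed9a30, 0x21fc479a8b56ed30, 0x2367dc98abef5410,
   0x23ab67efdc549810, 0x23dcab546798ef10, 0x2417f9ca8ebd5360, 0x248e17bdf953ca60,
   0x24f98e5317cabd60, 0x2637aebfd9c85140, 0x26aed95137bfc840, 0x26d937c8ae51bf40,
   0x281b4e7df5c693a0, 0x284ef5931b7dc6a0, 0x28f51bc64e937da0, 0x2a3bd5c46e7f9180,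
   0x2a6e3b7fd591c480, 0x2ad56e913bc47f80, 0x2d3c6978a5b4e1f0, 0x2d69a5e13c78b4f0,
   0x2da53cb469e178f0, 0x2f1c85b6497ae3d0, 0x2f491c7a85e3b6d0, 0x2f8549e31cb67ad0,
   0x3157ec8a9bfd4620, 0x319b57fdec468a20, 0x31ec9b46578afd20, 0x3267abfedc894510,
   0x32abdc4567fe8910, 0x32dc6789ab45fe10, 0x35179fbde8ca4260, 0x359fe84217bdca60,
   0x35e817ca9f42bd60, 0x3627d8c9afbe4150, 0x36af27bed841c950, 0x36d8af4127c9be50,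
   0x391be4c65f7d82a0, 0x395f1b7de482c6a0, 0x39e45f821bc67da0, 0x3a2b6f7ed4c58190,
   0x3a6fd4812b7ec590, 0x3ad42bc56f817e90, 0x3d2ca4b56879f1e0, 0x3d682c79a4f1b5e0,
   0x3da468f12cb579e0, 0x3e1c587a94b6f2d0, 0x3e5894f21c7ab6d0, 0x3e941cb658f27ad0,
   0x4127fa9c8deb3650, 0x418d27ebfa369c50, 0x41fa8d36279ceb50, 0x42178edbf9ac3560,
   0x428ef93517dbac60, 0x42f917ac8e35db60, 0x4567cdefba983210, 0x45ba6798cd32ef10,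
   0x45cdba3267ef9810, 0x4657b9a8cedf3120, 0x46b9ce3157a8df20, 0x46ce57dfb931a820,
   0x481df3a62e7b95c0, 0x482e1d7bf395a6c0, 0x48f32e951da67bc0, 0x4b5ac3d26978e1f0,
   0x4b695a78c3e1d2f0, 0x4bc369e15ad278f0, 0x4c5d6e7fb3a29180, 0x4c6eb3915d7fa280,
   0x4cb35da26e917f80, 0x4f1a297c83d6e5b0, 0x4f2983e51a7cd6b0, 0x4f831ad629e57cb0,
   0x51379dfbea8c2640, 0x519dea2637fb8c40, 0x51ea378c9d26fb40, 0x5317e8ac9fdb2460,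
   0x539f17dbe824ac60, 0x53e89f2417acdb60, 0x5467ba89cdfe2310, 0x54bacd236789fe10,
   0x54cd67feba238910, 0x5647cfdeb8a92130, 0x56b847a9cf21de30, 0x56cfb82147dea930,
   0x591d3f7be2a684c0, 0x593fe2841d7ba6c0, 0x59e21da63f847bc0, 0x5b4a6879c2d3f1e0,
   0x5b68c2f14a79d3e0, 0x5bc24ad368f179e0, 0x5c4db2a36f7e8190, 0x5c6f4d7eb281a390,
   0x5cb26f814da37e90, 0x5e1a92d6387cf4b0, 0x5e381a7c92f4d6b0, 0x5e9238f41ad67cb0,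
   0x6237d98caefb1540, 0x62ae37fbd9158c40, 0x62d9ae15378cfb40, 0x6327afebd89c1450,
   0x63afd81427eb9c50, 0x63d8279caf14eb50, 0x6457cefdb98a1320, 0x64b9578ace13fd20,
   0x64ceb91357fd8a20, 0x6547b89acfed1230, 0x65b8cf12479aed30, 0x65cf47edb8129a30,
   0x6a2ed1953f7b84c0, 0x6a3f2e7bd18495c0, 0x6ad13f842e957bc0, 0x6b49c1e3587af2d0,
   0x6b58497ac1f2e3d0, 0x6bc158f249e37ad0, 0x6c4e5f7db19382a0, 0x6c5fb1824e7d93a0,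
   0x6cb14e935f827da0, 0x6d29387ca1e5f4b0, 0x6d38a1f4297ce5b0, 0x6da129e538f47cb0,
   0x7896c32da54b1ef0, 0x78a5964bc31e2df0, 0x78c3a51e962d4bf0, 0x7986a45bc23d1fe0,
   0x79a4c21f865b3de0, 0x79c2863da41f5be0, 0x7a85c13e946b2fd0, 0x7a94856bc12f3ed0,
   0x7ac1942f853e6bd0, 0x7bd1e248f3596ac0, 0x7be2f36ad14859c0, 0x7bf3d159e26a48c0,
   0x7c83926da15e4fb0, 0x7c92a14f836d5eb0, 0x7ca1835e924f6db0, 0x7db1f539e4286ca0,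
   0x7de4b128f56c39a0, 0x7df5e46cb13928a0, 0x7eb2d418f63a5c90, 0x7ed4f65cb2183a90,
   0x7ef6b23ad45c1890, 0x7fb3e62ad5194c80, 0x7fd5b319e64c2a80, 0x7fe6d54cb32a1980,
   0x812b4de7f65c3a90, 0x814df63a2be75c90, 0x81f62b5c4d3ae790, 0x821bf56c4ed739a0,
   0x824e1bd7f5396ca0, 0x82f54e391b6cd7a0, 0x841d2eb7f36a59c0, 0x842ef3591db76ac0,
   0x84f31d6a2e59b7c0, 0x8796a5b4c3d2e1f0, 0x87a5c3e196b4d2f0, 0x87c396d2a5e1b4f0,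
   0x8976cd32ab54ef10, 0x89ab7654cdef3210, 0x89cdabef76325410, 0x8a759b64ce31df20,
   0x8a9bcedf75643120, 0x8ace75319bdf6420, 0x8c73ae519d62bf40, 0x8c9d7362aebf5140,
   0x8cae9dbf73516240, 0x8f1643da25bce970, 0x8f2516bc43e9da70, 0x8f4325e916dabc70,
   0x913be64c5df72a80, 0x915d3bf7e62a4c80, 0x91e65d2a3b4cf780, 0x931b5fd7e46c28a0,
   0x935fe4281bd76ca0, 0x93e41b6c5f28d7a0, 0x951de26a3fb748c0, 0x953f1db7e2486ac0,
   0x95e23f481d6ab7c0, 0x9786c2d3a4b5f1e0, 0x97a486b5c2f1d3e0, 0x97c2a4f186d3b5e0,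
   0x9876ab45cd23fe10, 0x98abcdfe76452310, 0x98cd7623abfe4510, 0x9a74cf218b65de30,
   0x9a8b7465cfde2130, 0x9acf8bde74216530, 0x9c728d63af41be50, 0x9c8dafbe72634150,
   0x9caf72418dbe6350, 0x9e1634bc52daf870, 0x9e3452f816bcda70, 0x9e5216da34f8bc70,
   0xa23b6ef7d54c1980, 0xa26ed5193bf74c80, 0xa2d53b4c6e19f780, 0xa32bd45c6fe71890,
   0xa36f2be7d4185c90, 0xa3d46f182b5ce790, 0xa62e3fb7d15948c0, 0xa63fd1482eb759c0,
   0xa6d12e593f48b7c0, 0xa78594b6c1e3f2d0, 0xa794c1f285b6e3d0, 0xa7c185e394f2b6d0,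
   0xa875ce139b46fd20, 0xa89b7546cefd1320, 0xa8ce9bfd75134620, 0xa9748b56cf12ed30,
   0xa98bcfed74561230, 0xa9cf74128bed5630, 0xac719f428e53bd60, 0xac8e71539fbd4260,
   0xac9f8ebd71425360, 0xad2561e934bcf870, 0xad3425bc61f8e970, 0xad6134f825e9bc70,
   0xb45a6987c32d1ef0, 0xb469c31e5a872df0, 0xb4c35a2d691e87f0, 0xb54ac23d68971fe0,
   0xb5684a97c21f3de0, 0xb5c2681f4a3d97e0, 0xb64958a7c13e2fd0, 0xb658c12f49a73ed0,
   0xb6c1493e582fa7d0, 0xb7d1f395e284a6c0, 0xb7e2d184f3a695c0, 0xb7f3e2a6d19584c0,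
   0xbc43619e52ad8f70, 0xbc5243ad618f9e70, 0xbc61528f439ead70, 0xbd71e824f935ac60,
   0xbde8f9ac71243560, 0xbdf97135e8ac2460, 0xbe72fa36d8149c50, 0xbed87214fa9c3650,
   0xbefad89c72361450, 0xbf73d915ea268c40, 0xbfd9ea8c73152640, 0xbfea7326d98c1540,
   0xc45db32a6ef71980, 0xc46e5df7b3192a80, 0xc4b36e195d2af780, 0xc54d6fe7b23a1890,
   0xc56fb2184de73a90, 0xc5b24d3a6f18e790, 0xc64eb1395fd728a0, 0xc65f4ed7b12839a0,
   0xc6b15f284e39d7a0, 0xc783a1e592d6f4b0, 0xc79283d6a1f4e5b0, 0xc7a192f483e5d6b0,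
   0xc8739d26ae15fb40, 0xc89daefb73261540, 0xc8ae73159dfb2640, 0xc972af148d36eb50,
   0xc98d7236afeb1450, 0xc9af8deb72143650, 0xca718e359f24db60, 0xca8e9fdb71352460,
   0xca9f71248edb3560, 0xcb4352da61e9f870, 0xcb5261f843dae970, 0xcb6143e952f8da70,
   0xd23ca54b69871ef0, 0xd2693c87a51e4bf0, 0xd2a5691e3c4b87f0, 0xd32c6897a45b1fe0,
   0xd368a41f2c975be0, 0xd3a42c5b681f97e0, 0xd629a15e38c74fb0, 0xd63829c7a14f5eb0,
   0xd6a1384f295ec7b0, 0xd7b1e482f593c6a0, 0xd7e4f5c6b18293a0, 0xd7f5b193e4c682a0,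
   0xda2534cb619e8f70, 0xda34618f25cb9e70, 0xda61259e348fcb70, 0xdb71f953e842ca60,
   0xdbe87142f9ca5360, 0xdbf9e8ca71534260, 0xde74b812fc569a30, 0xdeb8fc9a74125630,
   0xdefc7456b89a1230, 0xdf75ec46b9138a20, 0xdfb97513ec8a4620, 0xdfecb98a75461320,
   0xe13c5a87964b2df0, 0xe15a962d3c874bf0, 0xe1963c4b5a2d87f0, 0xe31c946b58a72fd0,
   0xe3581ca7942f6bd0, 0xe394582f1c6ba7d0, 0xe51a38c7926d4fb0, 0xe538924f1ac76db0,
   0xe5921a6d384fc7b0, 0xe7b2f6a3d481c590, 0xe7d4b281f6c5a390, 0xe7f6d4c5b2a38190,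
   0xe91652ad34cb8f70, 0xe93416cb528fad70, 0xe952348f16adcb70, 0xeb72d841fa63c950,
   0xebd8fac972416350, 0xebfa7263d8c94150, 0xed74fc65b821a930, 0xedb87421fca96530,
   0xedfcb8a974652130, 0xef76ba23dc458910, 0xefbadc8976234510, 0xefdc7645ba892310,
   0xf12c865b4a973de0, 0xf14a2c97863d5be0, 0xf1864a3d2c5b97e0, 0xf21c49a7856b3ed0,
   0xf249853e1ca76bd0, 0xf2851c6b493ea7d0, 0xf41a836d29c75eb0, 0xf4291ac7835e6db0,
   0xf483295e1a6dc7b0, 0xf7b3d591e6a2c480, 0xf7d5e6c4b391a280, 0xf7e6b3a2d5c49180,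
   0xf81625cb43ad9e70, 0xf825439e16cbad70, 0xf84316ad259ecb70, 0xfb73ea62d951c840,
   0xfbd97351eac86240, 0xfbead9c873625140, 0xfd75b931ec64a820, 0xfdb9eca875316420,
   0xfdec7564b9a83120, 0xfe76dc54ba329810, 0xfeba7632dc985410, 0xfedcba9876543210]

/-- The codes of all elements of the group: the linear ones, followed by the translations. -/
def codes : List ℕ :=
  linearCodes.flatMap fun c => (List.range 16).map fun b => c ^^^ (b * 0x1111111111111111)

set_option maxRecDepth 100000 in
lemma permCode_coordAct_mem (σ : Equiv.Perm (Fin 6)) (hσ : Equiv.Perm.sign σ = 1) :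
    permCode (coordAct σ) ∈ linearCodes := by
  revert σ; decide +kernel

/-- The affine permutation `w ↦ σ w + b` as an element of the group. -/
def affineElt (σ : Equiv.Perm (Fin 6)) (hσ : σ ∈ alternatingGroup (Fin 6)) (b : Pt) : T1654 :=
  ⟨{ toFun := fun w => coordAct σ w + b
     invFun := fun w => coordAct σ⁻¹ (w + b)
     left_inv := fun w => by
      beta_reduce
      rw [add_assoc, CharTwo.add_self_eq_zero, add_zero, ← coordAct_mul, inv_mul_cancel,
        coordAct_one]
     right_inv := fun w => by
      beta_reduce
      rw [← coordAct_mul, mul_inv_cancel, coordAct_one, add_assoc, CharTwo.add_self_eq_zero,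
        add_zero] }, σ, hσ, b, fun _ => rfl⟩

lemma affineElt_smul (σ : Equiv.Perm (Fin 6)) (hσ : σ ∈ alternatingGroup (Fin 6)) (b w : Pt) :
    affineElt σ hσ b • w = coordAct σ w + b := rfl

lemma exists_affineElt (g : T1654) : ∃ σ hσ b, g = affineElt σ hσ b := by
  obtain ⟨σ, hσ, b, h⟩ := g.2
  exact ⟨σ, hσ, b, Subtype.ext (Equiv.ext h)⟩

lemma coordAct_zero (σ : Equiv.Perm (Fin 6)) : coordAct σ 0 = 0 := by
  have h := coordAct_add σ 0 0
  simpa using h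

set_option maxRecDepth 100000 in
lemma eq_one_of_coordAct_eq (σ : Equiv.Perm (Fin 6))
    (h : ∀ k : Fin 4, coordAct σ (Pi.single k 1) = Pi.single k 1) : σ = 1 := by
  revert σ; decide +kernel

lemma coordAct_injective : Function.Injective coordAct := fun σ τ h => by
  have : τ⁻¹ * σ = 1 := eq_one_of_coordAct_eq _ fun k => by
    rw [coordAct_mul, h, ← coordAct_mul, inv_mul_cancel, coordAct_one]
  exact (inv_mul_eq_one.mp this).symm

/-- The elements of the group correspond to pairs of a linear part and a translation. -/
noncomputable def affineEquiv : alternatingGroup (Fin 6) × Pt ≃ T1654 :=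
  Equiv.ofBijective (fun x => affineElt x.1 x.1.2 x.2) <| by
    constructor
    · rintro ⟨⟨σ, hσ⟩, b⟩ ⟨⟨τ, hτ⟩, c⟩ h
      have h' : ∀ w, coordAct σ w + b = coordAct τ w + c := fun w =>
        congrArg (fun g : T1654 => g • w) h
      have h0 : b = c := by simpa [coordAct_zero] using h' 0
      subst h0
      have : σ = τ := coordAct_injective (funext fun w => add_right_cancel (h' w))
      subst this
      rfl
    · intro g
      obtain ⟨σ, hσ, b, rfl⟩ := exists_affineElt g
      exact ⟨⟨⟨σ, hσ⟩, b⟩, rfl⟩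

lemma card_pt : Nat.card Pt = 16 := by simp [Nat.card_eq_fintype_card, Pt]

lemma card_alternatingGroup_six : Nat.card (alternatingGroup (Fin 6)) = 360 := by
  rw [nat_card_alternatingGroup]; simp [Nat.factorial]

lemma card_T1654 : Nat.card T1654 = 5760 := by
  rw [← Nat.card_congr affineEquiv, Nat.card_prod, card_pt, card_alternatingGroup_six]

instance : Finite T1654 := Finite.of_equiv _ affineEquiv

lemma ap_translation {b n : ℕ} (hb : b < 16) (hn : n < 16) :
    ap (b * 0x1111111111111111) n = b := by
  have : ∀ b < 16, ∀ n < 16, ap (b * 0x1111111111111111) n = b := by decide +kernel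
  exact this b hb n hn

lemma xor_translation_lt {c b : ℕ} (hc : c < 16 ^ 16) (hb : b < 16) :
    c ^^^ (b * 0x1111111111111111) < 16 ^ 16 := by
  have : (16 : ℕ) ^ 16 = 2 ^ 64 := by norm_num
  rw [this] at hc ⊢
  exact Nat.xor_lt_two_pow hc (by omega)

lemma code_affineElt (σ : Equiv.Perm (Fin 6)) (hσ : σ ∈ alternatingGroup (Fin 6)) (b : Pt) :
    code (affineElt σ hσ b) = permCode (coordAct σ) ^^^ (ptCode b * 0x1111111111111111) := by
  refine eq_of_ap (permCode_lt _) (xor_translation_lt (permCode_lt _) (ptCode_lt b))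
    fun n hn => ?_
  rw [code, ap_permCode _ hn, ap_xor, ap_permCode _ hn, ap_translation (ptCode_lt b) hn,
    affineElt_smul, ptCode_add]

lemma code_mem (g : T1654) : code g ∈ codes := by
  obtain ⟨σ, hσ, b, rfl⟩ := exists_affineElt g
  rw [code_affineElt]
  exact List.mem_flatMap.mpr ⟨_, permCode_coordAct_mem σ (Equiv.Perm.mem_alternatingGroup.mp hσ),
    List.mem_map.mpr ⟨_, List.mem_range.mpr (ptCode_lt b), rfl⟩⟩

lemma length_codes : codes.length = 5760 := by decide +kernel

lemma range_code : Set.range code = {c | c ∈ codes} := by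
  refine Set.eq_of_subset_of_ncard_le ?_ ?_ (List.finite_toSet codes)
  · rintro _ ⟨g, rfl⟩
    exact code_mem g
  · rw [← Set.image_univ, Set.ncard_image_of_injective _ code_injective, Set.ncard_univ,
      card_T1654, ← length_codes]
    have : {c | c ∈ codes} = (codes.toFinset : Set ℕ) := by ext; simp
    rw [this, Set.ncard_coe_finset]
    exact List.toFinset_card_le codes

lemma exists_code_eq {c : ℕ} (hc : c ∈ codes) : ∃ g, code g = c := by
  have : c ∈ Set.range code := range_code ▸ hc
  exact this

lemma nodup_codes : codes.Nodup := by
  rw [← Multiset.coe_nodup, ← Multiset.toFinset_card_eq_card_iff_nodup]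
  have h : (codes.toFinset : Set ℕ) = Set.range code := by rw [range_code]; ext; simp
  have h2 := Set.ncard_coe_finset codes.toFinset
  rw [h, ← Set.image_univ, Set.ncard_image_of_injective _ code_injective, Set.ncard_univ,
    card_T1654] at h2
  rw [Multiset.coe_card, length_codes, h2]
  rfl

/-- Elements with a decidable property can be counted by counting codes. -/
lemma card_subtype_code (p : ℕ → Bool) :
    Nat.card {g : T1654 // p (code g)} = (codes.filter p).length := by
  have h : code '' {g | p (code g)} = ((codes.filter p).toFinset : Set ℕ) := by
    ext c
    simp only [Set.mem_image, Set.mem_ofPred_eq, List.coe_toFinset, List.mem_filter]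
    constructor
    · rintro ⟨g, hg, rfl⟩
      exact ⟨code_mem g, hg⟩
    · rintro ⟨hc, hp⟩
      obtain ⟨g, rfl⟩ := exists_code_eq hc
      exact ⟨g, hp, rfl⟩
  rw [← List.toFinset_card_of_nodup (nodup_codes.filter p), ← Set.ncard_coe_finset, ← h,
    Set.ncard_image_of_injective _ code_injective]
  rfl

/-- The code of a product. -/
def mulCode (c d : ℕ) : ℕ := (List.range 16).foldr (fun n e => ap c (ap d n) + 16 * e) 0

lemma code_mul (g h : T1654) : code (g * h) = mulCode (code g) (code h) := by
  refine eq_of_ap (permCode_lt _) ((foldr_lt (fun n => ap (code g) (ap (code h) n))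
    (fun n => ap_lt _ _) (List.range 16)).trans_eq (by rw [List.length_range])) fun n hn => ?_
  rw [code, ap_permCode _ hn, mulCode, ap_foldr (fun n => ap (code g) (ap (code h) n))
    (fun n => ap_lt _ _), mul_smul, ← ap_code, ← ap_code, ptCode_ptOf hn]
  simp [List.getD_eq_getElem?_getD, hn]

lemma code_one : code 1 = 0xfedcba9876543210 := by
  have : code 1 = permCode id := by simp [code, Function.id_def]
  rw [this]
  decide +kernel

/-! ### Sets of points as masks -/

/-- The set of points whose numbers are the positions of the binary digits `1` of `m`. -/
def ofMask (m : ℕ) : Finset Pt := Finset.univ.filter fun w => m.testBit (ptCode w)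

/-- The mask of the image of a set of points under a permutation with code `c`. -/
def img (c m : ℕ) : ℕ :=
  List.foldr (fun n e => Nat.lor (bif m.testBit n then Nat.pow 2 (ap c n) else 0) e) 0
    [0, 1, 2, 3, 4, 5, 6, 7, 8, 9, 10, 11, 12, 13, 14, 15]

lemma img_def (c m : ℕ) : img c m =
    (List.range 16).foldr (fun n e => (bif m.testBit n then 2 ^ ap c n else 0) ||| e) 0 := rfl

lemma mem_ofMask {m : ℕ} {w : Pt} : w ∈ ofMask m ↔ m.testBit (ptCode w) := by simp [ofMask]

lemma testBit_foldr (a : ℕ → ℕ) (m k : ℕ) (l : List ℕ) :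
    (l.foldr (fun n e => (bif m.testBit n then 2 ^ a n else 0) ||| e) 0).testBit k =
      l.any fun n => m.testBit n && decide (a n = k) := by
  induction l with
  | nil => simp
  | cons n l ih =>
    rw [List.foldr_cons, Nat.testBit_or, ih, List.any_cons]
    cases m.testBit n <;> simp [Nat.testBit_two_pow]

lemma img_lt (c m : ℕ) : img c m < 2 ^ 16 := by
  have h : ∀ l : List ℕ, l.foldr (fun n e => (bif m.testBit n then 2 ^ ap c n else 0) ||| e) 0
      < 2 ^ 16 := by
    intro l
    induction l with
    | nil => simp
    | cons n l ih =>
      refine Nat.or_lt_two_pow ?_ ih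
      have := Nat.pow_lt_pow_right (a := 2) (by norm_num) (ap_lt c n)
      cases m.testBit n <;> simp [this]
  exact h _

lemma ofMask_injOn {m m' : ℕ} (hm : m < 2 ^ 16) (hm' : m' < 2 ^ 16) (h : ofMask m = ofMask m') :
    m = m' := by
  apply Nat.eq_of_testBit_eq
  intro k
  by_cases hk : k < 16
  · have := Finset.ext_iff.mp h (ptOf k)
    rw [mem_ofMask, mem_ofMask, ptCode_ptOf hk] at this
    exact Bool.eq_iff_iff.mpr this
  · have h16 : 2 ^ 16 ≤ 2 ^ k := Nat.pow_le_pow_right (by norm_num) (by omega)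
    rw [Nat.testBit_lt_two_pow (hm.trans_le h16), Nat.testBit_lt_two_pow (hm'.trans_le h16)]

lemma smul_ofMask (g : T1654) (m : ℕ) : g • ofMask m = ofMask (img (code g) m) := by
  ext w
  rw [mem_ofMask, img_def, testBit_foldr, Finset.mem_smul_finset]
  simp only [List.any_eq_true, List.mem_range, Bool.and_eq_true, decide_eq_true_eq, mem_ofMask]
  constructor
  · rintro ⟨v, hv, rfl⟩
    exact ⟨ptCode v, ptCode_lt v, hv, ap_code g v⟩
  · rintro ⟨n, hn, hm, h⟩
    refine ⟨ptOf n, by rwa [ptCode_ptOf hn], ptCode_injective ?_⟩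
    rw [← ap_code, ptCode_ptOf hn, h]

/-! ### Five subgroups of order sixty -/

/-- Five families of five sets of points each, given by masks. -/
def fiveMasks : Fin 5 → List ℕ :=
  ![[8839, 14597, 35716, 39427, 45442], [1589, 2668, 17528, 18461, 20033],
    [1, 4, 64, 1024, 8192], [2565, 5140, 12291, 18450, 26112],
    [153, 2565, 12291, 16705, 33825]]

/-- The family of sets with the given masks. -/
def famOf (F : List ℕ) : Finset (Finset Pt) := (F.map ofMask).toFinset

/-- Five sets of points, given by masks. -/
def setMask : Fin 5 → ℕ := ![17528, 45442, 9285, 33256, 1]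

/-- A set of points and a family of sets of points, given by masks. -/
def objOf (S : ℕ) (F : List ℕ) : Finset Pt × Finset (Finset Pt) := (ofMask S, famOf F)

/-- The stabilizer of the `i`-th set and the `i`-th family. -/
def a5Sub (i : Fin 5) : Subgroup T1654 :=
  MulAction.stabilizer T1654 (objOf (setMask i) (fiveMasks i))

/-- Whether a permutation with code `c` maps every set in `F` into `F`. -/
def fixesFam (c : ℕ) (F : List ℕ) : Bool := F.all fun m => F.contains (img c m)

lemma fiveMasks_lt : ∀ i, ∀ m ∈ fiveMasks i, m < 2 ^ 16 := by decide +kernel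

lemma ofMask_mem_famOf {F : List ℕ} (hF : ∀ m ∈ F, m < 2 ^ 16) {m : ℕ} (hm : m < 2 ^ 16) :
    ofMask m ∈ famOf F ↔ m ∈ F := by
  simp only [famOf, List.mem_toFinset, List.mem_map]
  constructor
  · rintro ⟨k, hk, e⟩
    rwa [← ofMask_injOn (hF k hk) hm e]
  · exact fun h => ⟨m, h, rfl⟩

lemma smul_famOf (g : T1654) (F : List ℕ) :
    g • famOf F = famOf (F.map (img (code g))) := by
  ext S
  simp only [Finset.mem_smul_finset, famOf, List.mem_toFinset, List.mem_map, List.map_map,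
    Function.comp, ← smul_ofMask]
  constructor
  · rintro ⟨_, ⟨m, hm, rfl⟩, rfl⟩
    exact ⟨m, hm, rfl⟩
  · rintro ⟨m, hm, rfl⟩
    exact ⟨_, ⟨m, hm, rfl⟩, rfl⟩

lemma smul_famOf_eq_iff {F : List ℕ} (hF : ∀ m ∈ F, m < 2 ^ 16) (g : T1654) :
    g • famOf F = famOf F ↔ fixesFam (code g) F := by
  have h : fixesFam (code g) F ↔ g • famOf F ⊆ famOf F := by
    rw [smul_famOf, fixesFam, List.all_eq_true]
    constructor
    · intro h S hS
      simp only [famOf, List.mem_toFinset, List.mem_map] at hS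
      obtain ⟨_, ⟨m, hm, rfl⟩, rfl⟩ := hS
      rw [ofMask_mem_famOf hF (img_lt _ _)]
      simpa using h m hm
    · intro h m hm
      have := h (x := ofMask (img (code g) m)) (by
        simp only [famOf, List.mem_toFinset, List.mem_map]
        exact ⟨_, ⟨m, hm, rfl⟩, rfl⟩)
      rw [ofMask_mem_famOf hF (img_lt _ _)] at this
      simpa using this
  rw [h]
  exact ⟨fun h => h.subset, fun h => Finset.eq_of_subset_of_card_le h (by simp)⟩

/-- Whether a permutation with code `c` fixes the set `S` and maps every set in `F` into `F`. -/
def fixesObj (c S : ℕ) (F : List ℕ) : Bool := Nat.beq (img c S) S && fixesFam c F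

lemma smul_ofMask_eq_iff {S : ℕ} (hS : S < 2 ^ 16) (g : T1654) :
    g • ofMask S = ofMask S ↔ img (code g) S = S := by
  rw [smul_ofMask]
  exact ⟨ofMask_injOn (img_lt _ _) hS, fun h => by rw [h]⟩

lemma smul_objOf_eq_iff {S : ℕ} {F : List ℕ} (hS : S < 2 ^ 16) (hF : ∀ m ∈ F, m < 2 ^ 16)
    (g : T1654) : g • objOf S F = objOf S F ↔ fixesObj (code g) S F := by
  rw [objOf, Prod.smul_mk, Prod.mk.injEq, smul_ofMask_eq_iff hS, smul_famOf_eq_iff hF, fixesObj,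
    Bool.and_eq_true, Nat.beq_eq]

lemma setMask_lt : ∀ i, setMask i < 2 ^ 16 := by decide +kernel

lemma mem_a5Sub {i : Fin 5} {g : T1654} :
    g ∈ a5Sub i ↔ fixesObj (code g) (setMask i) (fiveMasks i) := by
  rw [a5Sub, MulAction.mem_stabilizer_iff, smul_objOf_eq_iff (setMask_lt i) (fiveMasks_lt i)]

/-- The numbers of the points in the `i`-th set. -/
def setPoints : Fin 5 → List ℕ :=
  ![[3, 4, 5, 6, 10, 14], [1, 7, 8, 12, 13, 15], [0, 2, 6, 10, 13], [3, 5, 6, 7, 8, 15], [0]]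

/-- A quick necessary condition for fixing the `i`-th set. -/
def quick (i : Fin 5) (c : ℕ) : Bool := (setPoints i).all fun n => (setMask i).testBit (ap c n)

lemma quick_of_img {i : Fin 5} {c : ℕ} (h : img c (setMask i) = setMask i) : quick i c := by
  have h1 : ∀ i, ∀ n ∈ setPoints i, n < 16 ∧ (setMask i).testBit n := by decide +kernel
  rw [quick, List.all_eq_true]
  intro n hn
  rw [← h, img_def, testBit_foldr, List.any_eq_true]
  exact ⟨n, List.mem_range.mpr (h1 i n hn).1, by simp [(h1 i n hn).2]⟩

/-- The codes of the elements of the stabilizer of the `i`-th set and family. -/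
def aCodes : Fin 5 → List ℕ :=
  ![[0x9acf74210356edb8, 0x8a0275fdce4631b9, 0x96d2b4f01e5a3c78, 0x861fb52cd34ae079,
     0xdeb874120365a9cf, 0xfe017689ba4532cd, 0xf528c61b934ea07d, 0xd591c4802a6e3b7f,
     0x13b975dfce64a802, 0x23cd7698ba54ef01, 0x24f906db8e53ac71, 0x148d059cfa63eb72,
     0x95c02e7bf3a6481d, 0x96871e0fb4a53c2d, 0xd5f72a08c4e63b19, 0xd6b01a7c83e54f29,
     0xca7106bd8e3542f9, 0x9a8b03127465edfc, 0x95d1f3b72e6a480c, 0xc52bf618d43ae709,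
     0xbe7205c9fa36418d, 0xdefc03217456a98b, 0xb61c852f943ea70d, 0xd69283c71a5e4f0b,
     0x0ef1d32cb54a6897, 0x7ac1942f853e6bd0, 0x0a82931bc64e5fd7, 0x7eb2d418f63a5c90,
     0x0a7dc6b193e45f28, 0x841d2eb7f36a59c0, 0x8a9bcedf75643120, 0x04fb26d915ea37c8,
     0x840cf37b2ea659d1, 0x8697d3c2b5a4e0f1, 0x1427fac90536ebd8, 0x16bcda709e3452f8,
     0xb37fc4082ae65d91, 0xb6d094f285e3a7c1, 0x1320cefd7546a89b, 0x168f9e07da4352cb,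
     0xc32d1ef0b45a6987, 0x7a0d85f294e36b1c, 0xca9f8edb06534217, 0x73bf15d926ea408c,
     0xb3192a80c46e5df7, 0x7e09f681d4a35c2b, 0x73c8269d15ae40fb, 0xbed8fa9c05634127,
     0xf40b837c1ae56d92, 0xf5d793b1c6e4a082, 0x25cb9e70da34618f, 0x24178ebd0635ac9f,
     0xc378b40f1ea569d2, 0xc590d481f6a3e7b2, 0x25f8da079e4361bc, 0x2310ba897645efdc,
     0x0e79b5c2d3a4681f, 0xf4291ac7835e6db0, 0x048c159d26ae37bf, 0xfedcba9876543210],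
    [0xf618a34dc52b907e, 0x807fa25dc43be619, 0xf078b43cd25a961e, 0x861fb52cd34ae079,
     0xca1760bdf924538e, 0x738c629dfb04ea15, 0xc3874b0fd2965a1e, 0x7a1c492fd0b6e385,
     0xdb7106acf953248e, 0x148d059cfa63eb72, 0x1b7d395fc6a0e482, 0xd4813a6fc5902b7e,
     0xdb1760ac8e4235f9, 0x75fd64ec8a029b13, 0x7b1d2e48c0a695f3, 0xd5f72a08c4e63b19,
     0xca7106bd8e3542f9, 0x12fc03ed8b659a74, 0xc2f15b68d3e04a79, 0x1a7c5e38d6b092f4,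
     0xd98c62371540aefb, 0xc98d05417236befa, 0xcefd64571320b98a, 0xdefc03217456a98b,
     0x7ac1942f853e6bd0, 0x7bd1e248f3596ac0, 0x1ac7e538f4290bd6, 0x1bd7935f824e0ac6,
     0xd418a36f7eb209c5, 0x841d2eb7f36a59c0, 0x89cdabef76325410, 0xd9c82637fbea0415,
     0xd57fa20819b36ec4, 0xf57d39b1820a4ec6, 0xfecdab9810234576, 0xdecf30218b9a6574,
     0xf6813a4d7e09b2c5, 0xf2c194a7d0e3b685, 0x12cf30ed74a9568b, 0x168f9e07da4352cb,
     0x86f15b2c790ea4d3, 0x84d1e2b7c095a6f3, 0x16f8e907cb2534da, 0x14d8509c72be36fa,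
     0x80f72a5d196eb3c4, 0x83c7e5a1d692b0f4, 0x73c8269d15ae40fb, 0x70f8e961da5243cb,
     0xf0874b3c1e69a5d2, 0xf5d793b1c6e4a082, 0x708f9e61cb3425da, 0x75df46ec13b9208a,
     0xc378b40f1ea569d2, 0x837c5ea1f40b29d6, 0xc9d85041faeb6372, 0x89dcbaef10452376,
     0xc21fb56879a40ed3, 0xf21c49a7856b3ed0, 0xcedf46578a9b0213, 0xfedcba9876543210],
    [0x4721ed8b9afc3056, 0x8b2156fced47309a, 0xfc219a47568b30ed, 0x4501bafecd893276,
     0x8901cd4576fe32ba, 0xfe017689ba4532cd, 0x4127fa9c8deb3650, 0xeb278d41509c36fa,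
     0x9c2750ebfa41368d, 0x4567cdefba983210, 0x9867ba4510ef32cd, 0xef671098cd4532ba,
     0x41058dc9fabe3672, 0xc90572be8d4136fa, 0xbe05fa4172c9368d, 0x47659ab8edcf3012,
     0xb86512cf9a4730ed, 0xcf65ed4712b8309a, 0x5ba48679e01f3dc2, 0x79a4c21f865b3de0,
     0x1fa4e05bc2793d86, 0x18d4b27e905c3af6, 0x7ed4f65cb2183a90, 0x5cd49018f67e3ab2,
     0x812b4de7f65c3a90, 0xe72b905c4d813af6, 0x5c2bf68190e73a4d, 0x54ab10ef768932cd,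
     0x89ab7654cdef3210, 0xefabcd8910543276, 0x8109f67e4dc53ab2, 0xc5094d81b27e3af6,
     0x7e09b2c5f6813a4d, 0x74a9568b12cf30ed, 0x8ba9edcf56743012, 0xcfa91274ed8b3056,
     0x9768e01f4ab53dc2, 0xb5684a97c21f3de0, 0x1f68c2b5e0973d4a, 0x14d8509c72be36fa,
     0xbed87214fa9c3650, 0x9cd8fabe50143672, 0xe76f4dc590183ab2, 0xc56fb2184de73a90,
     0x186f90e7b2c53a4d, 0x14af72c950eb368d, 0xebaf50148dc93672, 0xc9af8deb72143650,
     0xf10e4ab586793dc2, 0xb50ec2794af13d86, 0x790e86f1c2b53d4a, 0x74de12b856fc309a,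
     0xb8de9afc12743056, 0xfcde56749ab83012, 0xf12c865b4a973de0, 0x972c4af1e05b3d86,
     0x5b2ce09786f13d4a, 0x54dc76fe109832ba, 0x98dc1054bafe3276, 0xfedcba9876543210],
    [0xfca9124765308bde, 0x31b9ce4675fd8a02, 0xf0b4d296783c5a1e, 0x3da40e9768f15bc2,
     0x8bed21475630fc9a, 0x32cdba457689fe01, 0x39e40ad75f826cb1, 0x80c491d57f3b6e2a,
     0x8a20ec4657fd319b, 0xfe10ab45678932dc, 0xf924db06538e71ac, 0x8d149c0563fa72eb,
     0x590ce2b73f6a84d1, 0x5a4bd2c37869f0e1, 0x6e4c91b37f5d80a2, 0x6d0ba1c7385ef492,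
     0x71cabd06358ef942, 0x8b9a12036574fced, 0x84c0e2a63f7b591d, 0x7e904da36f815cb2,
     0x72bec90536fa8d41, 0xfcde210356748ba9, 0x7ad049e358f26bc1, 0xf4b0a1e5387c6d29,
     0x3dc2e01f86795ba4, 0x7ac1942f853e6bd0, 0x39b1a028f57d6ce4, 0x7eb2d418f63a5c90,
     0x6c1ba0d7f582394e, 0x841d2eb7f36a59c0, 0x8a9bcedf75643120, 0x629d40bf738c51ae,
     0x59d12ea6f37b840c, 0x5b4a0e1f68793d2c, 0x72419caf63508dbe, 0x70dabc16f852349e,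
     0x6ea219d5f73b804c, 0x6b0d492f583e7a1c, 0x3102ecdf57648ab9, 0x34adbc25f86170e9,
     0xf01e2dc387695ab4, 0x6b1c94e385f27a0d, 0xf9acbde835607124, 0x62ae04c837fb519d,
     0x802a19b3f75d6ec4, 0x5c2bd4a3f6817e09, 0x51ea04bf378c62d9, 0x8debc9af36507214,
     0x6d921ae5837cf40b, 0x6c4e0a285f7d391b, 0x709ecb258f6134da, 0x7142dbe85360f9ca,
     0x5ae12d96873cf04b, 0x5c094d186f3a7e2b, 0x34e9cb168f5270ad, 0x3201ab986754fecd,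
     0x5b2ce09786f13d4a, 0xf4291ac7835e6db0, 0x51d940c873fb62ea, 0xfedcba9876543210],
    [0x1247fca98bde6530, 0x139bec6457dfa820, 0x1e5a3c7896d2b4f0, 0x1f862cb54ad379e0,
     0x21478bedfc9a5630, 0x23dcab546798ef10, 0x28f51bc64e937da0, 0x2a6e3b7fd591c480,
     0x319b57fdec468a20, 0x32dc6789ab45fe10, 0x35e817ca9f42bd60, 0x36af27bed841c950,
     0x481df3a62e7b95c0, 0x4b5ac3d26978e1f0, 0x4c6eb3915d7fa280, 0x4f2983e51a7cd6b0,
     0x53e89f2417acdb60, 0x5647cfdeb8a92130, 0x591d3f7be2a684c0, 0x5cb26f814da37e90,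
     0x63afd81427eb9c50, 0x6547b89acfed1230, 0x6bc158f249e37ad0, 0x6d29387ca1e5f4b0,
     0x7986a45bc23d1fe0, 0x7ac1942f853e6bd0, 0x7df5e46cb13928a0, 0x7eb2d418f63a5c90,
     0x82f54e391b6cd7a0, 0x841d2eb7f36a59c0, 0x8a9bcedf75643120, 0x8c73ae519d62bf40,
     0x951de26a3fb748c0, 0x9786c2d3a4b5f1e0, 0x9caf72418dbe6350, 0x9e3452f816bcda70,
     0xa26ed5193bf74c80, 0xa7c185e394f2b6d0, 0xa89b7546cefd1320, 0xad3425bc61f8e970,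
     0xb45a6987c32d1ef0, 0xb6c1493e582fa7d0, 0xbde8f9ac71243560, 0xbf73d915ea268c40,
     0xc46e5df7b3192a80, 0xc5b24d3a6f18e790, 0xc8739d26ae15fb40, 0xc9af8deb72143650,
     0xd629a15e38c74fb0, 0xd7f5b193e4c682a0, 0xda34618f25cb9e70, 0xdbe87142f9ca5360,
     0xe15a962d3c874bf0, 0xe7b2f6a3d481c590, 0xe93416cb528fad70, 0xefdc7645ba892310,
     0xf1864a3d2c5b97e0, 0xf4291ac7835e6db0, 0xfb73ea62d951c840, 0xfedcba9876543210]]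

lemma filter_codes : ∀ i, (codes.filter fun c =>
    quick i c && fixesObj c (setMask i) (fiveMasks i)) = aCodes i := by
  decide +kernel

lemma mem_a5Sub_iff {i : Fin 5} {g : T1654} : g ∈ a5Sub i ↔ code g ∈ aCodes i := by
  rw [← filter_codes, List.mem_filter, mem_a5Sub, Bool.and_eq_true]
  refine ⟨fun hg => ⟨code_mem g, quick_of_img ?_, hg⟩, fun hg => hg.2.2⟩
  rw [fixesObj, Bool.and_eq_true, Nat.beq_eq] at hg
  exact hg.1

lemma card_a5Sub (i : Fin 5) : Nat.card (a5Sub i) = 60 := by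
  have h : Nat.card (a5Sub i) = Nat.card {g : T1654 //
      quick i (code g) && fixesObj (code g) (setMask i) (fiveMasks i)} := by
    refine Nat.card_congr (Equiv.subtypeEquivRight fun g => ?_)
    rw [mem_a5Sub_iff, ← filter_codes, List.mem_filter]
    exact ⟨fun h => h.2, fun h => ⟨code_mem g, h⟩⟩
  rw [h, card_subtype_code (fun c => quick i c && fixesObj c (setMask i) (fiveMasks i)),
    filter_codes]
  clear h
  revert i
  decide

lemma index_eq_96 {H : Subgroup T1654} (h : Nat.card H = 60) : H.index = 96 := by
  have := H.card_mul_index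
  rw [h, card_T1654] at this
  omega

/-- The codes of linear permutations which, with the translations, form a transversal of the
stabilizer of the `i`-th family. -/
def movers : Fin 5 → List ℕ :=
  ![[0x1247fca98bde6530, 0x128b47defc65a930, 0x12fc8b6547a9de30, 0x14278dbefac96350,
      0x148dfa6327bec950, 0x182bf6c54d7ea390],
    [0x1247fca98bde6530, 0x128b47defc65a930, 0x12fc8b6547a9de30, 0x148dfa6327bec950,
      0x14fa27c98d63be50, 0x18f64da32bc57e90],
    [0x1247fca98bde6530, 0x14278dbefac96350, 0x182bf6c54d7ea390, 0x1e3c96b45a78d2f0,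
      0x21478bedfc9a5630, 0x3157ec8a9bfd4620],
    [0x1247fca98bde6530, 0x128b47defc65a930, 0x12fc8b6547a9de30, 0x14278dbefac96350,
      0x148dfa6327bec950, 0x182bf6c54d7ea390],
    [0x1247fca98bde6530, 0x128b47defc65a930, 0x12fc8b6547a9de30, 0x14278dbefac96350,
      0x148dfa6327bec950, 0x182bf6c54d7ea390]]

/-- The codes of a transversal of the stabilizer of the `i`-th family. -/
def transversal (i : Fin 5) : List ℕ :=
  (movers i).flatMap fun c => (List.range 16).map fun b => c ^^^ (b * 0x1111111111111111)

/-- The images of the `i`-th set and family. -/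
def conjObjs (i : Fin 5) : List (ℕ × List ℕ) :=
  (transversal i).map fun c => (img c (setMask i), (fiveMasks i).map (img c))

lemma transversal_subset (i : Fin 5) : ∀ c ∈ transversal i, c ∈ codes := by
  have h : ∀ i, ∀ c ∈ movers i, c ∈ linearCodes := by decide +kernel
  intro c hc
  obtain ⟨d, hd, hc⟩ := List.mem_flatMap.mp hc
  exact List.mem_flatMap.mpr ⟨d, h i d hd, hc⟩

/-- A number depending only on the set of the entries of a list. -/
def famKey (F : List ℕ) : ℕ := F.foldr (fun m e => 2 ^ (m % 97) ||| e) 0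

lemma famKey_congr {F F' : List ℕ} (h : ∀ m, m ∈ F ↔ m ∈ F') : famKey F = famKey F' := by
  have key : ∀ (F : List ℕ) (k : ℕ), (famKey F).testBit k = F.any fun m => decide (m % 97 = k) := by
    intro F k
    induction F with
    | nil => simp [famKey]
    | cons m F ih =>
      rw [famKey] at ih ⊢
      rw [List.foldr_cons, Nat.testBit_or, ih, List.any_cons, Nat.testBit_two_pow]
  apply Nat.eq_of_testBit_eq
  intro k
  rw [key, key, Bool.eq_iff_iff]
  simp [h]

/-- Whether the entries of a list are distinct and none is the position of a digit of `e`. -/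
def distinctFrom : List ℕ → ℕ → Bool
  | [], _ => true
  | k :: l, e => !e.testBit k && distinctFrom l (e ||| 2 ^ k)

lemma nodup_of_distinctFrom (l : List ℕ) (e : ℕ) (h : distinctFrom l e) :
    l.Nodup ∧ ∀ k ∈ l, e.testBit k = false := by
  induction l generalizing e with
  | nil => simp
  | cons k l ih =>
    simp only [distinctFrom, Bool.and_eq_true, Bool.not_eq_true'] at h
    obtain ⟨h1, h2⟩ := ih _ h.2
    have h3 : ∀ j ∈ l, e.testBit j = false ∧ k ≠ j := fun j hj => by
      simpa [Nat.testBit_or, Nat.testBit_two_pow] using h2 j hj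
    refine ⟨List.nodup_cons.mpr ⟨fun hk => (h3 k hk).2 rfl, h1⟩, ?_⟩
    intro j hj
    rcases List.mem_cons.mp hj with rfl | hj
    · exact h.1
    · exact (h3 j hj).1

lemma conjObjs_distinct :
    ∀ i, distinctFrom ((conjObjs i).map fun o => famKey o.2 % 4227) 0 := by
  decide +kernel

lemma length_conjObjs : ∀ i, (conjObjs i).length = 96 := by decide +kernel

lemma conjObjs_lt {i : Fin 5} {o : ℕ × List ℕ} (ho : o ∈ conjObjs i) :
    o.1 < 2 ^ 16 ∧ ∀ m ∈ o.2, m < 2 ^ 16 := by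
  obtain ⟨c, -, rfl⟩ := List.mem_map.mp ho
  refine ⟨img_lt _ _, fun m hm => ?_⟩
  obtain ⟨k, -, rfl⟩ := List.mem_map.mp hm
  exact img_lt _ _

lemma smul_objOf (g : T1654) (S : ℕ) (F : List ℕ) :
    g • objOf S F = objOf (img (code g) S) (F.map (img (code g))) := by
  rw [objOf, Prod.smul_mk, smul_ofMask, smul_famOf, objOf]

lemma exists_smul_of_mem_conjObjs {i : Fin 5} {o : ℕ × List ℕ} (ho : o ∈ conjObjs i) :
    ∃ g : T1654, g • objOf (setMask i) (fiveMasks i) = objOf o.1 o.2 := by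
  obtain ⟨c, hc, rfl⟩ := List.mem_map.mp ho
  obtain ⟨g, rfl⟩ := exists_code_eq (transversal_subset i c hc)
  exact ⟨g, smul_objOf g _ _⟩

/-- The listed images exhaust the orbit: there are `96` distinct ones. -/
lemma exists_mem_conjObjs (i : Fin 5) (g : T1654) :
    ∃ o ∈ conjObjs i, g • objOf (setMask i) (fiveMasks i) = objOf o.1 o.2 := by
  have hsub : (((conjObjs i).map fun o => objOf o.1 o.2).toFinset : Set _) ⊆
      MulAction.orbit T1654 (objOf (setMask i) (fiveMasks i)) := by
    intro S hS
    simp only [List.coe_toFinset, List.mem_map, Set.mem_ofPred_eq] at hS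
    obtain ⟨o, ho, rfl⟩ := hS
    exact exists_smul_of_mem_conjObjs ho
  have hnodup : ((conjObjs i).map fun o => objOf o.1 o.2).Nodup := by
    have h := (nodup_of_distinctFrom _ _ (conjObjs_distinct i)).1
    rw [List.Nodup, List.pairwise_map] at h ⊢
    refine h.imp_of_mem fun {o o'} ho ho' h e => h ?_
    have e' : famOf o.2 = famOf o'.2 := congrArg Prod.snd e
    have hiff : ∀ m < 2 ^ 16, (m ∈ o.2 ↔ m ∈ o'.2) := fun m hm => by
      rw [← ofMask_mem_famOf (conjObjs_lt ho).2 hm, e', ofMask_mem_famOf (conjObjs_lt ho').2 hm]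
    rw [famKey_congr (F' := o'.2) fun m =>
      ⟨fun hm => (hiff m ((conjObjs_lt ho).2 m hm)).mp hm,
        fun hm => (hiff m ((conjObjs_lt ho').2 m hm)).mpr hm⟩]
  have hcard : (MulAction.orbit T1654 (objOf (setMask i) (fiveMasks i))).ncard = 96 := by
    rw [← Nat.card_coe_set_eq, Nat.card_congr (MulAction.orbitEquivQuotientStabilizer T1654 _)]
    exact index_eq_96 (card_a5Sub i)
  have heq := Set.eq_of_subset_of_ncard_le hsub (by
    rw [hcard, Set.ncard_coe_finset, List.toFinset_card_of_nodup hnodup, List.length_map,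
      length_conjObjs])
  have hg : g • objOf (setMask i) (fiveMasks i) ∈
      MulAction.orbit T1654 (objOf (setMask i) (fiveMasks i)) := ⟨g, rfl⟩
  rw [← heq] at hg
  simp only [List.coe_toFinset, List.mem_map, Set.mem_ofPred_eq] at hg
  obtain ⟨o, ho, e⟩ := hg
  exact ⟨o, ho, e.symm⟩

/-! ### Generators of the alternating group of degree five -/

lemma alternatingGroup_five_eq_top {K : Subgroup (alternatingGroup (Fin 5))}
    (h : 30 ∣ Nat.card K) : K = ⊤ := by
  have hc : Nat.card (alternatingGroup (Fin 5)) = 60 := by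
    rw [nat_card_alternatingGroup]; simp [Nat.factorial]
  have hm := K.card_mul_index
  rw [hc] at hm
  obtain ⟨m, hm'⟩ := h
  have hi : K.index = 1 ∨ K.index = 2 := by
    rw [hm', mul_assoc] at hm
    have h2 : m * K.index = 2 := by omega
    have : K.index ≤ 2 := Nat.le_of_dvd (by norm_num) ⟨m, by rw [← h2, mul_comm]⟩
    have h0 : K.index ≠ 0 := fun h0 => by simp [h0] at h2
    omega
  rcases hi with hi | hi
  · exact Subgroup.index_eq_one.mp hi
  · have := Subgroup.normal_of_index_eq_two hi
    have hs := alternatingGroup.isSimpleGroup (α := Fin 5) (by simp)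
    rcases hs.eq_bot_or_eq_top_of_normal K this with h | h
    · rw [h, Subgroup.index_bot, hc] at hi
      omega
    · exact h

/-- An involution of `A₅`. -/
def genTwo : alternatingGroup (Fin 5) :=
  ⟨Equiv.swap 0 1 * Equiv.swap 2 3, Equiv.Perm.mem_alternatingGroup.mpr (by decide +kernel)⟩

/-- An element of `A₅` of order `3` whose product with the involution `genTwo` has order `5`. -/
def genThree : alternatingGroup (Fin 5) :=
  ⟨Equiv.swap 0 2 * Equiv.swap 2 4, Equiv.Perm.mem_alternatingGroup.mpr (by decide +kernel)⟩

lemma genTwo_sq : genTwo ^ 2 = 1 := by decide +kernel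
lemma genTwo_ne_one : genTwo ≠ 1 := by decide +kernel
lemma genThree_pow : genThree ^ 3 = 1 := by decide +kernel
lemma genThree_ne_one : genThree ≠ 1 := by decide +kernel
lemma gen_mul_pow : (genTwo * genThree) ^ 5 = 1 := by decide +kernel
lemma gen_mul_ne_one : genTwo * genThree ≠ 1 := by decide +kernel

lemma closure_gens : Subgroup.closure {genTwo, genThree} = ⊤ := by
  apply alternatingGroup_five_eq_top
  set K := Subgroup.closure {genTwo, genThree}
  have h2 : genTwo ∈ K := Subgroup.subset_closure (by simp)
  have h3 : genThree ∈ K := Subgroup.subset_closure (by simp)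
  have key : ∀ {g : alternatingGroup (Fin 5)} {p : ℕ}, p.Prime → g ∈ K → g ^ p = 1 → g ≠ 1 →
      p ∣ Nat.card K := fun {g p} hp hg h1 hne => by
    have : Fact p.Prime := ⟨hp⟩
    rw [← orderOf_eq_prime h1 hne]
    exact Subgroup.orderOf_dvd_natCard K hg
  have d2 := key Nat.prime_two h2 genTwo_sq genTwo_ne_one
  have d3 := key Nat.prime_three h3 genThree_pow genThree_ne_one
  have d5 := key Nat.prime_five (K.mul_mem h2 h3) gen_mul_pow gen_mul_ne_one
  omega

/-! ### Elements of order three -/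

/-- The codes of the elements of a Sylow `3`-subgroup. -/
def sylowCodes : List ℕ :=
  [0xfedcba9876543210,
   0x79a4c21f865b3de0, 0x812b4de7f65c3a90, 0xfdb9eca875316420, 0x7ac1942f853e6bd0,
   0x824e1bd7f5396ca0, 0xfbead9c873625140, 0x7c92a14f836d5eb0, 0x841d2eb7f36a59c0]

/-- The codes of representatives of the classes of elements of order `3`. -/
def orderThreeCodes : List ℕ := [0x79a4c21f865b3de0, 0x7ac1942f853e6bd0]

lemma sylowCodes_conj : ∀ y ∈ sylowCodes, y = 0xfedcba9876543210 ∨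
    ∃ r ∈ orderThreeCodes, ∃ c ∈ linearCodes, mulCode c y = mulCode r c := by
  decide +kernel

lemma sylowCodes_subset : ∀ c ∈ sylowCodes, c ∈ linearCodes := by decide +kernel

lemma mem_codes_of_mem_linearCodes {c : ℕ} (hc : c ∈ linearCodes) : c ∈ codes :=
  List.mem_flatMap.mpr ⟨c, hc, List.mem_map.mpr ⟨0, by simp, by simp⟩⟩

lemma sylowCodes_mul : ∀ x ∈ sylowCodes, ∀ y ∈ sylowCodes, mulCode x y ∈ sylowCodes := by
  decide +kernel

lemma sylowCodes_cube : ∀ x ∈ sylowCodes, mulCode x (mulCode x x) = 0xfedcba9876543210 := by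
  decide +kernel

lemma eq_one_of_code {g : T1654} (h : code g = 0xfedcba9876543210) : g = 1 :=
  code_injective (h.trans code_one.symm)

/-- A Sylow `3`-subgroup. -/
def sylowThree : Subgroup T1654 where
  carrier := {g | code g ∈ sylowCodes}
  one_mem' := by simp [code_one, sylowCodes]
  mul_mem' := fun {g h} hg hh => by
    simpa [code_mul] using sylowCodes_mul _ hg _ hh
  inv_mem' := fun {g} hg => by
    have h : g * (g * g) = 1 := eq_one_of_code (by
      rw [code_mul, code_mul]; exact sylowCodes_cube _ hg)
    have h' : g⁻¹ = g * g := inv_eq_of_mul_eq_one_right h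
    simpa [h', code_mul] using sylowCodes_mul _ hg _ hg

lemma card_sylowThree : Nat.card sylowThree = 9 := by
  have hinj : code '' (sylowThree : Set T1654) = (sylowCodes.toFinset : Set ℕ) := by
    ext c
    simp only [Set.mem_image, List.coe_toFinset, Set.mem_ofPred_eq]
    constructor
    · rintro ⟨g, hg, rfl⟩
      exact hg
    · intro hc
      obtain ⟨g, rfl⟩ := exists_code_eq (mem_codes_of_mem_linearCodes (sylowCodes_subset c hc))
      exact ⟨g, hc, rfl⟩
  have h1 : (sylowThree : Set T1654).ncard = Nat.card sylowThree := (Nat.card_coe_set_eq _).symm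
  rw [← h1, ← Set.ncard_image_of_injective _ code_injective, hinj, Set.ncard_coe_finset]
  decide +kernel

lemma exists_conj_orderThree {y : T1654} (hy : y ^ 3 = 1) (hy1 : y ≠ 1) :
    ∃ g : T1654, code (g * y * g⁻¹) ∈ orderThreeCodes := by
  have : Fact (Nat.Prime 3) := ⟨Nat.prime_three⟩
  have h9 : Nat.card sylowThree = 3 ^ (Nat.card T1654).factorization 3 := by
    rw [card_sylowThree, card_T1654]
    have : (5760 : ℕ) = 3 ^ 2 * 640 := by norm_num
    rw [this, Nat.factorization_mul (by norm_num) (by norm_num), Finsupp.add_apply,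
      Nat.Prime.factorization_pow Nat.prime_three,
      Nat.factorization_eq_zero_of_not_dvd (n := 640) (by norm_num)]
    simp
  have hp : IsPGroup 3 (Subgroup.zpowers y) := by
    apply IsPGroup.of_card (n := 1)
    rw [Nat.card_zpowers, orderOf_eq_prime hy hy1, pow_one]
  obtain ⟨Q, hQ⟩ := hp.exists_le_sylow
  obtain ⟨g, hg⟩ := MulAction.exists_smul_eq T1654 Q (Sylow.ofCard sylowThree h9)
  have hmem : g * y * g⁻¹ ∈ sylowThree := by
    have h1 : g * y * g⁻¹ ∈ ((g • Q : Sylow 3 T1654) : Subgroup T1654) := by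
      rw [Sylow.coe_subgroup_smul]
      exact Subgroup.smul_mem_pointwise_smul y (MulAut.conj g) Q
        (hQ (Subgroup.mem_zpowers y))
    rw [hg, Sylow.coe_ofCard] at h1
    exact h1
  rcases sylowCodes_conj _ hmem with h | ⟨r, hr, c, hc, h⟩
  · exact absurd (by simpa using eq_one_of_code h) hy1
  · obtain ⟨k, rfl⟩ := exists_code_eq (mem_codes_of_mem_linearCodes hc)
    have hsub : ∀ r ∈ orderThreeCodes, r ∈ linearCodes := by decide +kernel
    obtain ⟨z, rfl⟩ := exists_code_eq (mem_codes_of_mem_linearCodes (hsub r hr))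
    rw [← code_mul, ← code_mul] at h
    refine ⟨k * g, ?_⟩
    have : k * g * y * (k * g)⁻¹ = z := by
      have := code_injective h
      rw [mul_inv_rev, eq_comm, ← mul_inv_eq_iff_eq_mul.mpr this]
      group
    rwa [this]

/-! ### The classes of subgroups isomorphic to `A₅` -/

/-- Whether two permutations have a common fixed object in one of the five orbits. -/
def commonObj (x y : ℕ) : Bool :=
  (List.finRange 5).any fun i =>
    ((conjObjs i).filter fun o => fixesObj y o.1 o.2).any fun o => fixesObj x o.1 o.2

/-- The fifth power on codes. -/
def powFive (c : ℕ) : ℕ := mulCode c (mulCode (mulCode c c) (mulCode c c))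

lemma forall_commonObj : codes.all (fun x => !(Nat.beq (mulCode x x) 0xfedcba9876543210) ||
    Nat.beq x 0xfedcba9876543210 || orderThreeCodes.all fun y =>
      !(Nat.beq (powFive (mulCode x y)) 0xfedcba9876543210) || commonObj x y) = true := by
  decide +kernel

lemma exists_commonObj {x y : T1654} (hx : x * x = 1) (hx1 : x ≠ 1)
    (hy : code y ∈ orderThreeCodes) (hxy : x * y * (x * y * (x * y) * (x * y * (x * y))) = 1) :
    commonObj (code x) (code y) := by
  have key : ∀ (l r : List ℕ) (e : ℕ) (q : ℕ → ℕ → Bool), l.all (fun x =>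
      !(Nat.beq (mulCode x x) e) || Nat.beq x e || r.all fun y =>
      !(Nat.beq (powFive (mulCode x y)) e) || q x y) = true →
      ∀ x ∈ l, mulCode x x = e → x ≠ e → ∀ y ∈ r, powFive (mulCode x y) = e → q x y = true := by
    intro l r e q h x hx h2 h1 y hy h5
    have h3 := List.all_eq_true.mp h x hx
    have h1' : Nat.beq x e = false := by
      rw [Bool.eq_false_iff, Ne, Nat.beq_eq]
      exact h1
    rw [h2, Nat.beq_refl, h1', Bool.not_true, Bool.false_or, Bool.false_or] at h3
    have h4 := List.all_eq_true.mp h3 y hy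
    rwa [h5, Nat.beq_refl, Bool.not_true, Bool.false_or] at h4
  refine key _ _ _ _ forall_commonObj _ (code_mem x) ?_ (fun h => hx1 (eq_one_of_code h)) _ hy ?_
  · rw [← code_mul, hx, code_one]
  · rw [powFive, ← code_mul, ← code_mul, ← code_mul, ← code_mul, hxy, code_one]

lemma conj_of_fixed {H : Subgroup T1654} (hH : Nat.card H = 60) {i : Fin 5} {g : T1654}
    (h : ∀ x ∈ H, x • g • objOf (setMask i) (fiveMasks i) = g • objOf (setMask i) (fiveMasks i)) :
    ConjSubgroups H (a5Sub i) := by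
  refine ⟨g⁻¹, Subgroup.eq_of_le_of_card_ge ?_ ?_⟩
  · rintro _ ⟨x, hx, rfl⟩
    have := h x hx
    simp only [MulEquiv.toMonoidHom_eq_coe, MonoidHom.coe_coe, MulAut.conj_apply, a5Sub, inv_inv,
      MulAction.mem_stabilizer_iff, mul_smul] at this ⊢
    rw [this, inv_smul_smul]
  · rw [card_a5Sub, Subgroup.card_map_of_injective (MulAut.conj g⁻¹).injective, hH]

lemma exists_conj_a5Sub {H : Subgroup T1654} (e : H ≃* alternatingGroup (Fin 5)) :
    ∃ i, ConjSubgroups H (a5Sub i) := by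
  have hcard : Nat.card H = 60 := by
    rw [Nat.card_congr e.toEquiv, nat_card_alternatingGroup]; simp [Nat.factorial]
  set x : H := e.symm genTwo
  set y : H := e.symm genThree
  have hgen : Subgroup.closure {x, y} = ⊤ := by
    have := congrArg (Subgroup.map e.symm.toMonoidHom) closure_gens
    rw [MonoidHom.map_closure, Set.image_pair,
      Subgroup.map_top_of_surjective _ e.symm.surjective] at this
    exact this
  have hx : (x : T1654) ^ 2 = 1 := by
    rw [← Subgroup.coe_pow, ← map_pow, genTwo_sq, map_one, Subgroup.coe_one]
  have hx1 : (x : T1654) ≠ 1 := by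
    simpa [x] using genTwo_ne_one
  have hy : (y : T1654) ^ 3 = 1 := by
    rw [← Subgroup.coe_pow, ← map_pow, genThree_pow, map_one, Subgroup.coe_one]
  have hy1 : (y : T1654) ≠ 1 := by
    simpa [y] using genThree_ne_one
  have hxy : ((x : T1654) * y) ^ 5 = 1 := by
    rw [← Subgroup.coe_mul, ← Subgroup.coe_pow, ← map_mul, ← map_pow, gen_mul_pow, map_one,
      Subgroup.coe_one]
  obtain ⟨g, hg⟩ := exists_conj_orderThree hy hy1
  have hsq : (g * x * g⁻¹) * (g * x * g⁻¹) = 1 := by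
    rw [← sq, conj_pow, hx]; group
  have hfive : (g * x * g⁻¹) * (g * y * g⁻¹) = g * (x * y) * g⁻¹ := by group
  have hfive' : (g * (x * y) * g⁻¹ : T1654) ^ 5 = 1 := by rw [conj_pow, hxy]; group
  have h := exists_commonObj hsq (fun hc => hx1 (by simpa using hc)) hg (by
    rw [hfive, ← hfive']
    simp only [pow_succ, pow_zero, one_mul, mul_assoc])
  simp only [commonObj, List.any_eq_true, List.mem_filter] at h
  obtain ⟨i, -, o, ⟨ho, hoy⟩, hox⟩ := h
  obtain ⟨t, ht⟩ := exists_smul_of_mem_conjObjs ho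
  rw [← smul_objOf_eq_iff (conjObjs_lt ho).1 (conjObjs_lt ho).2, ← ht] at hox hoy
  refine ⟨i, conj_of_fixed hcard (g := g⁻¹ * t) fun z hz => ?_⟩
  have hle : H ≤ MulAction.stabilizer T1654
      ((g⁻¹ * t) • objOf (setMask i) (fiveMasks i)) := by
    have hsub : (⊤ : Subgroup H) ≤ (MulAction.stabilizer T1654
        ((g⁻¹ * t) • objOf (setMask i) (fiveMasks i))).subgroupOf H := by
      rw [← hgen, Subgroup.closure_le]
      have aux : ∀ w : T1654, (g * w * g⁻¹) • t • objOf (setMask i) (fiveMasks i) =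
          t • objOf (setMask i) (fiveMasks i) → w • (g⁻¹ * t) • objOf (setMask i) (fiveMasks i) =
          (g⁻¹ * t) • objOf (setMask i) (fiveMasks i) := by
        intro w hw
        rw [mul_smul, eq_inv_smul_iff, smul_smul, smul_smul]
        exact hw
      rintro w (rfl | rfl)
      · exact aux _ hox
      · exact aux _ hoy
    intro w hw
    exact hsub (x := ⟨w, hw⟩) trivial
  exact hle hz

/-! ### The stabilizers of order sixty are alternating groups -/

lemma length_fiveMasks : ∀ i, (fiveMasks i).length = 5 ∧ (fiveMasks i).Nodup := by decide +kernel

lemma card_famOf (i : Fin 5) : (famOf (fiveMasks i)).card = 5 := by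
  rw [famOf, List.toFinset_card_of_nodup, List.length_map, (length_fiveMasks i).1]
  exact (List.nodup_map_iff_inj_on (length_fiveMasks i).2).mpr fun m hm k hk h =>
    ofMask_injOn (fiveMasks_lt i m hm) (fiveMasks_lt i k hk) h

/-- The family of five sets, with the action of its stabilizer. -/
def fivePoints (i : Fin 5) : SubMulAction (a5Sub i) (Finset Pt) where
  carrier := famOf (fiveMasks i)
  smul_mem' := fun g S hS => by
    have hg : (g : T1654) • famOf (fiveMasks i) = famOf (fiveMasks i) :=
      congrArg Prod.snd (MulAction.mem_stabilizer_iff.mp g.2)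
    rw [Finset.mem_coe] at hS ⊢
    rw [← hg]
    exact Finset.smul_mem_smul_finset hS

noncomputable instance (i : Fin 5) : Fintype (fivePoints i) :=
  inferInstanceAs (Fintype (famOf (fiveMasks i) : Set (Finset Pt)))

lemma card_fivePoints (i : Fin 5) : Nat.card (fivePoints i) = 5 := by
  rw [← card_famOf i]
  exact Nat.card_eq_fintype_card.trans (Fintype.card_coe _)

lemma eq_one_of_fixes_five : ∀ i, ∀ c ∈ aCodes i,
    ((fiveMasks i).all fun m => Nat.beq (img c m) m) → c = 0xfedcba9876543210 := by
  decide +kernel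

lemma toPermHom_fivePoints_injective (i : Fin 5) :
    Function.Injective (MulAction.toPermHom (a5Sub i) (fivePoints i)) := by
  rw [injective_iff_map_eq_one]
  intro g hg
  refine Subtype.ext (eq_one_of_code (eq_one_of_fixes_five i _ (mem_a5Sub_iff.mp g.2) ?_))
  rw [List.all_eq_true]
  intro m hm
  have hmem : ofMask m ∈ fivePoints i := (ofMask_mem_famOf (fiveMasks_lt i) (fiveMasks_lt i m hm)).mpr hm
  have := congrArg Subtype.val (Equiv.congr_fun hg ⟨ofMask m, hmem⟩)
  rw [Nat.beq_eq]
  exact (smul_ofMask_eq_iff (fiveMasks_lt i m hm) _).mp this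

lemma nonempty_a5Sub_mulEquiv (i : Fin 5) : Nonempty (a5Sub i ≃* alternatingGroup (Fin 5)) := by
  classical
  set f := MulAction.toPermHom (a5Sub i) (fivePoints i)
  have hf := toPermHom_fivePoints_injective i
  have e : fivePoints i ≃ Fin 5 := Finite.equivFinOfCardEq (card_fivePoints i)
  have hrange : f.range = alternatingGroup (fivePoints i) := by
    apply Equiv.Perm.eq_alternatingGroup_of_index_eq_two
    have h := f.range.card_mul_index
    rw [← Nat.card_congr (MonoidHom.ofInjective hf).toEquiv, card_a5Sub, Nat.card_perm,
      card_fivePoints] at h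
    have : Nat.factorial 5 = 120 := rfl
    omega
  exact ⟨(MonoidHom.ofInjective hf).trans
    ((MulEquiv.subgroupCongr hrange).trans (Equiv.altCongrHom e))⟩

/-! ### Proper subgroups without a counterpart in another class -/

/-- The codes of two generators of a Klein four-subgroup of the `i`-th stabilizer. -/
def kleinGens : Fin 5 → ℕ × ℕ :=
  ![(0xbed8fa9c05634127, 0x8a9bcedf75643120), (0xc21fb56879a40ed3, 0xf21c49a7856b3ed0),
    (0xf12c865b4a973de0, 0xc9af8deb72143650), (0x8debc9af36507214, 0x8a9bcedf75643120),
    (0xc9af8deb72143650, 0x8a9bcedf75643120)]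

lemma kleinGens_mem : ∀ i, (kleinGens i).1 ∈ aCodes i ∧ (kleinGens i).2 ∈ aCodes i ∧
    mulCode (kleinGens i).1 (kleinGens i).2 = mulCode (kleinGens i).2 (kleinGens i).1 := by
  decide +kernel

lemma kleinGens_moves : ∀ i j, i ≠ j → ¬ (i = 0 ∧ j = 1 ∨ i = 1 ∧ j = 0) → ∀ o ∈ conjObjs j,
    (fixesFam (kleinGens i).1 o.2 && fixesFam (kleinGens i).2 o.2) = false := by
  decide +kernel

lemma smul_objOf_of_conj {K : Subgroup T1654} {j : Fin 5} (h : ∃ K' ≤ a5Sub j, ConjSubgroups K K') :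
    ∃ o ∈ conjObjs j, ∀ k ∈ K, fixesObj (code k) o.1 o.2 := by
  obtain ⟨_, hK', g, rfl⟩ := h
  obtain ⟨o, ho, e⟩ := exists_mem_conjObjs j g⁻¹
  refine ⟨o, ho, fun k hk => ?_⟩
  rw [← smul_objOf_eq_iff (conjObjs_lt ho).1 (conjObjs_lt ho).2, ← e]
  have : g * k * g⁻¹ ∈ a5Sub j := hK' ⟨k, hk, rfl⟩
  rw [a5Sub, MulAction.mem_stabilizer_iff] at this
  rw [eq_inv_smul_iff, smul_smul, smul_smul]
  exact this

/-- The subgroup of the `i`-th stabilizer generated by two commuting involutions. -/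
lemma exists_klein (i : Fin 5) : ∃ K < a5Sub i, ∀ j, i ≠ j → ¬ (i = 0 ∧ j = 1 ∨ i = 1 ∧ j = 0) →
    ¬ ∃ K' ≤ a5Sub j, ConjSubgroups K K' := by
  obtain ⟨h1, h2, h12⟩ := kleinGens_mem i
  have hcodes : ∀ c ∈ aCodes i, ∃ g ∈ a5Sub i, code g = c := fun c hc => by
    rw [← filter_codes] at hc
    obtain ⟨g, rfl⟩ := exists_code_eq (List.mem_filter.mp hc).1
    rw [filter_codes] at hc
    exact ⟨g, mem_a5Sub_iff.mpr hc, rfl⟩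
  obtain ⟨a, ha, ea⟩ := hcodes _ h1
  obtain ⟨b, hb, eb⟩ := hcodes _ h2
  have hab : a * b = b * a := code_injective (by rw [code_mul, code_mul, ea, eb, h12])
  refine ⟨Subgroup.closure {a, b}, lt_of_le_of_ne ?_ ?_, ?_⟩
  · rw [Subgroup.closure_le]
    rintro x (rfl | rfl)
    exacts [ha, hb]
  · intro h
    obtain ⟨e⟩ := nonempty_a5Sub_mulEquiv i
    have hc : ∀ x ∈ Subgroup.closure {a, b}, ∀ y ∈ Subgroup.closure {a, b}, x * y = y * x := by
      have := Subgroup.isMulCommutative_closure (k := {a, b}) (by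
        rintro x (rfl | rfl) y (rfl | rfl)
        exacts [rfl, hab, hab.symm, rfl])
      intro x hx y hy
      exact congrArg Subtype.val (mul_comm' (⟨x, hx⟩ : Subgroup.closure {a, b}) ⟨y, hy⟩)
    rw [h] at hc
    have : genTwo * genThree ≠ genThree * genTwo := by decide +kernel
    apply this
    have h3 := hc _ (e.symm genTwo).2 _ (e.symm genThree).2
    apply e.symm.injective
    rw [map_mul, map_mul]
    exact Subtype.ext h3
  · intro j hij hne h
    obtain ⟨o, ho, hk⟩ := smul_objOf_of_conj h
    have := kleinGens_moves i j hij hne o ho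
    have ka := hk a (Subgroup.subset_closure (by simp))
    have kb := hk b (Subgroup.subset_closure (by simp))
    rw [fixesObj, Bool.and_eq_true, ea] at ka
    rw [fixesObj, Bool.and_eq_true, eb] at kb
    rw [ka.2, kb.2] at this
    exact absurd this (by decide)

/-! ### Two orbits of sets of six points -/

/-- The two orbits of sets of six points: for `i = 0, 1`, the masks of the images of the `i`-th
set. -/
def hexads : Fin 5 → List ℕ :=
  ![[30788, 46216, 53777, 57634, 34628, 19336, 11537, 7714, 17528, 34996, 4562, 8929, 17543,
     34891, 4397, 8734, 5348, 10456, 16817, 33394, 16718, 33421, 5147, 10279, 58388, 55336, 45377,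
     29314, 20033, 36226, 6932, 10024, 11908, 7496, 35617, 18194, 57928, 53636, 47122, 29729,
     33838, 18461, 8587, 4679, 18658, 34001, 4792, 8564, 13904, 14752, 51536, 50848, 25349, 37642,
     39941, 27658, 20534, 41017, 20681, 41158, 1379, 2707, 1436, 2668, 23696, 44128, 21344, 41872,
     50441, 51718, 13574, 14857, 36956, 24748, 24659, 37027, 2501, 1738, 1589, 2362, 26048, 39616,
     38192, 27184, 22028, 43276, 22787, 42499, 49253, 49306, 12437, 12394, 3158, 3241, 857, 934],
    [922, 869, 3178, 3221, 12457, 12374, 49318, 49241, 39427, 25859, 27148, 38156, 43312, 22064,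
     42688, 22976, 51466, 50693, 13834, 14597, 40096, 27728, 25504, 37712, 2761, 1478, 2614, 1337,
     41116, 20588, 41059, 20627, 36922, 24629, 24778, 37061, 2467, 1619, 1708, 2396, 14992, 13664,
     51808, 50576, 41737, 21254, 44038, 23561, 8494, 4637, 33931, 18503, 4834, 8657, 18616, 33908,
     11809, 7442, 35716, 18248, 57874, 53537, 47176, 29828, 34594, 19217, 11656, 7748, 30754,
     46097, 53896, 57668, 8839, 4427, 34861, 17438, 8824, 4532, 35026, 17633, 33358, 16781, 10267,
     5159, 10468, 5336, 33457, 16754, 20098, 36161, 6952, 10004, 58408, 55316, 45442, 29249],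
    [], [], []]

/-- Representatives of the orbits of the stabilizer of the first set on the second orbit. -/
def hexadReps : Fin 5 → ℕ := ![8839, 2467, 1619, 1337, 869]

/-- The `k`-th list defines a bijection of the first orbit with the second one; it is equivariant
under the common stabilizer of the first set and the `k`-th representative. -/
def partners : Fin 3 → List ℕ :=
  ![[7748, 46097, 53896, 34594, 57668, 19217, 11656, 30754, 8839, 35026, 4532, 17633, 17438,
     34861, 4427, 8824, 29828, 10468, 16781, 57874, 8494, 58408, 5159, 18616, 41116, 39427, 53537,
     20588, 2761, 51466, 6952, 25504, 3178, 14597, 36161, 922, 42688, 38156, 47176, 12457, 33358,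
     18503, 18248, 5336, 20098, 33931, 4834, 10004, 29249, 22976, 35716, 33457, 16754, 37712,
     55316, 10267, 12374, 41059, 20627, 49241, 25859, 27728, 1478, 27148, 23561, 51808, 13664,
     41737, 50576, 44038, 21254, 14992, 36922, 1619, 1708, 37061, 2467, 24629, 24778, 2396, 8657,
     40096, 45442, 11809, 4637, 43312, 7442, 33908, 50693, 49318, 22064, 13834, 2614, 3221, 869,
     1337],
    [14597, 45442, 39427, 5336, 35716, 33908, 20588, 49241, 2467, 18248, 58408, 17438, 8824,
     22064, 27728, 8839, 7748, 10468, 50576, 20098, 8494, 33358, 33931, 3178, 44038, 7442, 47176,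
     6952, 36161, 24629, 4834, 13834, 10004, 11656, 1337, 34594, 41737, 5159, 46097, 4427, 38156,
     10267, 51808, 4532, 24778, 33457, 4637, 16781, 14992, 18616, 19217, 35026, 27148, 53896,
     49318, 30754, 55316, 41116, 12457, 34861, 1619, 13664, 922, 3221, 40096, 42688, 29249, 11809,
     53537, 50693, 29828, 25504, 37061, 8657, 18503, 17633, 36922, 1478, 2761, 2396, 22976, 37712,
     51466, 57874, 21254, 41059, 1708, 43312, 57668, 20627, 12374, 25859, 2614, 23561, 869, 16754],
    [20588, 58408, 53537, 5336, 35716, 33908, 14597, 6952, 1619, 18616, 45442, 25504, 16781,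
     51466, 27728, 8494, 4834, 10267, 33457, 51808, 18503, 41116, 36922, 10468, 50693, 39427,
     41059, 29828, 23561, 20098, 4637, 13834, 12457, 7442, 34594, 1337, 42688, 37061, 34861,
     22064, 38156, 17438, 922, 50576, 35026, 21254, 4532, 10004, 2467, 14992, 36161, 17633, 25859,
     4427, 53896, 11656, 12374, 46097, 22976, 27148, 18248, 13664, 1478, 3178, 20627, 11809,
     29249, 57874, 33931, 55316, 5159, 47176, 33358, 8839, 24629, 40096, 2761, 24778, 1708, 2614,
     8657, 30754, 37712, 43312, 7748, 44038, 19217, 2396, 57668, 49241, 49318, 8824, 41737, 3221,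
     16754, 869]]

/-- For two members `a`, `b` of the family of five sets, a set `r` in the other orbit that is fixed
by the setwise stabilizer of `{a, b}`. -/
def pairHexads : Fin 5 → List (ℕ × ℕ × ℕ) :=
  ![[(8839, 14597, 24629), (8839, 35716, 1708), (8839, 39427, 1619), (8839, 45442, 24778),
     (14597, 35716, 2396), (14597, 39427, 23561), (14597, 45442, 13664), (35716, 39427, 51808),
     (35716, 45442, 50576), (39427, 45442, 36922)],
    [(1589, 2668, 934), (1589, 17528, 38192), (1589, 18461, 12437), (1589, 20033, 42499),
     (2668, 17528, 12394), (2668, 18461, 43276), (2668, 20033, 39616), (17528, 18461, 49306),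
     (17528, 20033, 26048), (18461, 20033, 22787)],
    [], [], []]

/-- The number of points in the set with mask `m`. -/
def popCount (m : ℕ) : ℕ := (List.range 16).countP m.testBit

lemma card_ofMask (m : ℕ) : (ofMask m).card = popCount m := by
  have h : (ofMask m).card = (((List.range 16).filter m.testBit).map ptOf).toFinset.card := by
    congr 1
    ext w
    simp only [mem_ofMask, List.mem_toFinset, List.mem_map, List.mem_filter, List.mem_range]
    constructor
    · exact fun hw => ⟨ptCode w, ⟨ptCode_lt w, hw⟩, ptOf_ptCode w⟩
    · rintro ⟨n, ⟨hn, hm⟩, rfl⟩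
      rwa [ptCode_ptOf hn]
  rw [h, List.toFinset_card_of_nodup, List.length_map, popCount, List.countP_eq_length_filter]
  refine (List.nodup_map_iff_inj_on (List.nodup_range.filter _)).mpr fun a ha b hb hab => ?_
  rw [← ptCode_ptOf (List.mem_range.mp (List.mem_filter.mp ha).1), hab,
    ptCode_ptOf (List.mem_range.mp (List.mem_filter.mp hb).1)]

lemma ofMask_inter (a b : ℕ) : ofMask a ∩ ofMask b = ofMask (a &&& b) := by
  ext w
  simp [mem_ofMask, Nat.testBit_and]

lemma card_inter_ofMask (a b : ℕ) : (ofMask a ∩ ofMask b).card = popCount (a &&& b) := by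
  rw [ofMask_inter, card_ofMask]

lemma card_smul_inter (g : T1654) (S T : Finset Pt) : (g • S ∩ g • T).card = (S ∩ T).card := by
  rw [← Finset.smul_finset_inter, Finset.card_smul_finset]

lemma map_transversal_eq_hexads : ∀ i, i = 0 ∨ i = 1 →
    ((transversal i).map fun c => img c (setMask i)) = hexads i := by
  decide +kernel

lemma hexads_distinct : ∀ i, distinctFrom (hexads i) 0 := by decide +kernel

lemma hexads_lt : ∀ i, ∀ m ∈ hexads i, m < 2 ^ 16 := by decide +kernel

lemma hexads_nodup (i : Fin 5) : (hexads i).Nodup :=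
  (nodup_of_distinctFrom _ _ (hexads_distinct i)).1

lemma length_hexads : ∀ i, i = 0 ∨ i = 1 → (hexads i).length = 96 := by decide +kernel

/-- Whether `i` and `j` are the two indices `0` and `1`. -/
def Opp (i j : Fin 5) : Prop := i = 0 ∧ j = 1 ∨ i = 1 ∧ j = 0

instance (i j : Fin 5) : Decidable (Opp i j) := inferInstanceAs (Decidable (_ ∨ _))

lemma fiveMasks_hexads : ∀ i j, Opp i j → ∀ m ∈ fiveMasks i,
    m ∈ hexads j ∧ popCount (setMask i &&& m) = 0 := by
  decide +kernel

lemma pairHexads_hexads : ∀ i j, Opp i j → ∀ t ∈ pairHexads i,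
    t.2.2 ∈ hexads j ∧ popCount (setMask i &&& t.2.2) = 3 := by
  decide +kernel

lemma exists_pairHexads : ∀ i j, Opp i j → ∀ a ∈ fiveMasks i, ∀ b ∈ fiveMasks i, a ≠ b →
    ∃ t ∈ pairHexads i, t.1 = a ∧ t.2.1 = b ∨ t.1 = b ∧ t.2.1 = a := by
  decide +kernel

lemma pairHexads_fixed : ∀ i, ∀ c ∈ aCodes i, ∀ t ∈ pairHexads i,
    (Nat.beq (img c t.1) t.1 && Nat.beq (img c t.2.1) t.2.1 ||
      Nat.beq (img c t.1) t.2.1 && Nat.beq (img c t.2.1) t.1) = true →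
    img c t.2.2 = t.2.2 := by
  decide +kernel

lemma orderFive_fixed : ∀ i j, Opp i j → ∀ c ∈ aCodes i, powFive c = 0xfedcba9876543210 →
    c ≠ 0xfedcba9876543210 → ∃ m, (hexads j).filter (fun m => Nat.beq (img c m) m) = [m] ∧
      popCount (setMask i &&& m) = 1 := by
  have h : ∀ i j, Opp i j → ∀ c ∈ aCodes i, powFive c = 0xfedcba9876543210 →
    c ≠ 0xfedcba9876543210 → ((hexads j).filter (fun m => Nat.beq (img c m) m)).length = 1 ∧
      ((hexads j).filter (fun m => Nat.beq (img c m) m)).all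
        fun m => Nat.beq (popCount (setMask i &&& m)) 1 := by
    decide +kernel
  intro i j hij c hc h5 h1
  obtain ⟨ha, hb⟩ := h i j hij c hc h5 h1
  obtain ⟨m, hm⟩ := List.length_eq_one_iff.mp ha
  rw [hm] at hb
  exact ⟨m, hm, by simpa using hb⟩

/-- The number whose binary digits `1` stand at the positions listed in `l`. -/
def bitSet (l : List ℕ) : ℕ := l.foldr (fun m e => 2 ^ m ||| e) 0

lemma testBit_bitSet (l : List ℕ) (k : ℕ) : (bitSet l).testBit k = true ↔ k ∈ l := by
  induction l with
  | nil => simp [bitSet]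
  | cons m l ih =>
    rw [bitSet] at ih ⊢
    rw [List.foldr_cons, Nat.testBit_or, Bool.or_eq_true, ih, Nat.testBit_two_pow, List.mem_cons,
      decide_eq_true_eq, eq_comm]

/-- The orbits of the stabilizer of the first set on the second orbit of sets of six points. -/
lemma hexads_subset_reps : ∀ m ∈ hexads 1, m ∈ (List.finRange 5).flatMap fun k =>
    (aCodes 0).map fun c => img c (hexadReps k) := by
  have h : ∀ m ∈ hexads 1, (bitSet ((List.finRange 5).flatMap fun k =>
      (aCodes 0).map fun c => img c (hexadReps k))).testBit m = true := by
    decide +kernel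
  exact fun m hm => (testBit_bitSet _ _).mp (h m hm)

/-- The sizes of the intersections of sets in the two orbits, in the order of the double cosets. -/
def interSizes : Fin 5 → ℕ := ![0, 1, 3, 4, 2]

lemma hexadReps_inter : ∀ k, popCount (setMask 0 &&& hexadReps k) = interSizes k := by
  decide +kernel

lemma hexadReps_mem : ∀ k, hexadReps k ∈ hexads 1 := by decide +kernel

lemma partners_distinct : ∀ k, distinctFrom (partners k) 0 := by decide +kernel

lemma partners_subset : ∀ k, (partners k).length = 96 ∧ ∀ m ∈ partners k, m ∈ hexads 1 := by
  decide +kernel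

lemma partners_equivariant : ∀ k, ∀ c ∈ aCodes 0,
    Nat.beq (img c (hexadReps (k.castLE (by norm_num)))) (hexadReps (k.castLE (by norm_num))) →
    ((hexads 0).zip (partners k)).all (fun q => ((hexads 0).zip (partners k)).any fun r =>
      Nat.beq r.1 (img c q.1) && Nat.beq r.2 (img c q.2)) = true := by
  decide +kernel

lemma exists_no_fixed_hexad : ∀ m ∈ hexads 1, ∃ c ∈ aCodes 0, img c m ≠ m := by
  decide +kernel

/-! ### Stabilizers and marks -/

lemma Opp.symm {i j : Fin 5} (h : Opp i j) : Opp j i := by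
  rcases h with ⟨h1, h2⟩ | ⟨h1, h2⟩
  exacts [Or.inr ⟨h2, h1⟩, Or.inl ⟨h2, h1⟩]

lemma Opp.left {i j : Fin 5} (h : Opp i j) : i = 0 ∨ i = 1 := by
  rcases h with ⟨h1, h2⟩ | ⟨h1, h2⟩
  exacts [Or.inl h1, Or.inr h1]

/-- The `i`-th set of points. -/
def hexad (i : Fin 5) : Finset Pt := ofMask (setMask i)

lemma exists_smul_of_mem_hexads {i : Fin 5} (hi : i = 0 ∨ i = 1) {m : ℕ} (hm : m ∈ hexads i) :
    ∃ g : T1654, g • hexad i = ofMask m := by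
  rw [← map_transversal_eq_hexads i hi] at hm
  obtain ⟨c, hc, rfl⟩ := List.mem_map.mp hm
  obtain ⟨g, rfl⟩ := exists_code_eq (transversal_subset i c hc)
  exact ⟨g, smul_ofMask g _⟩

lemma exists_mem_hexads {i : Fin 5} (hi : i = 0 ∨ i = 1) (g : T1654) :
    ∃ m ∈ hexads i, g • hexad i = ofMask m := by
  obtain ⟨o, ho, e⟩ := exists_mem_conjObjs i g
  obtain ⟨c, hc, rfl⟩ := List.mem_map.mp ho
  refine ⟨img c (setMask i), ?_, congrArg Prod.fst e⟩
  rw [← map_transversal_eq_hexads i hi]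
  exact List.mem_map.mpr ⟨c, hc, rfl⟩

lemma ofMask_injOn_hexads {i : Fin 5} {m m' : ℕ} (hm : m ∈ hexads i) (hm' : m' ∈ hexads i)
    (h : ofMask m = ofMask m') : m = m' :=
  ofMask_injOn (hexads_lt i m hm) (hexads_lt i m' hm') h

lemma orbit_hexad {i : Fin 5} (hi : i = 0 ∨ i = 1) :
    MulAction.orbit T1654 (hexad i) = (((hexads i).map ofMask).toFinset : Set (Finset Pt)) := by
  ext S
  simp only [List.coe_toFinset, List.mem_map, Set.mem_ofPred_eq, MulAction.mem_orbit_iff]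
  constructor
  · rintro ⟨g, rfl⟩
    obtain ⟨m, hm, e⟩ := exists_mem_hexads hi g
    exact ⟨m, hm, e.symm⟩
  · rintro ⟨m, hm, rfl⟩
    exact exists_smul_of_mem_hexads hi hm

lemma ncard_orbit_hexad {i : Fin 5} (hi : i = 0 ∨ i = 1) :
    (MulAction.orbit T1654 (hexad i)).ncard = 96 := by
  rw [orbit_hexad hi, Set.ncard_coe_finset, List.toFinset_card_of_nodup, List.length_map,
    length_hexads i hi]
  exact (List.nodup_map_iff_inj_on (hexads_nodup i)).mpr fun m hm k hk h =>
    ofMask_injOn_hexads hm hk h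

/-- The stabilizer of the set fixes the family: it has index `96`, by the size of the orbit. -/
lemma a5Sub_eq_stabilizer {i : Fin 5} (hi : i = 0 ∨ i = 1) :
    a5Sub i = MulAction.stabilizer T1654 (hexad i) := by
  refine Subgroup.eq_of_le_of_card_ge (fun g hg => congrArg Prod.fst hg) ?_
  have h := (MulAction.stabilizer T1654 (hexad i)).card_mul_index
  rw [MulAction.index_stabilizer, ncard_orbit_hexad hi, card_T1654] at h
  rw [card_a5Sub]
  omega

lemma mem_a5Sub_iff_smul {i : Fin 5} (hi : i = 0 ∨ i = 1) {g : T1654} :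
    g ∈ a5Sub i ↔ g • hexad i = hexad i := by
  rw [a5Sub_eq_stabilizer hi, MulAction.mem_stabilizer_iff]

section Marks

variable {G X : Type*} [Group G] [MulAction G X]

lemma mark_stabilizer (x : X) (K : Subgroup G) :
    mark (MulAction.stabilizer G x) K =
      {y | y ∈ MulAction.orbit G x ∧ ∀ k ∈ K, k • y = y}.ncard := by
  rw [mark, ← Nat.card_coe_set_eq]
  refine Nat.card_congr (Equiv.ofBijective (fun q =>
    ⟨MulAction.ofQuotientStabilizer G x q.1, ?_, ?_⟩) ⟨?_, ?_⟩)
  · obtain ⟨q, -⟩ := q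
    induction q using QuotientGroup.induction_on with
    | H g => exact ⟨g, rfl⟩
  · intro k hk
    rw [← MulAction.ofQuotientStabilizer_smul]
    exact congrArg _ (q.2 ⟨k, hk⟩)
  · intro p q h
    exact Subtype.ext (MulAction.injective_ofQuotientStabilizer G x (congrArg Subtype.val h))
  · rintro ⟨_, ⟨g, rfl⟩, hk⟩
    refine ⟨⟨(g : G ⧸ MulAction.stabilizer G x), fun k => ?_⟩, rfl⟩
    apply MulAction.injective_ofQuotientStabilizer G x
    refine (MulAction.ofQuotientStabilizer_smul G x (k : G)
      (g : G ⧸ MulAction.stabilizer G x)).trans ?_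
    exact hk k k.2

/-- An action on five points has a fixed point, or an invariant pair of points, or an orbit with
five elements. -/
lemma exists_fixed_or_pair_or_five_dvd [Finite G] (hX : Nat.card X = 5) :
    (∃ x : X, ∀ g : G, g • x = x) ∨
    (∃ x y : X, x ≠ y ∧ ∀ g : G, g • x = x ∧ g • y = y ∨ g • x = y ∧ g • y = x) ∨
    5 ∣ Nat.card G := by
  have : Finite X := Nat.finite_of_card_ne_zero (by omega)
  have key : ∀ T : Set X, (∀ g : G, g • T = T) → T.ncard = 1 ∨ T.ncard = 2 →
      (∃ x : X, ∀ g : G, g • x = x) ∨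
      (∃ x y : X, x ≠ y ∧ ∀ g : G, g • x = x ∧ g • y = y ∨ g • x = y ∧ g • y = x) := by
    intro T hT h
    have hmem : ∀ (g : G), ∀ x ∈ T, g • x ∈ T := fun g x hx => by
      have := Set.smul_mem_smul_set (a := g) hx
      rwa [hT] at this
    rcases h with h | h
    · obtain ⟨x, rfl⟩ := Set.ncard_eq_one.mp h
      exact Or.inl ⟨x, fun g => hmem g x rfl⟩
    · obtain ⟨x, y, hxy, rfl⟩ := Set.ncard_eq_two.mp h
      refine Or.inr ⟨x, y, hxy, fun g => ?_⟩
      have hne : g • x ≠ g • y := fun h => hxy (MulAction.injective g h)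
      rcases hmem g x (by simp) with h1 | h1 <;> rcases hmem g y (by simp) with h2 | h2
      · exact absurd (h1.trans h2.symm) hne
      · exact Or.inl ⟨h1, h2⟩
      · exact Or.inr ⟨h1, h2⟩
      · exact absurd (h1.trans (Set.mem_singleton_iff.mp h2).symm) hne
  obtain ⟨x⟩ : Nonempty X := (Nat.card_pos_iff.mp (by omega)).1
  set O := MulAction.orbit G x
  have hO : ∀ g : G, g • O = O := fun g => MulAction.smul_orbit g x
  have hOc : ∀ g : G, g • Oᶜ = Oᶜ := fun g => by rw [Set.smul_set_compl, hO]
  have hsum := Set.ncard_add_ncard_compl O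
  rw [hX] at hsum
  have hpos : 0 < O.ncard := (Set.ncard_pos O.toFinite).mpr ⟨x, MulAction.mem_orbit_self x⟩
  by_cases h5 : O.ncard = 5
  · refine Or.inr (Or.inr ?_)
    have := (MulAction.stabilizer G x).index_dvd_card
    rwa [MulAction.index_stabilizer, h5] at this
  · by_cases h12 : O.ncard ≤ 2
    · rw [← or_assoc]
      exact Or.inl (key O hO (by omega))
    · rw [← or_assoc]
      exact Or.inl (key Oᶜ hOc (by omega))

/-- Two orbits have the same numbers of fixed points under the subgroups of a group that leaves the
graph of a bijection of the orbits invariant. -/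
lemma ncard_fixed_eq_of_invariant_graph [Finite X] {O O' : Set X} (B : Set (X × X))
    (h1 : ∀ p ∈ B, ∀ q ∈ B, p.1 = q.1 → p = q) (h2 : ∀ p ∈ B, ∀ q ∈ B, p.2 = q.2 → p = q)
    (hO : Prod.fst '' B = O) (hO' : Prod.snd '' B = O') (K : Subgroup G)
    (hB : ∀ k ∈ K, ∀ p ∈ B, k • p ∈ B) :
    {y | y ∈ O ∧ ∀ k ∈ K, k • y = y}.ncard = {y | y ∈ O' ∧ ∀ k ∈ K, k • y = y}.ncard := by
  have e1 : {y | y ∈ O ∧ ∀ k ∈ K, k • y = y} = Prod.fst '' {p | p ∈ B ∧ ∀ k ∈ K, k • p = p} := by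
    ext y
    subst hO
    constructor
    · rintro ⟨⟨p, hp, rfl⟩, hk⟩
      exact ⟨p, ⟨hp, fun k hkK => h1 _ (hB k hkK p hp) _ hp (hk k hkK)⟩, rfl⟩
    · rintro ⟨p, ⟨hp, hk⟩, rfl⟩
      exact ⟨⟨p, hp, rfl⟩, fun k hkK => congrArg Prod.fst (hk k hkK)⟩
  have e2 : {y | y ∈ O' ∧ ∀ k ∈ K, k • y = y} = Prod.snd '' {p | p ∈ B ∧ ∀ k ∈ K, k • p = p} := by
    ext y
    subst hO'
    constructor
    · rintro ⟨⟨p, hp, rfl⟩, hk⟩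
      exact ⟨p, ⟨hp, fun k hkK => h2 _ (hB k hkK p hp) _ hp (hk k hkK)⟩, rfl⟩
    · rintro ⟨p, ⟨hp, hk⟩, rfl⟩
      exact ⟨⟨p, hp, rfl⟩, fun k hkK => congrArg Prod.snd (hk k hkK)⟩
  rw [e1, e2, Set.InjOn.ncard_image (fun p hp q hq h => h1 p hp.1 q hq.1 h),
    Set.InjOn.ncard_image (fun p hp q hq h => h2 p hp.1 q hq.1 h)]

end Marks

/-! ### Pairs of sets from the two orbits -/

/-- The pairs of sets from the two orbits are classified up to `T1654` by the size of the
intersection. -/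
lemma exists_smul_pair {S T : Finset Pt} (hS : S ∈ MulAction.orbit T1654 (hexad 0))
    (hT : T ∈ MulAction.orbit T1654 (hexad 1)) :
    ∃ (k : Fin 5) (g : T1654), g • hexad 0 = S ∧ g • ofMask (hexadReps k) = T ∧
      (S ∩ T).card = interSizes k := by
  obtain ⟨g, rfl⟩ := hS
  obtain ⟨t, rfl⟩ := hT
  obtain ⟨m, hm, e⟩ := exists_mem_hexads (Or.inr rfl) (g⁻¹ * t)
  obtain ⟨k, -, hk⟩ := List.mem_flatMap.mp (hexads_subset_reps m hm)
  obtain ⟨c, hc, rfl⟩ := List.mem_map.mp hk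
  have hc' := hc
  rw [← filter_codes] at hc'
  obtain ⟨h, rfl⟩ := exists_code_eq (List.mem_filter.mp hc').1
  have hh : h • hexad 0 = hexad 0 := (mem_a5Sub_iff_smul (Or.inl rfl)).mp (mem_a5Sub_iff.mpr hc)
  have e1 : (g * h) • hexad 0 = g • hexad 0 := by rw [mul_smul, hh]
  have e2 : (g * h) • ofMask (hexadReps k) = t • hexad 1 := by
    rw [mul_smul, smul_ofMask h, ← e, smul_smul, mul_inv_cancel_left]
  refine ⟨k, g * h, e1, e2, ?_⟩
  change (g • hexad 0 ∩ t • hexad 1).card = _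
  rw [← e1, ← e2, card_smul_inter, hexad, card_inter_ofMask, hexadReps_inter]

/-- The graph of the `k`-th bijection. -/
def partnerGraph (k : Fin 3) : Set (Finset Pt × Finset Pt) :=
  {p | ∃ q ∈ (hexads 0).zip (partners k), p = (ofMask q.1, ofMask q.2)}

lemma partnerGraph_inj (k : Fin 3) :
    (∀ p ∈ partnerGraph k, ∀ q ∈ partnerGraph k, p.1 = q.1 → p = q) ∧
    (∀ p ∈ partnerGraph k, ∀ q ∈ partnerGraph k, p.2 = q.2 → p = q) := by
  have hl : (hexads 0).length = (partners k).length :=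
    (length_hexads 0 (Or.inl rfl)).trans (partners_subset k).1.symm
  have hn := (nodup_of_distinctFrom _ _ (partners_distinct k)).1
  have aux : ∀ (l l' : List ℕ), l.Nodup → ∀ q ∈ l.zip l', ∀ r ∈ l.zip l', q.1 = r.1 → q = r := by
    intro l l' hl q hq r hr h
    obtain ⟨a, ha, e⟩ := List.mem_iff_getElem.mp hq
    obtain ⟨b, hb, f⟩ := List.mem_iff_getElem.mp hr
    simp only [List.getElem_zip] at e f
    subst e f
    have := (List.Nodup.getElem_inj_iff hl).mp h
    subst this
    rfl
  have aux' : ∀ (l l' : List ℕ), l'.Nodup → ∀ q ∈ l.zip l', ∀ r ∈ l.zip l', q.2 = r.2 → q = r := by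
    intro l l' hl q hq r hr h
    obtain ⟨a, ha, e⟩ := List.mem_iff_getElem.mp hq
    obtain ⟨b, hb, f⟩ := List.mem_iff_getElem.mp hr
    simp only [List.getElem_zip] at e f
    subst e f
    have := (List.Nodup.getElem_inj_iff hl).mp h
    subst this
    rfl
  constructor
  · rintro _ ⟨q, hq, rfl⟩ _ ⟨r, hr, rfl⟩ h
    rw [aux _ _ (hexads_nodup 0) q hq r hr (ofMask_injOn_hexads (List.of_mem_zip hq).1
      (List.of_mem_zip hr).1 h)]
  · rintro _ ⟨q, hq, rfl⟩ _ ⟨r, hr, rfl⟩ h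
    rw [aux' _ _ hn q hq r hr (ofMask_injOn_hexads ((partners_subset k).2 _ (List.of_mem_zip hq).2)
      ((partners_subset k).2 _ (List.of_mem_zip hr).2) h)]

lemma fst_partnerGraph (k : Fin 3) :
    Prod.fst '' partnerGraph k = MulAction.orbit T1654 (hexad 0) := by
  have hl : (hexads 0).length ≤ (partners k).length :=
    ((length_hexads 0 (Or.inl rfl)).trans (partners_subset k).1.symm).le
  rw [orbit_hexad (Or.inl rfl)]
  ext S
  simp only [Set.mem_image, List.coe_toFinset, List.mem_map, Set.mem_ofPred_eq]
  constructor
  · rintro ⟨_, ⟨q, hq, rfl⟩, rfl⟩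
    exact ⟨q.1, (List.of_mem_zip hq).1, rfl⟩
  · rintro ⟨m, hm, rfl⟩
    rw [← List.map_fst_zip hl] at hm
    obtain ⟨q, hq, rfl⟩ := List.mem_map.mp hm
    exact ⟨_, ⟨q, hq, rfl⟩, rfl⟩

lemma snd_partnerGraph (k : Fin 3) :
    Prod.snd '' partnerGraph k = MulAction.orbit T1654 (hexad 1) := by
  have hl : (partners k).length ≤ (hexads 0).length :=
    ((length_hexads 0 (Or.inl rfl)).trans (partners_subset k).1.symm).ge
  have hn := (nodup_of_distinctFrom _ _ (partners_distinct k)).1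
  have e : Prod.snd '' partnerGraph k =
      (((partners k).map ofMask).toFinset : Set (Finset Pt)) := by
    ext S
    simp only [Set.mem_image, List.coe_toFinset, List.mem_map, Set.mem_ofPred_eq]
    constructor
    · rintro ⟨_, ⟨q, hq, rfl⟩, rfl⟩
      exact ⟨q.2, (List.of_mem_zip hq).2, rfl⟩
    · rintro ⟨m, hm, rfl⟩
      rw [← List.map_snd_zip hl] at hm
      obtain ⟨q, hq, rfl⟩ := List.mem_map.mp hm
      exact ⟨_, ⟨q, hq, rfl⟩, rfl⟩
  rw [e]
  refine Set.eq_of_subset_of_ncard_le ?_ ?_ (Set.toFinite _)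
  · rw [orbit_hexad (Or.inr rfl)]
    intro S
    simp only [List.coe_toFinset, List.mem_map, Set.mem_ofPred_eq]
    rintro ⟨m, hm, rfl⟩
    exact ⟨m, (partners_subset k).2 m hm, rfl⟩
  · rw [ncard_orbit_hexad (Or.inr rfl), Set.ncard_coe_finset, List.toFinset_card_of_nodup,
      List.length_map, (partners_subset k).1]
    exact (List.nodup_map_iff_inj_on hn).mpr fun m hm k' hk h =>
      ofMask_injOn_hexads ((partners_subset k).2 m hm) ((partners_subset k).2 k' hk) h

lemma smul_mem_partnerGraph {k : Fin 3} {g : T1654} (h0 : g • hexad 0 = hexad 0)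
    (h1 : g • ofMask (hexadReps (k.castLE (by norm_num))) =
      ofMask (hexadReps (k.castLE (by norm_num)))) :
    ∀ p ∈ partnerGraph k, g • p ∈ partnerGraph k := by
  rintro _ ⟨q, hq, rfl⟩
  have hlt : hexadReps (k.castLE (by norm_num)) < 2 ^ 16 := hexads_lt 1 _ (hexadReps_mem _)
  have := partners_equivariant k (code g)
    (mem_a5Sub_iff.mp ((mem_a5Sub_iff_smul (Or.inl rfl)).mpr h0))
    ((Nat.beq_eq ..).mpr ((smul_ofMask_eq_iff hlt g).mp h1))
  obtain ⟨r, hr, h⟩ := List.any_eq_true.mp (List.all_eq_true.mp this q hq)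
  rw [Bool.and_eq_true, Nat.beq_eq, Nat.beq_eq] at h
  exact ⟨r, hr, by rw [Prod.smul_mk, smul_ofMask, smul_ofMask, h.1, h.2]⟩

/-- A subgroup fixing two sets, one from each orbit, that meet in `0`, `1` or `3` points, fixes
equally many sets in the two orbits. -/
lemma mark_eq_of_fixed_pair {K : Subgroup T1654} {S T : Finset Pt}
    (hS : S ∈ MulAction.orbit T1654 (hexad 0)) (hT : T ∈ MulAction.orbit T1654 (hexad 1))
    (hKS : ∀ k ∈ K, k • S = S) (hKT : ∀ k ∈ K, k • T = T)
    (h : (S ∩ T).card = 0 ∨ (S ∩ T).card = 1 ∨ (S ∩ T).card = 3) :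
    mark (a5Sub 0) K = mark (a5Sub 1) K := by
  obtain ⟨k, g, rfl, rfl, hk⟩ := exists_smul_pair hS hT
  obtain ⟨l, rfl⟩ : ∃ l : Fin 3, k = l.castLE (by norm_num) := by
    have aux : ∀ k, interSizes k = 0 ∨ interSizes k = 1 ∨ interSizes k = 3 →
        ∃ l : Fin 3, k = l.castLE (by norm_num) := by decide
    exact aux k (hk ▸ h)
  rw [a5Sub_eq_stabilizer (Or.inl rfl), a5Sub_eq_stabilizer (Or.inr rfl), mark_stabilizer,
    mark_stabilizer]
  have hinj := partnerGraph_inj l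
  have hgB : ∀ p ∈ g • partnerGraph l, ∃ q ∈ partnerGraph l, p = g • q := by
    rintro _ ⟨q, hq, rfl⟩
    exact ⟨q, hq, rfl⟩
  have himg : ∀ (f : Finset Pt × Finset Pt → Finset Pt) (O : Finset Pt),
      (∀ p, f (g • p) = g • f p) → f '' partnerGraph l = MulAction.orbit T1654 O →
      f '' (g • partnerGraph l) = MulAction.orbit T1654 O := by
    intro f O hf hO
    rw [← MulAction.smul_orbit g, ← hO]
    ext S
    constructor
    · rintro ⟨_, ⟨q, hq, rfl⟩, rfl⟩
      exact ⟨f q, ⟨q, hq, rfl⟩, (hf q).symm⟩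
    · rintro ⟨_, ⟨q, hq, rfl⟩, rfl⟩
      exact ⟨g • q, ⟨q, hq, rfl⟩, hf q⟩
  refine ncard_fixed_eq_of_invariant_graph (g • partnerGraph l) ?_ ?_
    (himg _ _ (fun _ => rfl) (fst_partnerGraph l)) (himg _ _ (fun _ => rfl) (snd_partnerGraph l)) K ?_
  · intro p hp q hq h
    obtain ⟨p, hp', rfl⟩ := hgB p hp
    obtain ⟨q, hq', rfl⟩ := hgB q hq
    rw [hinj.1 p hp' q hq' (MulAction.injective g h)]
  · intro p hp q hq h
    obtain ⟨p, hp', rfl⟩ := hgB p hp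
    obtain ⟨q, hq', rfl⟩ := hgB q hq
    rw [hinj.2 p hp' q hq' (MulAction.injective g h)]
  · intro x hx p hp
    obtain ⟨p, hp', rfl⟩ := hgB p hp
    have h0 : (g⁻¹ * x * g) • hexad 0 = hexad 0 := by
      rw [mul_smul, mul_smul, inv_smul_eq_iff]
      exact hKS x hx
    have h1 : (g⁻¹ * x * g) • ofMask (hexadReps (l.castLE (by norm_num))) =
        ofMask (hexadReps (l.castLE (by norm_num))) := by
      rw [mul_smul, mul_smul, inv_smul_eq_iff]
      exact hKT x hx
    refine ⟨(g⁻¹ * x * g) • p, smul_mem_partnerGraph h0 h1 p hp', ?_⟩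
    change g • (g⁻¹ * x * g) • p = x • g • p
    rw [smul_smul, smul_smul]
    congr 1
    group

/-! ### Proper subgroups of the two stabilizers -/

section

variable {G : Type*} [Group G]

/-- A group of order `5`, `10`, `15` or `20` has a normal subgroup of order `5`. -/
lemma exists_orderOf_five_normal [Finite G] (h5 : 5 ∣ Nat.card G) (h60 : Nat.card G ∣ 60)
    (hlt : Nat.card G < 30) :
    ∃ x : G, orderOf x = 5 ∧ ∀ g : G, g⁻¹ * x * g ∈ Subgroup.zpowers x := by
  have : Fact (Nat.Prime 5) := ⟨Nat.prime_five⟩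
  obtain ⟨P⟩ : Nonempty (Sylow 5 G) := inferInstance
  have hn := card_sylow_modEq_one 5 G
  have hPi := Sylow.card_dvd_index P
  have hm := (P : Subgroup G).card_mul_index
  have hP5 : 5 ∣ Nat.card P := P.dvd_card_of_dvd_card h5
  obtain ⟨a, ha⟩ := hP5
  obtain ⟨b, hb⟩ := h60
  have hpos : 0 < Nat.card G := Nat.card_pos
  have hcard : a * (P : Subgroup G).index < 6 := by
    have : 5 * (a * (P : Subgroup G).index) < 30 := by
      rw [← mul_assoc, ← ha, hm]; exact hlt
    omega
  have hapos : 0 < a := by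
    rcases Nat.eq_zero_or_pos a with h | h
    · rw [h, mul_zero] at ha
      rw [ha, zero_mul] at hm
      omega
    · exact h
  have hipos : 0 < (P : Subgroup G).index := Nat.pos_of_ne_zero (Subgroup.index_ne_zero_of_finite)
  have hile : (P : Subgroup G).index < 6 := lt_of_le_of_lt (Nat.le_mul_of_pos_left _ hapos) hcard
  have hn1 : Nat.card (Sylow 5 G) = 1 := by
    have := Nat.le_of_dvd hipos hPi
    have h2 : Nat.card (Sylow 5 G) % 5 = 1 := hn
    omega
  have hsub : Subsingleton (Sylow 5 G) := (Nat.card_eq_one_iff_unique.mp hn1).1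
  have hnormal := Sylow.normal_of_subsingleton P
  have ha5 : a = 1 := by
    have h2 : a ∣ 12 := by
      refine ⟨(P : Subgroup G).index * b, ?_⟩
      rw [← hm, ha] at hb
      have : 5 * 12 = 5 * (a * ((P : Subgroup G).index * b)) := by rw [← mul_assoc]; linarith
      omega
    have h3 : a < 6 := lt_of_le_of_lt (Nat.le_mul_of_pos_right _ hipos) hcard
    obtain ⟨n, hn⟩ := P.isPGroup'.exists_card_eq
    rw [ha] at hn
    rcases n with _ | _ | n
    · omega
    · omega
    · have : 25 ∣ 5 * a := by rw [hn, pow_succ, pow_succ, mul_assoc]; exact dvd_mul_left _ _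
      have h4 : 5 ∣ a := by omega
      obtain ⟨d, rfl⟩ := h4
      have : d = 1 := by omega
      subst this
      norm_num at h2
  obtain ⟨x, hx⟩ := exists_prime_orderOf_dvd_card' (G := P) 5 ⟨a, ha⟩
  have hx' : orderOf (x : G) = 5 := by rw [Subgroup.orderOf_coe, hx]
  have hz : Subgroup.zpowers (x : G) = P := by
    refine Subgroup.eq_of_le_of_card_ge (Subgroup.zpowers_le.mpr x.2) ?_
    rw [Nat.card_zpowers, hx', ha, ha5]
  refine ⟨x, hx', fun g => ?_⟩
  rw [hz]
  simpa using hnormal.conj_mem _ x.2 g⁻¹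

end

lemma card_lt_of_lt_a5Sub {i : Fin 5} {K : Subgroup T1654} (hK : K < a5Sub i) :
    Nat.card K ∣ 60 ∧ (5 ∣ Nat.card K → Nat.card K < 30) := by
  have hd : Nat.card K ∣ 60 := by
    rw [← card_a5Sub i]
    exact Subgroup.card_dvd_of_le hK.le
  refine ⟨hd, fun h5 => ?_⟩
  by_contra hlt
  obtain ⟨e⟩ := nonempty_a5Sub_mulEquiv i
  have h30 : 30 ∣ Nat.card K := by
    have := Nat.le_of_dvd (by norm_num) hd
    obtain ⟨b, hb⟩ := hd
    obtain ⟨a, ha⟩ := h5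
    have hb2 : b ≤ 2 := by
      by_contra hb3
      have : 30 * 3 ≤ Nat.card K * b := Nat.mul_le_mul (by omega) (by omega)
      omega
    interval_cases b <;> omega
  have htop : (K.subgroupOf (a5Sub i)).map e.toMonoidHom = ⊤ := by
    apply alternatingGroup_five_eq_top
    rw [Subgroup.card_map_of_injective e.injective,
      Nat.card_congr (Subgroup.subgroupOfEquivOfLe hK.le).toEquiv]
    exact h30
  have : K.subgroupOf (a5Sub i) = ⊤ := by
    rw [eq_top_iff]
    intro x _
    have hx : e x ∈ (K.subgroupOf (a5Sub i)).map e.toMonoidHom := htop ▸ Subgroup.mem_top _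
    obtain ⟨y, hy, hxy⟩ := hx
    rwa [← e.injective hxy]
  exact hK.not_ge (Subgroup.subgroupOf_eq_top.mp this)

lemma powFive_code (x : T1654) : powFive (code x) = code (x ^ 5) := by
  rw [powFive, ← code_mul, ← code_mul, ← code_mul]
  congr 1

/-- A proper subgroup of one of the two stabilizers fixes a member of the family of five sets, or a
pair of members, or normalizes a subgroup of order five.  In each case it fixes a set in the other
orbit. -/
lemma exists_fixed_hexad {i j : Fin 5} (hij : Opp i j) {K : Subgroup T1654} (hK : K < a5Sub i) :
    ∃ m ∈ hexads j, (∀ k ∈ K, k • ofMask m = ofMask m) ∧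
      ((hexad i ∩ ofMask m).card = 0 ∨ (hexad i ∩ ofMask m).card = 1 ∨
        (hexad i ∩ ofMask m).card = 3) := by
  have hcode : ∀ k ∈ K, code k ∈ aCodes i := fun k hk => mem_a5Sub_iff.mp (hK.le hk)
  have hlt : ∀ m ∈ hexads j, m < 2 ^ 16 := hexads_lt j
  have hlt5 := fiveMasks_lt i
  let f : K →* a5Sub i := Subgroup.inclusion hK.le
  let _ : MulAction K (fivePoints i) := MulAction.compHom _ f
  have hsmul : ∀ (k : K) (x : fivePoints i), ((k • x : fivePoints i) : Finset Pt) =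
      (k : T1654) • (x : Finset Pt) := fun k x => rfl
  have hmask : ∀ x : fivePoints i, ∃ m ∈ fiveMasks i, (x : Finset Pt) = ofMask m := fun x => by
    have hx : (x : Finset Pt) ∈ famOf (fiveMasks i) := x.2
    obtain ⟨m, hm, e⟩ := List.mem_map.mp (List.mem_toFinset.mp hx)
    exact ⟨m, hm, e.symm⟩
  rcases exists_fixed_or_pair_or_five_dvd (G := K) (card_fivePoints i) with
    ⟨x, hx⟩ | ⟨x, y, hxy, h⟩ | h5
  · obtain ⟨m, hm, e⟩ := hmask x
    refine ⟨m, (fiveMasks_hexads i j hij m hm).1, fun k hk => ?_, Or.inl ?_⟩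
    · rw [← e]
      exact congrArg Subtype.val (hx ⟨k, hk⟩)
    · rw [hexad, card_inter_ofMask]
      exact (fiveMasks_hexads i j hij m hm).2
  · obtain ⟨a, ha, ea⟩ := hmask x
    obtain ⟨b, hb, eb⟩ := hmask y
    have hne : a ≠ b := fun hab => hxy (Subtype.ext (by rw [ea, eb, hab]))
    obtain ⟨t, ht, hab⟩ := exists_pairHexads i j hij a ha b hb hne
    obtain ⟨hr, hr3⟩ := pairHexads_hexads i j hij t ht
    refine ⟨t.2.2, hr, fun k hk => ?_, Or.inr (Or.inr ?_)⟩
    · rw [smul_ofMask_eq_iff (hlt _ hr)]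
      refine pairHexads_fixed i _ (hcode k hk) t ht ?_
      simp only [Bool.or_eq_true, Bool.and_eq_true, Nat.beq_eq]
      have himg : ∀ p ∈ fiveMasks i, ∀ (z w : fivePoints i) (q : ℕ), q ∈ fiveMasks i →
          (z : Finset Pt) = ofMask p → (w : Finset Pt) = ofMask q →
          (⟨k, hk⟩ : K) • z = w → img (code k) p = q := by
        intro p hp z w q hq hz hw hzw
        apply ofMask_injOn (img_lt _ _) (hlt5 q hq)
        rw [← smul_ofMask, ← hz, ← hw, ← hzw]
        rfl
      rcases h ⟨k, hk⟩ with ⟨h1, h2⟩ | ⟨h1, h2⟩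
      · have e1 := himg a ha x x a ha ea ea h1
        have e2 := himg b hb y y b hb eb eb h2
        rcases hab with ⟨h3, h4⟩ | ⟨h3, h4⟩ <;> rw [h3, h4]
        exacts [Or.inl ⟨e1, e2⟩, Or.inl ⟨e2, e1⟩]
      · have e1 := himg a ha x y b hb ea eb h1
        have e2 := himg b hb y x a ha eb ea h2
        rcases hab with ⟨h3, h4⟩ | ⟨h3, h4⟩ <;> rw [h3, h4]
        exacts [Or.inr ⟨e1, e2⟩, Or.inr ⟨e2, e1⟩]
    · rw [hexad, card_inter_ofMask, hr3]
  · obtain ⟨h60, h30⟩ := card_lt_of_lt_a5Sub hK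
    obtain ⟨x, hx, hn⟩ := exists_orderOf_five_normal (G := K) h5 h60 (h30 h5)
    have hx5 : (x : T1654) ^ 5 = 1 := by
      rw [← Subgroup.coe_pow, ← hx, pow_orderOf_eq_one, Subgroup.coe_one]
    have hx1 : (x : T1654) ≠ 1 := fun h => by
      rw [← Subgroup.orderOf_coe, h, orderOf_one] at hx
      omega
    obtain ⟨m, hm, hm1⟩ := orderFive_fixed i j hij _ (hcode x x.2)
      (by rw [powFive_code, hx5, code_one]) (fun h => hx1 (eq_one_of_code h))
    have hmem : m ∈ hexads j ∧ Nat.beq (img (code (x : T1654)) m) m = true := by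
      have h1 := List.mem_singleton_self m
      rw [← hm] at h1
      have h2 := List.mem_filter.mp h1
      exact h2
    have hxm : (x : T1654) • ofMask m = ofMask m := by
      rw [smul_ofMask_eq_iff (hlt m hmem.1)]
      exact (Nat.beq_eq ..).mp hmem.2
    refine ⟨m, hmem.1, fun k hk => ?_, Or.inr (Or.inl ?_)⟩
    · obtain ⟨g, hg⟩ := exists_smul_of_mem_hexads hij.symm.left hmem.1
      obtain ⟨m', hm', e⟩ := exists_mem_hexads hij.symm.left (k * g)
      rw [mul_smul, hg] at e
      have hz : k⁻¹ * x * k ∈ MulAction.stabilizer T1654 (ofMask m) := by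
        have h1 := hn ⟨k, hk⟩
        obtain ⟨z, hz⟩ := h1
        have hz' : (x : T1654) ^ z = k⁻¹ * x * k := by
          have := congrArg Subtype.val hz
          simpa using this
        rw [← hz']
        exact Subgroup.zpow_mem _ (MulAction.mem_stabilizer_iff.mpr hxm) z
      have hxm' : (x : T1654) • ofMask m' = ofMask m' := by
        rw [MulAction.mem_stabilizer_iff, mul_smul, mul_smul, inv_smul_eq_iff] at hz
        rw [← e]
        exact hz
      rw [smul_ofMask_eq_iff (hlt m' hm')] at hxm'
      have : m' ∈ (hexads j).filter (fun m => Nat.beq (img (code (x : T1654)) m) m) :=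
        List.mem_filter.mpr ⟨hm', (Nat.beq_eq ..).mpr hxm'⟩
      rw [hm, List.mem_singleton] at this
      rw [e, this]
    · rw [hexad, card_inter_ofMask, hm1]

/-- Every proper subgroup of one of the two stabilizers is conjugate to one of the other. -/
lemma exists_conj_of_lt {i j : Fin 5} (hij : Opp i j) {K : Subgroup T1654} (hK : K < a5Sub i) :
    ∃ K' < a5Sub j, ConjSubgroups K K' := by
  obtain ⟨m, hm, hfix, -⟩ := exists_fixed_hexad hij hK
  obtain ⟨g, hg⟩ := exists_smul_of_mem_hexads hij.symm.left hm
  refine ⟨K.map (MulAut.conj g⁻¹).toMonoidHom, lt_of_le_of_ne ?_ fun h => ?_, g⁻¹, rfl⟩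
  · rintro _ ⟨k, hk, rfl⟩
    rw [mem_a5Sub_iff_smul hij.symm.left]
    change (g⁻¹ * k * g⁻¹⁻¹) • hexad j = hexad j
    rw [inv_inv, mul_smul, mul_smul, hg, hfix k hk, ← hg, inv_smul_smul]
  · have h1 := congrArg (fun H : Subgroup T1654 => Nat.card H) h
    simp only [card_a5Sub] at h1
    rw [Subgroup.card_map_of_injective (MulAut.conj g⁻¹).injective] at h1
    exact hK.ne (Subgroup.eq_of_le_of_card_ge hK.le (by rw [h1, card_a5Sub]))

lemma not_isSolvable_a5Sub (i : Fin 5) : ¬ Group.IsSolvable (a5Sub i) := by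
  intro h
  obtain ⟨e⟩ := nonempty_a5Sub_mulEquiv i
  have h2 : Group.IsSolvable (alternatingGroup (Fin 5)) :=
    Group.isSolvable_of_surjective (f := e.toMonoidHom) e.surjective
  have := alternatingGroup.isSimpleGroup (α := Fin 5) (by simp)
  have h3 := IsSimpleGroup.comm_iff_isSolvable.mpr h2
  exact absurd (h3 genTwo genThree) (by decide +kernel)

/-- Equality of marks, from the side of one of the two stabilizers. -/
lemma mark_eq_of_fixed {i j : Fin 5} (hij : Opp i j) {K : Subgroup T1654}
    (hK : Group.IsSolvable K) {S : Finset Pt} (hS : S ∈ MulAction.orbit T1654 (hexad i))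
    (hfix : ∀ k ∈ K, k • S = S) : mark (a5Sub 0) K = mark (a5Sub 1) K := by
  obtain ⟨g, rfl⟩ := hS
  change ∀ k ∈ K, k • g • hexad i = g • hexad i at hfix
  set K' := K.map (MulAut.conj g⁻¹).toMonoidHom
  have hle : K' ≤ a5Sub i := by
    rintro _ ⟨k, hk, rfl⟩
    rw [mem_a5Sub_iff_smul hij.left]
    change (g⁻¹ * k * g⁻¹⁻¹) • hexad i = hexad i
    rw [inv_inv, mul_smul, mul_smul, hfix k hk, inv_smul_smul]
  have hne : K' ≠ a5Sub i := fun h => by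
    have h1 : Group.IsSolvable K' := Group.isSolvable_of_surjective
      (f := (MulAut.conj g⁻¹).toMonoidHom.subgroupMap K)
      ((MulAut.conj g⁻¹).toMonoidHom.subgroupMap_surjective K)
    rw [h] at h1
    exact not_isSolvable_a5Sub i h1
  obtain ⟨m, hm, hfixm, hc⟩ := exists_fixed_hexad hij (lt_of_le_of_ne hle hne)
  obtain ⟨t, ht⟩ := exists_smul_of_mem_hexads hij.symm.left hm
  have hT : g • ofMask m ∈ MulAction.orbit T1654 (hexad j) := ⟨g * t, by
    change (g * t) • hexad j = _
    rw [mul_smul, ht]⟩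
  have hKT : ∀ k ∈ K, k • g • ofMask m = g • ofMask m := by
    intro k hk
    have := hfixm (g⁻¹ * k * g⁻¹⁻¹) ⟨k, hk, rfl⟩
    rwa [inv_inv, mul_smul, mul_smul, inv_smul_eq_iff] at this
  have hS : g • hexad i ∈ MulAction.orbit T1654 (hexad i) := ⟨g, rfl⟩
  rw [← card_smul_inter g] at hc
  rcases hij with ⟨rfl, rfl⟩ | ⟨rfl, rfl⟩
  · exact mark_eq_of_fixed_pair hS hT hfix hKT hc
  · rw [Finset.inter_comm] at hc
    exact mark_eq_of_fixed_pair hT hS hKT hfix hc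

lemma solvablyEquivalent_a5Sub : SolvablyEquivalent (a5Sub 0) (a5Sub 1) := by
  intro K hK
  by_cases h0 : ∃ S ∈ MulAction.orbit T1654 (hexad 0), ∀ k ∈ K, k • S = S
  · obtain ⟨S, hS, h⟩ := h0
    exact mark_eq_of_fixed (Or.inl ⟨rfl, rfl⟩) hK hS h
  by_cases h1 : ∃ S ∈ MulAction.orbit T1654 (hexad 1), ∀ k ∈ K, k • S = S
  · obtain ⟨S, hS, h⟩ := h1
    exact mark_eq_of_fixed (Or.inr ⟨rfl, rfl⟩) hK hS h
  have hempty : ∀ i, (i = 0 ∨ i = 1) → (¬ ∃ S ∈ MulAction.orbit T1654 (hexad i), ∀ k ∈ K,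
      k • S = S) → mark (a5Sub i) K = 0 := by
    intro i hi h
    rw [a5Sub_eq_stabilizer hi, mark_stabilizer]
    convert Set.ncard_empty (Finset Pt)
    rw [Set.eq_empty_iff_forall_notMem]
    exact fun S hS => h ⟨S, hS.1, hS.2⟩
  rw [hempty 0 (Or.inl rfl) h0, hempty 1 (Or.inr rfl) h1]

lemma not_conj_a5Sub {i j : Fin 5} (hij : i ≠ j) : ¬ ConjSubgroups (a5Sub i) (a5Sub j) := by
  intro h
  have h01 : ¬ ConjSubgroups (a5Sub 0) (a5Sub 1) := by
    rintro ⟨g, hg⟩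
    obtain ⟨m, hm, e⟩ := exists_mem_hexads (i := 1) (Or.inr rfl) g⁻¹
    obtain ⟨c, hc, hcm⟩ := exists_no_fixed_hexad m hm
    have hc' := hc
    rw [← filter_codes] at hc'
    obtain ⟨x, rfl⟩ := exists_code_eq (List.mem_filter.mp hc').1
    have hx : g * x * g⁻¹ ∈ a5Sub 1 := hg ▸ ⟨x, mem_a5Sub_iff.mpr hc, rfl⟩
    rw [mem_a5Sub_iff_smul (Or.inr rfl), mul_smul, mul_smul, ← eq_inv_smul_iff, e,
      smul_ofMask_eq_iff (hexads_lt 1 m hm)] at hx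
    exact hcm hx
  by_cases hO : Opp i j
  · rcases hO with ⟨rfl, rfl⟩ | ⟨rfl, rfl⟩
    · exact h01 h
    · apply h01
      obtain ⟨g, hg⟩ := h
      refine ⟨g⁻¹, ?_⟩
      rw [← hg, Subgroup.map_map]
      convert Subgroup.map_id _
      ext x
      simp
  · obtain ⟨K, hK, hne⟩ := exists_klein i
    obtain ⟨g, hg⟩ := h
    exact hne j hij hO ⟨_, hg ▸ Subgroup.map_mono hK.le, g, rfl⟩

lemma proper_subgroups_iff (i j : Fin 5) (hij : i ≠ j) :
    (∀ K < a5Sub i, ∃ K' < a5Sub j, ConjSubgroups K K') ↔ (i = 0 ∧ j = 1 ∨ i = 1 ∧ j = 0) := by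
  constructor
  · intro h
    by_contra hO
    obtain ⟨K, hK, hne⟩ := exists_klein i
    obtain ⟨K', hK', hc⟩ := h K hK
    exact hne j hij hO ⟨K', hK'.le, hc⟩
  · exact fun hO K hK => exists_conj_of_lt hO hK

/-! ### Cosets as sets of six points -/

/-- The image of the `i`-th set that corresponds to a coset. -/
def cosetHexad (i : Fin 5) (q : T1654 ⧸ a5Sub i) : Finset Pt :=
  Quotient.liftOn' q (fun g => g • hexad i) fun g h hgh => by
    have h1 : g⁻¹ * h ∈ a5Sub i := QuotientGroup.leftRel_apply.mp hgh
    have h2 : (g⁻¹ * h) • hexad i = hexad i := congrArg Prod.fst h1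
    rwa [mul_smul, inv_smul_eq_iff, eq_comm] at h2

lemma cosetHexad_mk (i : Fin 5) (g : T1654) :
    cosetHexad i (g : T1654 ⧸ a5Sub i) = g • hexad i := rfl

lemma cosetHexad_smul (i : Fin 5) (g : T1654) (q : T1654 ⧸ a5Sub i) :
    cosetHexad i (g • q) = g • cosetHexad i q := by
  induction q using QuotientGroup.induction_on with
  | H h => exact mul_smul g h _

lemma cosetHexad_injective {i : Fin 5} (hi : i = 0 ∨ i = 1) :
    Function.Injective (cosetHexad i) := by
  intro p q
  induction p using QuotientGroup.induction_on with
  | H g =>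
    induction q using QuotientGroup.induction_on with
    | H h =>
      intro e
      rw [cosetHexad_mk, cosetHexad_mk] at e
      rw [QuotientGroup.eq, mem_a5Sub_iff_smul hi, mul_smul, ← e, inv_smul_smul]

lemma cosetHexad_mem_orbit (i : Fin 5) (q : T1654 ⧸ a5Sub i) :
    cosetHexad i q ∈ MulAction.orbit T1654 (hexad i) := by
  induction q using QuotientGroup.induction_on with
  | H g => exact ⟨g, rfl⟩

lemma exists_cosetHexad_eq {i : Fin 5} (hi : i = 0 ∨ i = 1) {m : ℕ} (hm : m ∈ hexads i) :
    ∃ q, cosetHexad i q = ofMask m := by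
  obtain ⟨g, hg⟩ := exists_smul_of_mem_hexads hi hm
  exact ⟨(g : T1654 ⧸ a5Sub i), hg⟩

lemma exists_mem_hexads_coset {i : Fin 5} (hi : i = 0 ∨ i = 1) (q : T1654 ⧸ a5Sub i) :
    ∃ m ∈ hexads i, cosetHexad i q = ofMask m := by
  induction q using QuotientGroup.induction_on with
  | H g => exact exists_mem_hexads hi g

lemma card_quotient_a5Sub (i : Fin 5) : Nat.card (T1654 ⧸ a5Sub i) = 96 :=
  index_eq_96 (card_a5Sub i)

noncomputable instance (i : Fin 5) : Fintype (T1654 ⧸ a5Sub i) := Fintype.ofFinite _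

noncomputable instance (i : Fin 5) : DecidableEq (T1654 ⧸ a5Sub i) := Classical.decEq _

/-- Sums over the cosets are sums over the list of sets. -/
lemma sum_coset {R : Type*} [AddCommMonoid R] {i : Fin 5} (hi : i = 0 ∨ i = 1)
    (f : Finset Pt → R) :
    ∑ q : T1654 ⧸ a5Sub i, f (cosetHexad i q) = ((hexads i).map fun m => f (ofMask m)).sum := by
  have hn : ((hexads i).map ofMask).Nodup :=
    (List.nodup_map_iff_inj_on (hexads_nodup i)).mpr fun m hm k hk h =>
      ofMask_injOn_hexads hm hk h
  have e : Finset.univ.map ⟨cosetHexad i, cosetHexad_injective hi⟩ =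
      ((hexads i).map ofMask).toFinset := by
    ext S
    simp only [Finset.mem_map, Finset.mem_univ, true_and, Function.Embedding.coeFn_mk,
      List.mem_toFinset, List.mem_map]
    constructor
    · rintro ⟨q, rfl⟩
      obtain ⟨m, hm, h⟩ := exists_mem_hexads_coset hi q
      exact ⟨m, hm, h.symm⟩
    · rintro ⟨m, hm, rfl⟩
      exact exists_cosetHexad_eq hi hm
  have h1 := Finset.sum_map Finset.univ ⟨cosetHexad i, cosetHexad_injective hi⟩ f
  simp only [Function.Embedding.coeFn_mk] at h1
  rw [← h1, e, List.sum_toFinset _ hn, List.map_map]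
  rfl

/-! ### The rank of the two actions -/

/-- Representatives of the orbits of the `i`-th stabilizer on the `i`-th orbit of sets. -/
def selfReps : Fin 5 → Fin 5 → ℕ :=
  ![![17528, 934, 4397, 857, 1436], ![45442, 869, 5159, 922, 4532], 0, 0, 0]

lemma selfReps_mem : ∀ i, i = 0 ∨ i = 1 → ∀ k, selfReps i k ∈ hexads i := by decide +kernel

lemma hexads_subset_selfReps : ∀ i, i = 0 ∨ i = 1 → ∀ m ∈ hexads i,
    m ∈ (List.finRange 5).flatMap fun k => (aCodes i).map fun c => img c (selfReps i k) := by
  have h : ∀ i, i = 0 ∨ i = 1 → ∀ m ∈ hexads i, (bitSet ((List.finRange 5).flatMap fun k =>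
      (aCodes i).map fun c => img c (selfReps i k))).testBit m = true := by
    decide +kernel
  exact fun i hi m hm => (testBit_bitSet _ _).mp (h i hi m hm)

lemma selfReps_ne : ∀ i, i = 0 ∨ i = 1 → ∀ k l, k ≠ l → ∀ c ∈ aCodes i,
    Nat.beq (img c (selfReps i k)) (selfReps i l) = false := by
  decide +kernel

lemma exists_code_of_mem_aCodes {i : Fin 5} {c : ℕ} (hc : c ∈ aCodes i) :
    ∃ g ∈ a5Sub i, code g = c := by
  rw [← filter_codes] at hc
  obtain ⟨g, rfl⟩ := exists_code_eq (List.mem_filter.mp hc).1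
  rw [filter_codes] at hc
  exact ⟨g, mem_a5Sub_iff.mpr hc, rfl⟩

lemma mk_one_smul {i : Fin 5} {g : T1654} (hg : g ∈ a5Sub i) :
    g • ((1 : T1654) : T1654 ⧸ a5Sub i) = ((1 : T1654) : T1654 ⧸ a5Sub i) := by
  rw [MulAction.Quotient.smul_coe, smul_eq_mul, mul_one, QuotientGroup.eq, mul_one]
  exact inv_mem hg

/-- The pairs of cosets are classified by representatives of the orbits of the stabilizer. -/
lemma exists_smul_self_pair {i : Fin 5} (hi : i = 0 ∨ i = 1) (a b : T1654 ⧸ a5Sub i) :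
    ∃ (k : Fin 5) (g : T1654), g • ((1 : T1654) : T1654 ⧸ a5Sub i) = a ∧
      cosetHexad i (g⁻¹ • b) = ofMask (selfReps i k) := by
  induction a using QuotientGroup.induction_on with
  | H t =>
    obtain ⟨m, hm, e⟩ := exists_mem_hexads_coset hi (t⁻¹ • b)
    obtain ⟨k, -, hk⟩ := List.mem_flatMap.mp (hexads_subset_selfReps i hi m hm)
    obtain ⟨c, hc, rfl⟩ := List.mem_map.mp hk
    obtain ⟨h, hh, rfl⟩ := exists_code_of_mem_aCodes hc
    refine ⟨k, t * h, ?_, ?_⟩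
    · rw [mul_smul, mk_one_smul hh, MulAction.Quotient.smul_coe, smul_eq_mul, mul_one]
    · rw [mul_inv_rev, mul_smul, cosetHexad_smul, e, ← smul_ofMask, inv_smul_smul]

lemma actionRank_a5Sub {i : Fin 5} (hi : i = 0 ∨ i = 1) :
    actionRank T1654 (T1654 ⧸ a5Sub i) = 5 := by
  choose q hq using fun k => exists_cosetHexad_eq hi (selfReps_mem i hi k)
  let f : Fin 5 → MulAction.orbitRel.Quotient T1654 ((T1654 ⧸ a5Sub i) × (T1654 ⧸ a5Sub i)) :=
    fun k => Quotient.mk'' (((1 : T1654) : T1654 ⧸ a5Sub i), q k)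
  have hf : Function.Bijective f := by
    constructor
    · intro k l hkl
      by_contra hne
      obtain ⟨g, hg⟩ : (((1 : T1654) : T1654 ⧸ a5Sub i), q k) ∈
        MulAction.orbit T1654 (((1 : T1654) : T1654 ⧸ a5Sub i), q l) := Quotient.exact hkl
      have h1 : g • ((1 : T1654) : T1654 ⧸ a5Sub i) = ((1 : T1654) : T1654 ⧸ a5Sub i) :=
        congrArg Prod.fst hg
      have h2 : g • q l = q k := congrArg Prod.snd hg
      rw [MulAction.Quotient.smul_coe, smul_eq_mul, mul_one, QuotientGroup.eq, mul_one] at h1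
      have h3 := congrArg (cosetHexad i) h2
      rw [cosetHexad_smul, hq, hq, smul_ofMask] at h3
      have h4 := ofMask_injOn (img_lt _ _) (hexads_lt i _ (selfReps_mem i hi k)) h3
      have h5 := selfReps_ne i hi l k (Ne.symm hne) _ (mem_a5Sub_iff.mp (inv_mem_iff.mp h1))
      rw [h4, Nat.beq_refl] at h5
      exact absurd h5 (by decide)
    · intro x
      induction x using Quotient.inductionOn' with
      | h p =>
        obtain ⟨a, b⟩ := p
        obtain ⟨k, g, h1, h2⟩ := exists_smul_self_pair hi a b
        refine ⟨k, Quotient.sound' ⟨g⁻¹, ?_⟩⟩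
        change (g⁻¹ • a, g⁻¹ • b) = (_, q k)
        rw [← h1, inv_smul_smul, cosetHexad_injective hi (h2.trans (hq k).symm)]
  rw [actionRank, ← Nat.card_congr (Equiv.ofBijective f hf), Nat.card_fin]

/-! ### The double cosets -/

/-- The index of the double coset of two sets that meet in `n` points. -/
def colOf (n : ℕ) : Fin 5 := if n = 0 then 0 else if n = 1 then 1 else if n = 3 then 2 else
  if n = 4 then 3 else 4

lemma colOf_interSizes : ∀ k, colOf (interSizes k) = k := by decide

/-- The index of the double coset that belongs to two cosets. -/
def col (a : T1654 ⧸ a5Sub 0) (b : T1654 ⧸ a5Sub 1) : Fin 5 :=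
  colOf (cosetHexad 0 a ∩ cosetHexad 1 b).card

lemma col_def (a : T1654 ⧸ a5Sub 0) (b : T1654 ⧸ a5Sub 1) :
    col a b = colOf (cosetHexad 0 a ∩ cosetHexad 1 b).card := rfl

attribute [irreducible] col

lemma col_smul (g : T1654) (a : T1654 ⧸ a5Sub 0) (b : T1654 ⧸ a5Sub 1) :
    col (g • a) (g • b) = col a b := by
  rw [col_def, cosetHexad_smul, cosetHexad_smul, card_smul_inter, col_def]

lemma exists_smul_of_col (a : T1654 ⧸ a5Sub 0) (b : T1654 ⧸ a5Sub 1) :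
    ∃ g : T1654, g • hexad 0 = cosetHexad 0 a ∧
      g • ofMask (hexadReps (col a b)) = cosetHexad 1 b := by
  obtain ⟨k, g, h1, h2, h3⟩ := exists_smul_pair (cosetHexad_mem_orbit 0 a) (cosetHexad_mem_orbit 1 b)
  rw [col_def, h3, colOf_interSizes]
  exact ⟨g, h1, h2⟩

lemma exists_smul_of_col_eq {a a' : T1654 ⧸ a5Sub 0} {b b' : T1654 ⧸ a5Sub 1}
    (h : col a b = col a' b') : ∃ g : T1654, g • a = a' ∧ g • b = b' := by
  obtain ⟨g, h1, h2⟩ := exists_smul_of_col a b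
  obtain ⟨g', h1', h2'⟩ := exists_smul_of_col a' b'
  refine ⟨g' * g⁻¹, cosetHexad_injective (Or.inl rfl) ?_, cosetHexad_injective (Or.inr rfl) ?_⟩
  · rw [cosetHexad_smul, ← h1, mul_smul, inv_smul_smul, h1']
  · rw [cosetHexad_smul, ← h2, mul_smul, inv_smul_smul, h, h2']

lemma exists_col_eq (k : Fin 5) : ∃ b, col ((1 : T1654) : T1654 ⧸ a5Sub 0) b = k := by
  obtain ⟨b, hb⟩ := exists_cosetHexad_eq (Or.inr rfl) (hexadReps_mem k)
  refine ⟨b, ?_⟩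
  rw [col_def, hb, cosetHexad_mk, one_smul, hexad, card_inter_ofMask, hexadReps_inter, colOf_interSizes]

lemma col_one_eq_of_rel {g h : T1654}
    (hgh : DoubleCoset.setoid (a5Sub 0 : Set T1654) (a5Sub 1 : Set T1654) g h) :
    col ((1 : T1654) : T1654 ⧸ a5Sub 0) (g : T1654 ⧸ a5Sub 1) =
      col ((1 : T1654) : T1654 ⧸ a5Sub 0) (h : T1654 ⧸ a5Sub 1) := by
  obtain ⟨x, hx, y, hy, rfl⟩ := DoubleCoset.rel_iff.mp hgh
  have e : ((x * g * y : T1654) : T1654 ⧸ a5Sub 1) = x • (g : T1654 ⧸ a5Sub 1) := by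
    rw [MulAction.Quotient.smul_coe, smul_eq_mul, eq_comm, QuotientGroup.eq]
    have : (x * g)⁻¹ * (x * g * y) = y := by group
    rwa [this]
  have e' := col_smul x ((1 : T1654) : T1654 ⧸ a5Sub 0) (g : T1654 ⧸ a5Sub 1)
  rw [mk_one_smul hx, ← e] at e'
  exact e'.symm

/-- The index of a double coset. -/
noncomputable def colDouble
    (D : DoubleCoset.Quotient (a5Sub 0 : Set T1654) (a5Sub 1 : Set T1654)) : Fin 5 :=
  Quotient.liftOn' D (fun g => col ((1 : T1654) : T1654 ⧸ a5Sub 0) (g : T1654 ⧸ a5Sub 1))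
    fun _ _ h => col_one_eq_of_rel h

lemma colDouble_mk (g : T1654) : colDouble (DoubleCoset.mk (a5Sub 0) (a5Sub 1) g) =
    col ((1 : T1654) : T1654 ⧸ a5Sub 0) (g : T1654 ⧸ a5Sub 1) := rfl

lemma colDouble_bijective : Function.Bijective colDouble := by
  constructor
  · intro D D'
    induction D using Quotient.inductionOn' with
    | h g =>
      induction D' using Quotient.inductionOn' with
      | h g' =>
        intro h
        obtain ⟨x, h1, h2⟩ := exists_smul_of_col_eq h
        rw [MulAction.Quotient.smul_coe, smul_eq_mul, mul_one, QuotientGroup.eq, mul_one,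
          inv_mem_iff] at h1
        rw [MulAction.Quotient.smul_coe, smul_eq_mul, QuotientGroup.eq] at h2
        refine Quotient.sound' (DoubleCoset.rel_iff.mpr ⟨x, h1, _, h2, ?_⟩)
        group
  · intro k
    obtain ⟨b, hb⟩ := exists_col_eq k
    obtain ⟨g, rfl⟩ := QuotientGroup.mk_surjective b
    exact ⟨DoubleCoset.mk (a5Sub 0) (a5Sub 1) g, hb⟩

/-- The double cosets, in their order. -/
noncomputable def colEquiv :
    Fin 5 ≃ DoubleCoset.Quotient (a5Sub 0 : Set T1654) (a5Sub 1 : Set T1654) :=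
  (Equiv.ofBijective colDouble colDouble_bijective).symm

lemma colEquiv_symm_mk (g : T1654) : colEquiv.symm (DoubleCoset.mk (a5Sub 0) (a5Sub 1) g) =
    col ((1 : T1654) : T1654 ⧸ a5Sub 0) (g : T1654 ⧸ a5Sub 1) := colDouble_mk g

lemma colEquiv_symm_mk_inv_mul (g h : T1654) :
    colEquiv.symm (DoubleCoset.mk (a5Sub 0) (a5Sub 1) (g⁻¹ * h)) =
      col (g : T1654 ⧸ a5Sub 0) (h : T1654 ⧸ a5Sub 1) := by
  have e := col_smul g ((1 : T1654) : T1654 ⧸ a5Sub 0) ((g⁻¹ * h : T1654) : T1654 ⧸ a5Sub 1)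
  rw [MulAction.Quotient.smul_coe, MulAction.Quotient.smul_coe, smul_eq_mul, smul_eq_mul, mul_one,
    mul_inv_cancel_left] at e
  rw [colEquiv_symm_mk, e]

lemma countP_cosetCounts : ∀ k,
    (hexads 0).countP (fun m => decide (colOf (popCount (m &&& setMask 1)) = k)) =
      cosetCounts k := by
  decide +kernel

lemma ncard_rightCosetsIn (k : Fin 5) (g : T1654)
    (hg : DoubleCoset.mk (a5Sub 0) (a5Sub 1) g = colEquiv k) :
    (rightCosetsIn (a5Sub 0) (DoubleCoset.doubleCoset g (a5Sub 0) (a5Sub 1))).ncard =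
      cosetCounts k := by
  classical
  have hk : col ((1 : T1654) : T1654 ⧸ a5Sub 0) (g : T1654 ⧸ a5Sub 1) = k := by
    rw [← colEquiv_symm_mk, hg, Equiv.symm_apply_apply]
  -- a right coset `H₁ x` corresponds to the coset `x⁻¹ H₁`
  let R : T1654 → Set T1654 := fun x => {y | ∃ h ∈ a5Sub 0, y = h * x}
  have hR : ∀ x y, R x = R y ↔ ((x⁻¹ : T1654) : T1654 ⧸ a5Sub 0) = ((y⁻¹ : T1654) : T1654 ⧸ a5Sub 0) := by
    intro x y
    rw [QuotientGroup.eq, inv_inv]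
    constructor
    · intro h
      have : x ∈ R y := h ▸ ⟨1, one_mem _, (one_mul x).symm⟩
      obtain ⟨h, hh, rfl⟩ := this
      simpa using hh
    · intro h
      ext z
      constructor
      · rintro ⟨t, ht, rfl⟩
        exact ⟨t * (x * y⁻¹), mul_mem ht h, by group⟩
      · rintro ⟨t, ht, rfl⟩
        exact ⟨t * (x * y⁻¹)⁻¹, mul_mem ht (inv_mem h), by group⟩
  have hmem : ∀ x, R x ⊆ DoubleCoset.doubleCoset g (a5Sub 0) (a5Sub 1) ↔
      col ((x⁻¹ : T1654) : T1654 ⧸ a5Sub 0) ((1 : T1654) : T1654 ⧸ a5Sub 1) = k := by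
    intro x
    have h1 : col ((x⁻¹ : T1654) : T1654 ⧸ a5Sub 0) ((1 : T1654) : T1654 ⧸ a5Sub 1) =
        colEquiv.symm (DoubleCoset.mk (a5Sub 0) (a5Sub 1) x) := by
      have e := colEquiv_symm_mk_inv_mul x⁻¹ 1
      rwa [inv_inv, mul_one, eq_comm] at e
    rw [h1, Equiv.symm_apply_eq, ← hg]
    constructor
    · intro h
      have hx : x ∈ DoubleCoset.doubleCoset g (a5Sub 0 : Set T1654) (a5Sub 1) :=
        h ⟨1, one_mem _, (one_mul x).symm⟩
      exact (DoubleCoset.eq _ _ _ _).mpr (by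
        obtain ⟨a, ha, b, hb, rfl⟩ := DoubleCoset.mem_doubleCoset.mp hx
        exact ⟨a⁻¹, inv_mem ha, b⁻¹, inv_mem hb, by group⟩)
    · intro h
      obtain ⟨a, ha, b, hb, rfl⟩ := (DoubleCoset.eq _ _ _ _).mp h
      rintro _ ⟨t, ht, rfl⟩
      exact DoubleCoset.mem_doubleCoset.mpr ⟨t * a⁻¹, mul_mem ht (inv_mem ha), b⁻¹, inv_mem hb, by group⟩
  have hset : rightCosetsIn (a5Sub 0) (DoubleCoset.doubleCoset g (a5Sub 0) (a5Sub 1)) =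
      (fun q : T1654 ⧸ a5Sub 0 => R (Quotient.out q)⁻¹) ''
        {q | col q ((1 : T1654) : T1654 ⧸ a5Sub 1) = k} := by
    ext S
    constructor
    · rintro ⟨⟨x, rfl⟩, hx⟩
      refine ⟨((x⁻¹ : T1654) : T1654 ⧸ a5Sub 0), (hmem x).mp hx, ?_⟩
      refine (hR _ _).mpr ?_
      rw [inv_inv]
      exact QuotientGroup.out_eq' _
    · rintro ⟨q, hq, rfl⟩
      refine ⟨⟨_, rfl⟩, (hmem _).mpr ?_⟩
      rw [inv_inv]
      have : ((Quotient.out q : T1654) : T1654 ⧸ a5Sub 0) = q := QuotientGroup.out_eq' q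
      rw [this]
      exact hq
  have hinj : Function.Injective fun q : T1654 ⧸ a5Sub 0 => R (Quotient.out q)⁻¹ := by
    intro p q h
    have := (hR _ _).mp h
    rw [inv_inv, inv_inv] at this
    exact (QuotientGroup.out_eq' p).symm.trans (this.trans (QuotientGroup.out_eq' q))
  have hsum := sum_coset (i := 0) (Or.inl rfl) fun S =>
    if colOf (S ∩ hexad 1).card = k then 1 else 0
  rw [hset, Set.ncard_image_of_injective _ hinj, ← countP_cosetCounts,
    Set.ncard_eq_toFinset_card', Set.toFinset_ofPred, Finset.card_filter]
  simp only [col_def, cosetHexad_mk, one_smul]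
  rw [hsum]
  have hl : ∀ l : List ℕ, (l.map fun m => if colOf (ofMask m ∩ hexad 1).card = k then 1 else 0).sum =
      l.countP fun m => decide (colOf (popCount (m &&& setMask 1)) = k) := by
    intro l
    induction l with
    | nil => rfl
    | cons m l ih =>
      rw [List.map_cons, List.sum_cons, ih, List.countP_cons, hexad, card_inter_ofMask, add_comm]
      simp
  exact hl _

/-! ### Determinants of families of matrices with orthogonal rows -/

lemma det_one_add_smul_idempotent {K n : Type*} [Field K] [Fintype n] [DecidableEq n]
    {E : Matrix n n K} (hE : E * E = E) (z : K) :
    ∃ r : ℕ, E.trace = r ∧ (1 + (z - 1) • E).det = z ^ r := by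
  have hid : IsIdempotentElem (Matrix.toLin' E) := by
    rw [IsIdempotentElem, Module.End.mul_eq_comp, ← Matrix.toLin'_mul, hE]
  have hp := LinearMap.IsIdempotentElem.isProj_range _ hid
  have htr := hp.trace
  rw [Matrix.trace_toLin'_eq] at htr
  refine ⟨_, htr, ?_⟩
  have h := hp.eq_conj_prodMap
  set e := (LinearMap.range (Matrix.toLin' E)).prodEquivOfIsCompl (LinearMap.ker (Matrix.toLin' E))
    hp.isCompl
  have h2 : Matrix.toLin' (1 + (z - 1) • E) =
      e.conj ((z • LinearMap.id).prodMap LinearMap.id) := by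
    have h3 : ((z • LinearMap.id).prodMap LinearMap.id :
        (LinearMap.range (Matrix.toLin' E) × LinearMap.ker (Matrix.toLin' E)) →ₗ[K] _) =
        LinearMap.id + (z - 1) • (LinearMap.id.prodMap 0) := by
      ext x <;> simp [sub_smul]
    rw [h3, map_add, map_smul, map_add, map_smul, ← h, Matrix.toLin'_one, LinearEquiv.conj_id]
  rw [← LinearMap.det_toLin', h2, LinearEquiv.conj_apply, LinearMap.comp_assoc,
    LinearMap.det_conj, LinearMap.det_prodMap, LinearMap.det_smul]
  simp

/-- If the matrices `F m Uᵀ`, with `U` the sum of the family, are orthogonal idempotents with sum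
`1`, then the combinations of the `F m` have determinants that are, up to a sign, products of powers
of the coefficients. -/
lemma det_sum_smul_of_orthogonal {K n ι : Type*} [Field K] [CharZero K] [Fintype n] [DecidableEq n]
    [Fintype ι] [DecidableEq ι] (F : ι → Matrix n n K) (r : ι → ℕ)
    (horth : ∀ i j, i ≠ j → F i * (F j).transpose = 0)
    (hone : ∑ i, F i * (F i).transpose = 1) (htr : ∀ i, (F i * (F i).transpose).trace = r i) :
    ∃ s : K, s * s = 1 ∧ ∀ z : ι → K, (∑ i, z i • F i).det = s * ∏ i, z i ^ r i := by
  set U := ∑ i, F i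
  have hFU : ∀ i, F i * U.transpose = F i * (F i).transpose := fun i => by
    rw [Matrix.transpose_sum, Finset.mul_sum]
    exact Finset.sum_eq_single i (fun j _ hj => horth i j hj.symm) (by simp)
  have hU : U * U.transpose = 1 := by
    rw [Finset.sum_mul, ← hone]
    exact Finset.sum_congr rfl fun i _ => hFU i
  have hU' : U.transpose * U = 1 := mul_eq_one_comm.mp hU
  set E : ι → Matrix n n K := fun i => F i * U.transpose
  have hE : ∀ i j, E i * E j = if i = j then E i else 0 := fun i j => by
    have h1 : E j = U * (F j).transpose := by
      have : (E j).transpose = E j := by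
        simp only [E, hFU, Matrix.transpose_mul, Matrix.transpose_transpose]
      rw [← this]
      simp only [E, Matrix.transpose_mul, Matrix.transpose_transpose]
    rw [h1, Matrix.mul_assoc, ← Matrix.mul_assoc U.transpose, hU', Matrix.one_mul]
    split_ifs with h
    · rw [h, ← hFU]
    · exact horth i j h
  have hsum : ∑ i, E i = 1 := by
    rw [← Finset.sum_mul]
    exact hU
  refine ⟨U.det, ?_, fun z => ?_⟩
  · have := congrArg Matrix.det hU
    rwa [Matrix.det_mul, Matrix.det_transpose, Matrix.det_one] at this
  have hfac : ∑ i, z i • F i = (∑ i, z i • E i) * U := by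
    rw [Finset.sum_mul]
    refine Finset.sum_congr rfl fun i _ => ?_
    rw [Matrix.smul_mul, Matrix.mul_assoc, hU', Matrix.mul_one]
  have hprod : ∀ s : Finset ι, (1 + ∑ i ∈ s, (z i - 1) • E i).det = ∏ i ∈ s, z i ^ r i := by
    intro s
    induction s using Finset.induction_on with
    | empty => simp
    | insert j s hj ih =>
      have hmul : 1 + ∑ i ∈ insert j s, (z i - 1) • E i =
          (1 + (z j - 1) • E j) * (1 + ∑ i ∈ s, (z i - 1) • E i) := by
        have h0 : E j * ∑ i ∈ s, (z i - 1) • E i = 0 := by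
          rw [Finset.mul_sum]
          refine Finset.sum_eq_zero fun i hi => ?_
          rw [Matrix.mul_smul, hE, if_neg (by rintro rfl; exact hj hi), smul_zero]
        rw [Finset.sum_insert hj, Matrix.mul_add, Matrix.mul_one, Matrix.add_mul, Matrix.one_mul,
          Matrix.smul_mul, h0, smul_zero, add_zero]
        abel
      obtain ⟨d, hd, hdet⟩ := det_one_add_smul_idempotent ((hE j j).trans (if_pos rfl)) (z j)
      rw [Finset.prod_insert hj, ← ih, hmul, Matrix.det_mul, hdet]
      have : (d : K) = r j := by
        rw [← hd, ← htr j, ← hFU]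
      rw [Nat.cast_injective this]
  have hlin : ∑ i, z i • E i = 1 + ∑ i, (z i - 1) • E i := by
    simp only [sub_smul, one_smul, Finset.sum_sub_distrib, hsum]
    abel
  rw [hfac, Matrix.det_mul, hlin, hprod, mul_comm]

/-! ### The determinant of the general homomorphism -/

/-- The matrix with entry `x k` at the pairs of cosets in the `k`-th double coset. -/
def colMatrix {R : Type*} (x : Fin 5 → R) : Matrix (T1654 ⧸ a5Sub 0) (T1654 ⧸ a5Sub 1) R :=
  Matrix.of fun a b => x (col a b)

/-- `96` times the basis dual to the five linear forms. -/
def dualVec : Fin 5 → Fin 5 → ℤ :=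
  ![![1, 1, 1, 1, 1], ![1, -5, -5, 1, 1], ![9, 5, -3, -7, 1], ![18, -10, 6, 2, -2],
    ![9, 15, -9, 9, -3]]

/-- For the `r`-th representative `S` of the orbits on the first set of cosets, and the sets `T` in
the second orbit, the numbers `5 k + l`, where `k` and `l` are the indices of the double cosets that
belong to the first set and `T`, and to `S` and `T`. -/
def pairKeys : Fin 5 → List ℕ :=
  ![[24, 24, 18, 24, 24, 24, 24, 18, 0, 24, 24, 24, 24, 18, 24, 24, 24, 24, 24, 0, 24, 18, 24, 24,
     24, 24, 24, 18, 24, 18, 24, 24, 12, 12, 12, 6, 6, 12, 12, 12, 6, 12, 12, 12, 6, 6, 6, 12, 24,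
     24, 24, 24, 24, 24, 18, 18, 24, 24, 0, 18, 24, 24, 24, 24, 24, 24, 24, 24, 24, 24, 24, 24, 0,
     24, 24, 18, 18, 24, 24, 18, 24, 24, 24, 24, 24, 18, 24, 18, 24, 24, 24, 24, 18, 24, 0, 24],
    [23, 23, 19, 24, 24, 24, 23, 15, 4, 24, 24, 24, 24, 19, 24, 24, 24, 24, 24, 4, 24, 15, 23, 24,
     24, 23, 23, 19, 24, 19, 24, 24, 14, 14, 14, 9, 8, 14, 13, 14, 9, 14, 14, 14, 9, 8, 9, 10, 23,
     24, 24, 24, 23, 24, 19, 19, 24, 24, 3, 19, 24, 24, 20, 24, 23, 24, 24, 24, 24, 20, 24, 24, 3,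
     24, 24, 19, 19, 23, 24, 19, 22, 22, 21, 22, 22, 16, 22, 17, 22, 21, 22, 22, 16, 21, 2, 21],
    [24, 23, 19, 24, 23, 24, 24, 19, 4, 24, 24, 23, 24, 19, 20, 24, 24, 24, 24, 3, 24, 15, 24, 24,
     24, 24, 24, 18, 24, 18, 24, 24, 12, 12, 11, 7, 7, 11, 12, 12, 6, 12, 11, 11, 7, 7, 6, 12, 23,
     23, 24, 24, 24, 24, 19, 19, 24, 24, 4, 19, 20, 23, 24, 24, 24, 24, 24, 24, 24, 24, 24, 24, 4,
     23, 23, 19, 19, 23, 20, 19, 24, 23, 24, 23, 24, 19, 24, 19, 20, 24, 23, 24, 19, 24, 4, 24],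
    [23, 23, 19, 24, 24, 24, 20, 18, 4, 24, 24, 24, 24, 19, 24, 24, 24, 24, 24, 4, 20, 19, 24, 23,
     23, 24, 24, 18, 24, 19, 24, 24, 14, 14, 14, 9, 9, 13, 14, 13, 9, 14, 14, 14, 8, 9, 5, 14, 24,
     23, 24, 24, 24, 23, 19, 19, 24, 24, 4, 18, 24, 24, 24, 20, 24, 23, 24, 24, 20, 24, 24, 24, 4,
     23, 24, 19, 18, 24, 24, 19, 22, 22, 22, 21, 21, 17, 22, 17, 21, 22, 22, 22, 16, 21, 1, 22],
    [23, 24, 19, 23, 24, 24, 24, 19, 0, 24, 24, 23, 24, 19, 24, 24, 24, 24, 24, 4, 24, 19, 24, 24,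
     24, 23, 24, 18, 23, 19, 20, 24, 14, 14, 14, 9, 9, 14, 13, 13, 9, 14, 10, 13, 9, 9, 9, 14, 22,
     22, 22, 21, 21, 22, 17, 17, 21, 22, 2, 17, 21, 21, 21, 22, 24, 24, 23, 24, 20, 24, 24, 24, 4,
     24, 24, 18, 19, 23, 24, 19, 24, 23, 24, 24, 24, 18, 24, 19, 24, 24, 24, 23, 19, 24, 4, 20]]

lemma map_hexads_eq_pairKeys : ∀ r, ((hexads 1).map fun T =>
    5 * (colOf (popCount (setMask 0 &&& T)) : ℕ) + colOf (popCount (selfReps 0 r &&& T))) =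
      pairKeys r := by
  decide +kernel

/-- The values of a coefficient vector, numbered by natural numbers. -/
def vecAt (v : Fin 5 → ℤ) (n : ℕ) : ℤ := v (Fin.ofNat 5 n)

/-- The value of the bilinear form that gives the entries of products `F Gᵀ`. -/
def pairSum (r : Fin 5) (v w : Fin 5 → ℤ) : ℤ :=
  ((pairKeys r).map fun q => vecAt v (q / 5) * vecAt w q).sum

lemma pairSum_of_ne : ∀ r m n, m ≠ n → pairSum r (dualVec m) (dualVec n) = 0 := by
  decide +kernel

/-- The exponents of the linear forms in the determinant. -/
def formExp : Fin 5 → ℕ := ![1, 5, 15, 30, 45]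

lemma pairSum_zero : ∀ m, pairSum 0 (dualVec m) (dualVec m) = 96 * formExp m := by
  decide +kernel

lemma sum_pairSum : ∀ r, ∑ m, pairSum r (dualVec m) (dualVec m) = if r = 0 then 96 ^ 2 else 0 := by
  decide +kernel

lemma ofMask_selfReps_zero : ofMask (selfReps 0 0) = hexad 0 :=
  congrArg ofMask (by decide +kernel)

/-- The entries of a product `F Gᵀ` depend only on the orbit of the pair of cosets. -/
lemma exists_mul_transpose_apply (a a' : T1654 ⧸ a5Sub 0) :
    ∃ r : Fin 5, (r = 0 ↔ a = a') ∧ ∀ v w : Fin 5 → ℤ,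
      ∑ b, v (col a b) * w (col a' b) = pairSum r v w := by
  obtain ⟨r, g, h1, h2⟩ := exists_smul_self_pair (i := 0) (Or.inl rfl) a a'
  refine ⟨r, ⟨?_, ?_⟩, fun v w => ?_⟩
  · intro hr
    rw [hr] at h2
    have h3 : g⁻¹ • a' = ((1 : T1654) : T1654 ⧸ a5Sub 0) :=
      cosetHexad_injective (Or.inl rfl) (h2.trans (by rw [cosetHexad_mk, one_smul, ofMask_selfReps_zero]))
    rw [← h1, ← h3, smul_inv_smul]
  · intro ha
    rw [← ha] at h2
    have h3 : ofMask (selfReps 0 r) = ofMask (selfReps 0 0) := by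
      rw [← h2, ← h1, inv_smul_smul, cosetHexad_mk, one_smul, ofMask_selfReps_zero]
    have h4 : ∀ r, r ≠ 0 → selfReps 0 r ≠ selfReps 0 0 := by decide
    by_contra hr
    exact h4 r hr (ofMask_injOn_hexads (selfReps_mem 0 (Or.inl rfl) r)
      (selfReps_mem 0 (Or.inl rfl) 0) h3)
  · have hcol : ∀ b, col a b = col ((1 : T1654) : T1654 ⧸ a5Sub 0) (g⁻¹ • b) := fun b => by
      rw [← col_smul g⁻¹, ← h1, inv_smul_smul]
    have hcol' : ∀ b, col a' b = col (g⁻¹ • a') (g⁻¹ • b) := fun b => (col_smul _ _ _).symm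
    simp only [hcol, hcol']
    refine (Equiv.sum_comp (MulAction.toPerm g⁻¹) fun b =>
      v (col ((1 : T1654) : T1654 ⧸ a5Sub 0) b) * w (col (g⁻¹ • a') b)).trans ?_
    simp only [col_def, h2, cosetHexad_mk, one_smul]
    rw [sum_coset (i := 1) (Or.inr rfl) fun T =>
      v (colOf (hexad 0 ∩ T).card) * w (colOf (ofMask (selfReps 0 r) ∩ T).card), pairSum,
      ← map_hexads_eq_pairKeys, List.map_map]
    congr 1
    refine List.map_congr_left fun T _ => ?_
    have aux : ∀ k l : Fin 5, Fin.ofNat 5 ((5 * (k : ℕ) + l) / 5) = k ∧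
        Fin.ofNat 5 (5 * (k : ℕ) + l) = l := by decide
    rw [Function.comp_apply, vecAt, vecAt, (aux _ _).1, (aux _ _).2, hexad, card_inter_ofMask,
      card_inter_ofMask]

/-- The determinant of a matrix with entries `x (c a b)`, under the relations that hold for the
classes of pairs of cosets. -/
lemma det_of_pairSum {α β : Type*} [Fintype α] [Fintype β] (c : α → β → Fin 5)
    (hα : Nat.card α = 96) (hβ : Nat.card β = 96)
    (hc : ∀ a a', ∃ r : Fin 5, (r = 0 ↔ a = a') ∧ ∀ v w : Fin 5 → ℤ,
      ∑ b, v (c a b) * w (c a' b) = pairSum r v w) :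
    ∃ (e₁ : Fin 96 ≃ α) (e₂ : Fin 96 ≃ β), ∀ x : Fin 5 → ℤ,
      ((Matrix.of fun a b => x (c a b)).submatrix e₁ e₂).det =
      -(linForm x 0 * linForm x 1 ^ 5 * linForm x 2 ^ 15 * linForm x 3 ^ 30 *
        linForm x 4 ^ 45) := by
  have e₁ : Fin 96 ≃ α := (Finite.equivFinOfCardEq hα).symm
  have e₂ : Fin 96 ≃ β := (Finite.equivFinOfCardEq hβ).symm
  let M : (Fin 5 → ℤ) → Matrix α β ℤ := fun v => Matrix.of fun a b => v (c a b)
  let Z : Fin 5 → Matrix (Fin 96) (Fin 96) ℤ := fun m => (M (dualVec m)).submatrix e₁ e₂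
  let F : Fin 5 → Matrix (Fin 96) (Fin 96) ℚ := fun m => (96⁻¹ : ℚ) • (Z m).map (Int.castRingHom ℚ)
  have hF : ∀ m n, F m * (F n).transpose =
      (96⁻¹ * 96⁻¹ : ℚ) • (Z m * (Z n).transpose).map (Int.castRingHom ℚ) := fun m n => by
    rw [Matrix.transpose_smul, Matrix.smul_mul, Matrix.mul_smul, smul_smul, Matrix.map_mul,
      Matrix.transpose_map]
  have hM : ∀ v w a a', (M v * (M w).transpose) a a' = ∑ b, v (c a b) * w (c a' b) :=
    fun v w a a' => rfl
  have hZ : ∀ m n, Z m * (Z n).transpose =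
      (M (dualVec m) * (M (dualVec n)).transpose).submatrix e₁ e₁ := fun m n => by
    rw [Matrix.transpose_submatrix, Matrix.submatrix_mul_equiv]
  have horth : ∀ m n, m ≠ n → F m * (F n).transpose = 0 := by
    intro m n hmn
    rw [hF, hZ]
    ext i j
    obtain ⟨r, -, hr⟩ := hc (e₁ i) (e₁ j)
    rw [Matrix.smul_apply, Matrix.map_apply, Matrix.submatrix_apply, hM, hr,
      pairSum_of_ne r m n hmn]
    simp
  have hone : ∑ m, F m * (F m).transpose = 1 := by
    ext i j
    obtain ⟨r, h0, hr⟩ := hc (e₁ i) (e₁ j)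
    simp only [Matrix.sum_apply, hF, hZ, Matrix.smul_apply, Matrix.map_apply,
      Matrix.submatrix_apply, hM, hr]
    rw [← Finset.smul_sum, ← map_sum, sum_pairSum, Matrix.one_apply]
    rw [EmbeddingLike.apply_eq_iff_eq] at h0
    by_cases hij : i = j
    · rw [if_pos (h0.mpr hij), if_pos hij]
      norm_num
    · rw [if_neg (fun h => hij (h0.mp h)), if_neg hij]
      simp
  have htr : ∀ m, (F m * (F m).transpose).trace = formExp m := by
    intro m
    have : ∀ i, (F m * (F m).transpose) i i = (96⁻¹ : ℚ) * formExp m := fun i => by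
      obtain ⟨r, h0, hr⟩ := hc (e₁ i) (e₁ i)
      rw [hF, hZ, Matrix.smul_apply, Matrix.map_apply, Matrix.submatrix_apply, hM, hr, h0.mpr rfl,
        pairSum_zero]
      rw [smul_eq_mul, eq_intCast]
      push_cast
      ring
    simp only [Matrix.trace, Matrix.diag, this, Finset.sum_const, Finset.card_univ,
      Fintype.card_fin, nsmul_eq_mul]
    push_cast
    ring
  obtain ⟨s, hs, hdet⟩ := det_sum_smul_of_orthogonal F formExp horth hone htr
  -- the sign is adjusted by a transposition of the columns
  have hsign : s = 1 ∨ s = -1 := mul_self_eq_one_iff.mp hs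
  obtain ⟨σ, hσ⟩ : ∃ σ : Equiv.Perm (Fin 96), ((Equiv.Perm.sign σ : ℤ) : ℚ) * s = -1 := by
    rcases hsign with rfl | rfl
    · exact ⟨Equiv.swap 0 1, by rw [Equiv.Perm.sign_swap (by decide)]; norm_num⟩
    · exact ⟨1, by simp⟩
  refine ⟨e₁, σ.trans e₂, fun x => ?_⟩
  change ((M x).submatrix e₁ (σ.trans e₂)).det = _
  have hx : ((M x).submatrix e₁ e₂).map (Int.castRingHom ℚ) =
      ∑ m, (linForm x m : ℚ) • F m := by
    have hdual : ∀ k, (x k : ℚ) = ∑ m, (linForm x m : ℚ) * (96⁻¹ * (dualVec m k : ℚ)) := by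
      intro k
      rw [Fin.sum_univ_five]
      fin_cases k <;> simp [linForm, dualVec] <;> ring
    ext i j
    simp only [Matrix.map_apply, Matrix.submatrix_apply, Matrix.sum_apply, Matrix.smul_apply, F, Z,
      M, Matrix.of_apply, smul_eq_mul]
    exact hdual _
  have hdx := hdet fun m => (linForm x m : ℚ)
  rw [← hx] at hdx
  have hperm : (M x).submatrix e₁ (σ.trans e₂) =
      ((M x).submatrix e₁ e₂).submatrix id σ := rfl
  have hcast : ((((M x).submatrix e₁ e₂).det : ℤ) : ℚ) =
      (((M x).submatrix e₁ e₂).map (Int.castRingHom ℚ)).det :=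
    RingHom.map_det (Int.castRingHom ℚ) _
  rw [hperm, Matrix.det_permute']
  have hQ : ((((Equiv.Perm.sign σ : ℤˣ) : ℤ) * ((M x).submatrix e₁ e₂).det : ℤ) : ℚ) =
      ((-(linForm x 0 * linForm x 1 ^ 5 * linForm x 2 ^ 15 * linForm x 3 ^ 30 *
        linForm x 4 ^ 45) : ℤ) : ℚ) := by
    rw [Int.cast_mul, hcast, hdx, ← mul_assoc, hσ, Fin.prod_univ_five]
    simp only [formExp]
    push_cast
    simp
  exact_mod_cast hQ

lemma det_colMatrix : ∃ (e₁ : Fin 96 ≃ T1654 ⧸ a5Sub 0) (e₂ : Fin 96 ≃ T1654 ⧸ a5Sub 1),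
    ∀ x : Fin 5 → ℤ, ((colMatrix x).submatrix e₁ e₂).det =
      -(linForm x 0 * linForm x 1 ^ 5 * linForm x 2 ^ 15 * linForm x 3 ^ 30 *
        linForm x 4 ^ 45) :=
  det_of_pairSum col (card_quotient_a5Sub 0) (card_quotient_a5Sub 1) exists_mul_transpose_apply

lemma not_forall_linForm_eq : ¬ ∃ x : Fin 5 → ℤ, ∀ k, linForm x k = 1 ∨ linForm x k = -1 := by
  rintro ⟨x, hx⟩
  have h0 := hx 0
  have h1 := hx 1
  have h2 := hx 2
  have h3 := hx 3
  have h4 := hx 4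
  simp only [linForm, Matrix.cons_val] at h0 h1 h2 h3 h4
  omega

/-! ### Homomorphisms of permutation modules -/

section PermModule

variable {G : Type*} [Group G] (R : Type*) [CommRing R]

/-- The basis of a permutation module that consists of the cosets. -/
noncomputable def permBasis (H : Subgroup G) : Module.Basis (G ⧸ H) R (PermModule R H) :=
  .ofRepr ((Representation.ofMulAction R G (G ⧸ H)).asModuleEquiv.trans
    (MonoidAlgebra.coeffLinearEquiv R))

variable {R} {H₁ H₂ : Subgroup G}

lemma permBasis_apply (H : Subgroup G) (a : G ⧸ H) : permBasis R H a =
    (Representation.ofMulAction R G (G ⧸ H)).asModuleEquiv.symm (MonoidAlgebra.single a 1) := rfl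

lemma single_smul_permBasis (H : Subgroup G) (g : G) (a : G ⧸ H) :
    MonoidAlgebra.single g (1 : R) • permBasis R H a = permBasis R H (g • a) := by
  rw [permBasis_apply, permBasis_apply, Representation.single_smul, one_smul,
    LinearEquiv.apply_symm_apply, Representation.ofMulAction_single]
  rfl

lemma homMatrix_apply (φ : PermModule ℤ H₁ →ₗ[MonoidAlgebra ℤ G] PermModule ℤ H₂)
    (a : G ⧸ H₁) (b : G ⧸ H₂) :
    homMatrix φ a b = (permBasis ℤ H₂).repr (φ (permBasis ℤ H₁ a)) b := rfl

lemma permHom_ext {φ ψ : PermModule R H₁ →ₗ[MonoidAlgebra R G] PermModule R H₂}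
    (h : ∀ a b, (permBasis R H₂).repr (φ (permBasis R H₁ a)) b =
      (permBasis R H₂).repr (ψ (permBasis R H₁ a)) b) : φ = ψ := by
  have h1 : φ.restrictScalars R = ψ.restrictScalars R :=
    (permBasis R H₁).ext fun a => (permBasis R H₂).repr.injective (Finsupp.ext (h a))
  ext x
  exact LinearMap.congr_fun h1 x

lemma isUnit_det_of_equiv {n : Type*} [Fintype n] [DecidableEq n]
    (e₁ : n ≃ G ⧸ H₁) (e₂ : n ≃ G ⧸ H₂)
    (φ : PermModule R H₁ ≃ₗ[MonoidAlgebra R G] PermModule R H₂) :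
    IsUnit (Matrix.of fun i j =>
      (permBasis R H₂).repr (φ (permBasis R H₁ (e₁ i))) (e₂ j)).det := by
  let v := (permBasis R H₁).reindex e₁.symm
  let w := (permBasis R H₂).reindex e₂.symm
  have hmat : LinearMap.toMatrix v w (φ.restrictScalars R).toLinearMap = (Matrix.of fun i j =>
      (permBasis R H₂).repr (φ (permBasis R H₁ (e₁ i))) (e₂ j)).transpose := by
    ext i j
    rw [LinearMap.toMatrix_apply, Matrix.transpose_apply]
    simp only [v, w, Module.Basis.repr_reindex, Module.Basis.reindex_apply, Equiv.symm_symm,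
      Finsupp.mapDomain_equiv_apply]
    rfl
  rw [← Matrix.det_transpose, ← hmat]
  exact LinearEquiv.isUnit_det _ v w

variable [Fintype (G ⧸ H₂)]

/-- The homomorphism of permutation modules with a given invariant matrix. -/
noncomputable def homOfMatrix (M : Matrix (G ⧸ H₁) (G ⧸ H₂) R)
    (hM : ∀ (g : G) a b, M (g • a) (g • b) = M a b) :
    PermModule R H₁ →ₗ[MonoidAlgebra R G] PermModule R H₂ :=
  MonoidAlgebra.equivariantOfLinearOfComm
    ((permBasis R H₁).constr R fun a => ∑ b, M a b • permBasis R H₂ b) <| by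
    intro g v
    refine Submodule.span_induction (fun x hx => ?_) ?_ (fun x y _ _ hx hy => ?_)
      (fun c x _ hx => ?_) ((permBasis R H₁).mem_span v)
    · obtain ⟨a, rfl⟩ := hx
      rw [single_smul_permBasis, Module.Basis.constr_basis, Module.Basis.constr_basis,
        Finset.smul_sum, ← Equiv.sum_comp (MulAction.toPerm g)]
      refine Finset.sum_congr rfl fun b _ => ?_
      rw [MulAction.toPerm_apply, hM, smul_comm, single_smul_permBasis]
    · rw [smul_zero, map_zero, smul_zero]
    · rw [smul_add, map_add, hx, hy, map_add, smul_add]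
    · rw [smul_comm, map_smul, hx, map_smul, smul_comm]

lemma homOfMatrix_permBasis (M : Matrix (G ⧸ H₁) (G ⧸ H₂) R)
    (hM : ∀ (g : G) a b, M (g • a) (g • b) = M a b) (a : G ⧸ H₁) :
    homOfMatrix M hM (permBasis R H₁ a) = ∑ b, M a b • permBasis R H₂ b :=
  (permBasis R H₁).constr_basis R _ a

lemma repr_homOfMatrix (M : Matrix (G ⧸ H₁) (G ⧸ H₂) R)
    (hM : ∀ (g : G) a b, M (g • a) (g • b) = M a b) (a : G ⧸ H₁) (b : G ⧸ H₂) :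
    (permBasis R H₂).repr (homOfMatrix M hM (permBasis R H₁ a)) b = M a b := by
  classical
  rw [homOfMatrix_permBasis, Module.Basis.repr_sum_self]

lemma repr_smul_smul (φ : PermModule R H₁ →ₗ[MonoidAlgebra R G] PermModule R H₂) (g : G)
    (a : G ⧸ H₁) (b : G ⧸ H₂) :
    (permBasis R H₂).repr (φ (permBasis R H₁ (g • a))) (g • b) =
      (permBasis R H₂).repr (φ (permBasis R H₁ a)) b := by
  classical
  have h := (permBasis R H₂).sum_repr (φ (permBasis R H₁ a))
  rw [← single_smul_permBasis, map_smul φ]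
  conv_lhs => rw [← h]
  rw [Finset.smul_sum, map_sum, Finset.sum_apply']
  have h2 : ∀ c, (permBasis R H₂).repr (MonoidAlgebra.single g (1 : R) •
      (permBasis R H₂).repr (φ (permBasis R H₁ a)) c • permBasis R H₂ c) (g • b) =
      if c = b then (permBasis R H₂).repr (φ (permBasis R H₁ a)) c else 0 := by
    intro c
    rw [smul_comm, single_smul_permBasis, map_smul (permBasis R H₂).repr, Finsupp.smul_apply, Module.Basis.repr_self,
      Finsupp.single_apply]
    by_cases hcb : c = b
    · rw [if_pos hcb, if_pos (congrArg (g • ·) hcb), smul_eq_mul, mul_one]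
    · rw [if_neg hcb, if_neg fun h => hcb (MulAction.injective g h), smul_zero]
  simp only [h2]
  simp

lemma equivalentOver_of_isUnit_det {n : Type*} [Fintype n] [DecidableEq n]
    (e₁ : n ≃ G ⧸ H₁) (e₂ : n ≃ G ⧸ H₂) (M : Matrix (G ⧸ H₁) (G ⧸ H₂) R)
    (hM : ∀ (g : G) a b, M (g • a) (g • b) = M a b) (hdet : IsUnit (M.submatrix e₁ e₂).det) :
    EquivalentOver R H₁ H₂ := by
  let φ := homOfMatrix M hM
  let v := (permBasis R H₁).reindex e₁.symm
  let w := (permBasis R H₂).reindex e₂.symm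
  have hmat : LinearMap.toMatrix v w (φ.restrictScalars R) = (M.submatrix e₁ e₂).transpose := by
    ext i j
    rw [LinearMap.toMatrix_apply, Matrix.transpose_apply, Matrix.submatrix_apply]
    simp only [v, w, Module.Basis.repr_reindex, Module.Basis.reindex_apply, Equiv.symm_symm,
      Finsupp.mapDomain_equiv_apply, LinearMap.restrictScalars_apply]
    exact repr_homOfMatrix M hM _ _
  have hu : IsUnit (LinearMap.toMatrix v w (φ.restrictScalars R)).det := by
    rwa [hmat, Matrix.det_transpose]
  have hb : Function.Bijective φ := (LinearEquiv.ofIsUnitDet hu).bijective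
  exact ⟨LinearEquiv.ofBijective φ hb⟩

end PermModule

lemma colMatrix_smul {R : Type*} (x : Fin 5 → R) (g : T1654) (a : T1654 ⧸ a5Sub 0)
    (b : T1654 ⧸ a5Sub 1) : colMatrix x (g • a) (g • b) = colMatrix x a b := by
  rw [colMatrix, Matrix.of_apply, Matrix.of_apply, col_smul]

/-- The homomorphism of the integral permutation modules with given coefficients at the double
cosets. -/
noncomputable def colHomFun (x : Fin 5 → ℤ) :
    PermModule ℤ (a5Sub 0) →ₗ[MonoidAlgebra ℤ T1654] PermModule ℤ (a5Sub 1) :=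
  homOfMatrix (colMatrix x) (colMatrix_smul x)

lemma homMatrix_colHomFun (x : Fin 5 → ℤ) : homMatrix (colHomFun x) = colMatrix x := by
  ext a b
  exact repr_homOfMatrix (colMatrix x) (colMatrix_smul x) a b

lemma homMatrix_injective {H₁ H₂ : Subgroup T1654}
    {φ ψ : PermModule ℤ H₁ →ₗ[MonoidAlgebra ℤ T1654] PermModule ℤ H₂}
    (h : homMatrix φ = homMatrix ψ) : φ = ψ :=
  permHom_ext fun a b => congrFun (congrFun h a) b

lemma homMatrix_add {H₁ H₂ : Subgroup T1654}
    (φ ψ : PermModule ℤ H₁ →ₗ[MonoidAlgebra ℤ T1654] PermModule ℤ H₂) :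
    homMatrix (φ + ψ) = homMatrix φ + homMatrix ψ := by
  ext a b
  exact congrArg (fun f => f b) (map_add (permBasis ℤ H₂).repr _ _)

/-- The homomorphisms of the integral permutation modules correspond to the coefficient vectors. -/
noncomputable def colHom :
    (Fin 5 → ℤ) ≃+ (PermModule ℤ (a5Sub 0) →ₗ[MonoidAlgebra ℤ T1654] PermModule ℤ (a5Sub 1)) :=
  AddEquiv.ofBijective (AddMonoidHom.mk' colHomFun fun x y => homMatrix_injective (by
    rw [homMatrix_add, homMatrix_colHomFun, homMatrix_colHomFun, homMatrix_colHomFun]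
    rfl)) <| by
  constructor
  · intro x y h
    have h1 := (homMatrix_colHomFun x).symm.trans ((congrArg homMatrix h).trans
      (homMatrix_colHomFun y))
    ext k
    obtain ⟨b, rfl⟩ := exists_col_eq k
    exact congrFun (congrFun h1 ((1 : T1654) : T1654 ⧸ a5Sub 0)) b
  · intro φ
    choose q hq using exists_col_eq
    refine ⟨fun k => homMatrix φ ((1 : T1654) : T1654 ⧸ a5Sub 0) (q k), homMatrix_injective ?_⟩
    refine (homMatrix_colHomFun _).trans ?_
    ext a b
    obtain ⟨g, h1, h2⟩ := exists_smul_of_col_eq (hq (col a b))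
    rw [colMatrix, Matrix.of_apply, homMatrix_apply, homMatrix_apply, ← repr_smul_smul φ g, h1, h2]

lemma homMatrix_colHom (x : Fin 5 → ℤ) : homMatrix (colHom x) = colMatrix x :=
  homMatrix_colHomFun x

lemma not_integrallyEquivalent_a5Sub : ¬ IntegrallyEquivalent (a5Sub 0) (a5Sub 1) := by
  rintro ⟨φ⟩
  obtain ⟨e₁, e₂, hdet⟩ := det_colMatrix
  have hu : IsUnit ((homMatrix φ.toLinearMap).submatrix e₁ e₂).det := isUnit_det_of_equiv e₁ e₂ φ
  obtain ⟨x, hx⟩ := colHom.surjective φ.toLinearMap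
  rw [← hx, homMatrix_colHom, hdet, IsUnit.neg_iff] at hu
  refine not_forall_linForm_eq ⟨x, fun k => Int.isUnit_iff.mp ?_⟩
  simp only [IsUnit.mul_iff] at hu
  obtain ⟨⟨⟨⟨h0, h1⟩, h2⟩, h3⟩, h4⟩ := hu
  fin_cases k
  · exact h0
  · exact (isUnit_pow_iff (by norm_num)).mp h1
  · exact (isUnit_pow_iff (by norm_num)).mp h2
  · exact (isUnit_pow_iff (by norm_num)).mp h3
  · exact (isUnit_pow_iff (by norm_num)).mp h4

/-- Two homomorphisms whose determinants have no common prime factor. -/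
lemma locallyIntegrallyEquivalent_a5Sub : LocallyIntegrallyEquivalent (a5Sub 0) (a5Sub 1) := by
  intro p hp
  obtain ⟨e₁, e₂, hdet⟩ := det_colMatrix
  have key : ∀ x : Fin 5 → ℤ, (∀ k, ¬ (p : ℤ) ∣ linForm x k) →
      EquivalentOver ℤ_[p] (a5Sub 0) (a5Sub 1) := by
    intro x hx
    have hp' : Prime (p : ℤ) := Nat.prime_iff_prime_int.mp hp.out
    refine equivalentOver_of_isUnit_det e₁ e₂ ((colMatrix x).map (Int.castRingHom ℤ_[p]))
      (fun g a b => congrArg (Int.castRingHom ℤ_[p]) (colMatrix_smul x g a b)) ?_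
    rw [Matrix.submatrix_map, ← RingHom.mapMatrix_apply, ← RingHom.map_det, hdet, eq_intCast,
      PadicInt.isUnit_iff]
    have h1 : ¬ (p : ℤ) ∣ -(linForm x 0 * linForm x 1 ^ 5 * linForm x 2 ^ 15 * linForm x 3 ^ 30 *
        linForm x 4 ^ 45) := by
      rw [dvd_neg]
      intro h
      rcases hp'.dvd_or_dvd h with h | h
      · rcases hp'.dvd_or_dvd h with h | h
        · rcases hp'.dvd_or_dvd h with h | h
          · rcases hp'.dvd_or_dvd h with h | h
            · exact hx 0 h
            · exact hx 1 (hp'.dvd_of_dvd_pow h)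
          · exact hx 2 (hp'.dvd_of_dvd_pow h)
        · exact hx 3 (hp'.dvd_of_dvd_pow h)
      · exact hx 4 (hp'.dvd_of_dvd_pow h)
    refine le_antisymm (PadicInt.norm_le_one _) (not_lt.mp fun h => h1 ?_)
    exact (PadicInt.norm_int_lt_one_iff_dvd _).mp h
  -- the forms have values dividing `325 = 5² · 13` at the second vector, and values prime to `5`
  -- and `13` at the first one
  by_cases h : p = 5 ∨ p = 13
  · refine key ![0, -1, -1, 1, 0] fun k => ?_
    rcases h with rfl | rfl <;> revert k <;> decide
  · refine key ![-2, 0, 0, 1, 0] fun k hk => ?_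
    have h2 : (p : ℤ) ∣ 325 := hk.trans ((by decide : ∀ k, linForm ![-2, 0, 0, 1, 0] k ∣ 325) k)
    have h3 : p ∣ 5 ^ 2 * 13 := by exact_mod_cast h2
    rcases (Nat.Prime.dvd_mul hp.out).mp h3 with h4 | h4
    · exact h (Or.inl ((Nat.prime_dvd_prime_iff_eq hp.out Nat.prime_five).mp
        (hp.out.dvd_of_dvd_pow h4)))
    · exact h (Or.inr ((Nat.prime_dvd_prime_iff_eq hp.out (by norm_num)).mp h4))

lemma not_isoGSets_a5Sub : ¬ IsoGSets T1654 (T1654 ⧸ a5Sub 0) (T1654 ⧸ a5Sub 1) := by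
  rintro ⟨e, he⟩
  obtain ⟨g, hg⟩ := QuotientGroup.mk_surjective (e ((1 : T1654) : T1654 ⧸ a5Sub 0))
  refine not_conj_a5Sub (i := 0) (j := 1) (by decide) ⟨g⁻¹, Subgroup.eq_of_le_of_card_ge ?_ ?_⟩
  · rintro _ ⟨x, hx, rfl⟩
    change g⁻¹ * x * g⁻¹⁻¹ ∈ _
    have h1 := he x ((1 : T1654) : T1654 ⧸ a5Sub 0)
    rw [mk_one_smul hx, ← hg, MulAction.Quotient.smul_coe, QuotientGroup.eq, smul_eq_mul,
      ← mul_assoc] at h1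
    rwa [inv_inv]
  · rw [card_a5Sub, Subgroup.card_map_of_injective (MulAut.conj g⁻¹).injective, card_a5Sub]

/-! ### Transport along an isomorphism, and realization as Galois group -/

section Transport

variable {G G' : Type*} [Group G] [Group G'] (φ : G' ≃* G)

/-- An isomorphism of groups identifies the cosets of a subgroup and of its preimage. -/
def cosetCongr (H : Subgroup G) : G' ⧸ H.comap φ.toMonoidHom ≃ G ⧸ H :=
  Quotient.congr φ.toEquiv fun a b => by
    rw [QuotientGroup.leftRel_apply, QuotientGroup.leftRel_apply, Subgroup.mem_comap]
    simp

lemma cosetCongr_smul (H : Subgroup G) (g : G') (a : G' ⧸ H.comap φ.toMonoidHom) :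
    cosetCongr φ H (g • a) = φ g • cosetCongr φ H a := by
  induction a using QuotientGroup.induction_on with
  | H x => exact congrArg (QuotientGroup.mk (s := H)) (map_mul φ g x)

lemma mark_comap (H : Subgroup G) (K : Subgroup G') :
    mark (H.comap φ.toMonoidHom) K = mark H (K.map φ.toMonoidHom) := by
  refine Nat.card_congr (Equiv.subtypeEquiv (cosetCongr φ H) fun a => ?_)
  simp only [MulAction.mem_fixedPoints, Subtype.forall, Subgroup.mem_map]
  constructor
  · rintro h _ ⟨k, hk, rfl⟩
    have := congrArg (cosetCongr φ H) (h k hk)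
    exact (cosetCongr_smul φ H k a).symm.trans this
  · intro h k hk
    exact (cosetCongr φ H).injective ((cosetCongr_smul φ H k a).trans (h (φ k) ⟨k, hk, rfl⟩))

lemma SolvablyEquivalent.comap {H₁ H₂ : Subgroup G} (h : SolvablyEquivalent H₁ H₂) :
    SolvablyEquivalent (H₁.comap φ.toMonoidHom) (H₂.comap φ.toMonoidHom) := by
  intro K hK
  rw [mark_comap, mark_comap]
  exact h _ (Group.isSolvable_of_surjective
    (f := (K.equivMapOfInjective φ.toMonoidHom φ.injective).toMonoidHom)
    (K.equivMapOfInjective φ.toMonoidHom φ.injective).surjective)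

lemma EquivalentOver.of_comap {R : Type*} [CommRing R] {H₁ H₂ : Subgroup G} {n : Type*}
    [Fintype n] [DecidableEq n] [Fintype (G ⧸ H₂)] (e₁ : n ≃ G ⧸ H₁) (e₂ : n ≃ G ⧸ H₂)
    (h : EquivalentOver R (H₁.comap φ.toMonoidHom) (H₂.comap φ.toMonoidHom)) :
    EquivalentOver R H₁ H₂ := by
  obtain ⟨ψ⟩ := h
  have : Fintype (G' ⧸ H₂.comap φ.toMonoidHom) := Fintype.ofEquiv _ (cosetCongr φ H₂).symm
  have hu := isUnit_det_of_equiv (e₁.trans (cosetCongr φ H₁).symm)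
    (e₂.trans (cosetCongr φ H₂).symm) ψ
  refine equivalentOver_of_isUnit_det e₁ e₂ (Matrix.of fun a b =>
    (permBasis R _).repr (ψ (permBasis R _ ((cosetCongr φ H₁).symm a)))
      ((cosetCongr φ H₂).symm b)) (fun g a b => ?_) hu
  have hs : ∀ (H : Subgroup G) (c : G ⧸ H),
      (cosetCongr φ H).symm (g • c) = φ.symm g • (cosetCongr φ H).symm c := fun H c => by
    rw [Equiv.symm_apply_eq, cosetCongr_smul, Equiv.apply_symm_apply, MulEquiv.apply_symm_apply]
  simp only [Matrix.of_apply, hs]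
  exact repr_smul_smul ψ.toLinearMap _ _ _

end Transport

lemma a5Sub_core_trivial : ∀ i : Fin 5, i = 0 ∨ i = 1 → ∀ c ∈ aCodes i,
    ((hexads i).all fun m => (img c m).beq m) = true → c = 0xfedcba9876543210 := by
  decide +kernel

/-- The subgroups `H₁` and `H₂` contain no nontrivial normal subgroup of `G`. -/
lemma eq_bot_of_normal_of_le_a5Sub {i : Fin 5} (hi : i = 0 ∨ i = 1) {N : Subgroup T1654}
    (hN : N.Normal) (hle : N ≤ a5Sub i) : N = ⊥ := by
  refine (Subgroup.eq_bot_iff_forall N).mpr fun g hg => ?_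
  refine eq_one_of_code (a5Sub_core_trivial i hi _ (mem_a5Sub_iff.mp (hle hg)) ?_)
  refine List.all_eq_true.mpr fun m hm => (Nat.beq_eq ..).mpr ?_
  rw [← smul_ofMask_eq_iff (hexads_lt i m hm)]
  obtain ⟨t, ht⟩ := exists_smul_of_mem_hexads hi hm
  have h1 := (mem_a5Sub_iff_smul hi).mp (hle (hN.conj_mem g hg t⁻¹))
  rw [inv_inv, mul_smul, mul_smul, inv_smul_eq_iff, ht] at h1
  exact h1

/-- A field whose Galois group over `ℚ` is `T1654` realizes the pair `H₁`, `H₂`. -/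
theorem realizesPair_of_mulEquiv (L : Type*) [Field L] [CharZero L] [NumberField L]
    [IsGalois ℚ L] (φ : (L ≃ₐ[ℚ] L) ≃* T1654) : RealizesPair (a5Sub 0) (a5Sub 1) L := by
  let Hs : Fin 5 → Subgroup (L ≃ₐ[ℚ] L) := fun i => (a5Sub i).comap φ.toMonoidHom
  let Ks : Fin 5 → IntermediateField ℚ L := fun i => IntermediateField.fixedField (Hs i)
  have hK : ∀ i, (Ks i).fixingSubgroup = Hs i := fun i =>
    IntermediateField.fixingSubgroup_fixedField (Hs i)
  have hdeg : ∀ i, Module.finrank ℚ (Ks i) = 96 := fun i => by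
    rw [IntermediateField.finrank_eq_fixingSubgroup_index, hK,
      Subgroup.index_comap_of_surjective _ φ.surjective]
    exact index_eq_96 (card_a5Sub i)
  have hnc : ∀ i, i = 0 ∨ i = 1 → IsNormalClosure ℚ (Ks i) L := fun i hi => by
    refine Algebra.IsAlgebraic.isNormalClosure_iff.mpr ⟨fun x => ?_, ?_⟩
    · have := Normal.splits (F := ℚ) inferInstance (x : L)
      rwa [← IntermediateField.minpoly_eq] at this
    · set N := IntermediateField.normalClosure ℚ (Ks i) L
      have hle : N.fixingSubgroup ≤ Hs i := by
        rw [← hK]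
        exact IntermediateField.fixingSubgroup_antitone (Ks i).le_normalClosure
      have hN : N.fixingSubgroup.Normal := inferInstance
      have hb := eq_bot_of_normal_of_le_a5Sub hi (hN.map φ.toMonoidHom φ.surjective)
        (Subgroup.map_le_iff_le_comap.mpr hle)
      rw [(Subgroup.map_eq_bot_iff_of_injective _ φ.injective)] at hb
      rw [← IsGalois.fixedField_fixingSubgroup N, hb, IntermediateField.fixedField_bot]
  refine ⟨inferInstance, inferInstance, φ, Ks 0, Ks 1, hK 0, hK 1, hdeg 0, hdeg 1,
    ⟨inferInstance, hnc 0 (Or.inl rfl), hnc 1 (Or.inr rfl), ?_⟩, ?_, ?_⟩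
  · rw [hK, hK]
    exact solvablyEquivalent_a5Sub.comap φ
  · rw [hK, hK]
    intro h
    have e : ∀ i : Fin 5, Fin 96 ≃ T1654 ⧸ a5Sub i := fun i =>
      (Finite.equivFinOfCardEq (card_quotient_a5Sub i)).symm
    exact not_integrallyEquivalent_a5Sub (EquivalentOver.of_comap φ (e 0) (e 1) h)
  · rintro ⟨χ⟩
    refine not_conj_a5Sub (i := 0) (j := 1) (by decide) ?_
    set τ := χ.liftNormal L
    have hτ : ∀ x : Ks 0, τ x = χ x := fun x => χ.liftNormal_commutes L x
    have hsymm : ∀ x : Ks 1, τ⁻¹ (x : L) = χ.symm x := fun x => by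
      rw [AlgEquiv.aut_inv, AlgEquiv.symm_apply_eq, hτ, AlgEquiv.apply_symm_apply]
    have hmem : ∀ i (σ : L ≃ₐ[ℚ] L), φ σ ∈ a5Sub i ↔ ∀ x : Ks i, σ x = x := fun i σ => by
      have : φ σ ∈ a5Sub i ↔ σ ∈ (Ks i).fixingSubgroup := by rw [hK]; rfl
      rw [this]
      exact ⟨fun h x => h x, fun h x => h x⟩
    refine ⟨φ τ, ?_⟩
    ext g
    obtain ⟨σ, rfl⟩ := φ.surjective g
    rw [Subgroup.mem_map, hmem]
    constructor
    · rintro ⟨s, hs, e⟩ x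
      obtain ⟨ρ, rfl⟩ := φ.surjective s
      have e2 : σ = τ * ρ * τ⁻¹ := φ.injective (by
        rw [← e, map_mul, map_mul, map_inv]; rfl)
      rw [e2, AlgEquiv.mul_apply, AlgEquiv.mul_apply, hsymm, (hmem 0 ρ).mp hs, hτ,
        AlgEquiv.apply_symm_apply]
    · intro h
      refine ⟨φ (τ⁻¹ * σ * τ), (hmem 0 _).mpr fun x => ?_, ?_⟩
      · rw [AlgEquiv.mul_apply, AlgEquiv.mul_apply, hτ, h, hsymm, AlgEquiv.symm_apply_apply]
      · change φ τ * φ (τ⁻¹ * σ * τ) * (φ τ)⁻¹ = φ σ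
        rw [← map_inv, ← map_mul, ← map_mul]
        congr 1
        group

/-! ### Galois actions on six numbers and on their square roots -/

/-- The sign `(-1)^a`. -/
def sgn (a : ZMod 2) : ℤ := if a = 0 then 1 else -1

lemma sgn_add : ∀ a b, sgn (a + b) = sgn a * sgn b := by decide

lemma sgn_eq_one_iff : ∀ a, sgn a = 1 ↔ a = 0 := by decide

lemma sgn_injective : Function.Injective sgn := by unfold Function.Injective; decide

lemma sgn_sum {ι : Type*} (s : Finset ι) (e : ι → ZMod 2) :
    sgn (∑ i ∈ s, e i) = ∏ i ∈ s, sgn (e i) := by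
  classical
  induction s using Finset.induction_on with
  | empty => rfl
  | insert a s ha ih => rw [Finset.sum_insert ha, Finset.prod_insert ha, sgn_add, ih]

lemma coordAct_ptClass (σ : Equiv.Perm (Fin 6)) (u : Fin 6 → ZMod 2) (hu : ∑ i, u i = 0) :
    coordAct σ (ptClass u) = ptClass (fun i => u (σ⁻¹ i)) := by
  simp only [coordAct, evenRep_ptClass u hu]
  ext i
  fin_cases i <;> simp [ptClass]

lemma ptClass_add (u v : Fin 6 → ZMod 2) : ptClass (u + v) = ptClass u + ptClass v := by
  ext i
  fin_cases i <;> simp [ptClass] <;> ring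

lemma ptClass_eq_zero_iff (u : Fin 6 → ZMod 2) (hu : ∑ i, u i = 0) :
    ptClass u = 0 ↔ ∀ i j, u i = u j := by
  revert u; decide +kernel

lemma affineElt_inj {σ τ : Equiv.Perm (Fin 6)} {hσ : σ ∈ alternatingGroup (Fin 6)}
    {hτ : τ ∈ alternatingGroup (Fin 6)} {b c : Pt} :
    affineElt σ hσ b = affineElt τ hτ c ↔ σ = τ ∧ b = c := by
  refine ⟨fun h => ?_, ?_⟩
  · have h1 : ∀ w, coordAct σ w + b = coordAct τ w + c := fun w => by
      rw [← affineElt_smul σ hσ, h, affineElt_smul]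
    have h0 := h1 0
    rw [coordAct_zero, coordAct_zero, zero_add, zero_add] at h0
    subst h0
    exact ⟨coordAct_injective (funext fun w => add_right_cancel (h1 w)), rfl⟩
  · rintro ⟨rfl, rfl⟩
    rfl

lemma affineElt_mul {σ τ : Equiv.Perm (Fin 6)} (hσ : σ ∈ alternatingGroup (Fin 6))
    (hτ : τ ∈ alternatingGroup (Fin 6)) (b c : Pt) :
    affineElt σ hσ b * affineElt τ hτ c =
      affineElt (σ * τ) (mul_mem hσ hτ) (coordAct σ c + b) := by
  refine Subtype.ext (Equiv.ext fun w => ?_)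
  change affineElt σ hσ b • affineElt τ hτ c • w = affineElt (σ * τ) _ (coordAct σ c + b) • w
  rw [affineElt_smul, affineElt_smul, affineElt_smul, coordAct_add, coordAct_mul, add_assoc]

lemma affineElt_one : affineElt 1 (one_mem _) 0 = 1 := by
  refine Subtype.ext (Equiv.ext fun w => ?_)
  change affineElt 1 _ 0 • w = w
  rw [affineElt_smul, coordAct_one, add_zero]

instance isPretransitive_T1654 : MulAction.IsPretransitive T1654 Pt :=
  ⟨fun v w => ⟨affineElt 1 (one_mem _) (w - v), by rw [affineElt_smul, coordAct_one]; abel⟩⟩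

/-- A five-cycle. -/
def fiveCycle : Equiv.Perm (Fin 6) :=
  Equiv.swap 0 1 * Equiv.swap 1 2 * Equiv.swap 2 3 * Equiv.swap 3 4

/-- A three-cycle that moves the fixed point of the five-cycle. -/
def threeCycle : Equiv.Perm (Fin 6) := Equiv.swap 0 1 * Equiv.swap 1 5

lemma fiveCycle_mem : fiveCycle ∈ alternatingGroup (Fin 6) :=
  Equiv.Perm.mem_alternatingGroup.mpr (by decide +kernel)

lemma threeCycle_mem : threeCycle ∈ alternatingGroup (Fin 6) :=
  Equiv.Perm.mem_alternatingGroup.mpr (by decide +kernel)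

lemma exists_word_coordAct : ∀ v w : Pt, v ≠ 0 → w ≠ 0 → ∃ a b c : Fin 5,
    w = coordAct (fiveCycle ^ (a : ℕ) * threeCycle ^ (b : ℕ) * fiveCycle ^ (c : ℕ)) v := by
  decide +kernel

/-- The alternating group acts transitively on the nonzero vectors. -/
lemma exists_coordAct_eq {v w : Pt} (hv : v ≠ 0) (hw : w ≠ 0) :
    ∃ ρ ∈ alternatingGroup (Fin 6), w = coordAct ρ v := by
  obtain ⟨a, b, c, h⟩ := exists_word_coordAct v w hv hw
  exact ⟨_, mul_mem (mul_mem (pow_mem fiveCycle_mem _) (pow_mem threeCycle_mem _))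
    (pow_mem fiveCycle_mem _), h⟩

/-- A subgroup of `T1654` that maps onto `A₆` and contains a nontrivial translation is everything,
because `A₆` permutes the nonzero vectors transitively. -/
lemma eq_top_of_translation_mem (N : Subgroup T1654)
    (hπ : ∀ ρ, ∀ hρ : ρ ∈ alternatingGroup (Fin 6), ∃ b, affineElt ρ hρ b ∈ N)
    {v : Pt} (hv : v ≠ 0) (hvN : affineElt 1 (one_mem _) v ∈ N) : N = ⊤ := by
  have htr : ∀ w, affineElt 1 (one_mem _) w ∈ N := fun w => by
    by_cases hw : w = 0
    · rw [hw, affineElt_one]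
      exact one_mem _
    · obtain ⟨ρ, hρ, rfl⟩ := exists_coordAct_eq hv hw
      obtain ⟨b, hb⟩ := hπ ρ hρ
      have h1 : affineElt 1 (one_mem _) (coordAct ρ v) * affineElt ρ hρ b =
          affineElt ρ hρ b * affineElt 1 (one_mem _) v := by
        rw [affineElt_mul, affineElt_mul, affineElt_inj]
        exact ⟨by rw [one_mul, mul_one], by rw [coordAct_one, add_comm]⟩
      rw [eq_mul_inv_of_mul_eq h1]
      exact mul_mem (mul_mem hb hvN) (inv_mem hb)
  refine (Subgroup.eq_top_iff' N).mpr fun g => ?_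
  obtain ⟨ρ, hρ, b', rfl⟩ := exists_affineElt g
  obtain ⟨b, hb⟩ := hπ ρ hρ
  have := mul_mem (htr (b' - b)) hb
  rw [affineElt_mul, coordAct_one, add_sub_cancel] at this
  convert this using 2
  exact (one_mul ρ).symm

/-- Six distinct algebraic numbers `θ i` and nonzero numbers `s i` such that every automorphism
permutes the `θ i` evenly, permutes the `s i` up to sign in the same way, and fixes the product
of the `s i`. -/
structure IsSqrtTower {Ω : Type*} [Field Ω] [CharZero Ω] (θ s : Fin 6 → Ω) : Prop where
  inj : Function.Injective θ
  ne_zero : ∀ i, s i ≠ 0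
  exists_perm : ∀ σ : Ω ≃ₐ[ℚ] Ω,
    ∃ π ∈ alternatingGroup (Fin 6), ∀ i, σ (θ i) = θ (π i) ∧
      (σ (s i) = s (π i) ∨ σ (s i) = -s (π i))
  prod : ∀ σ : Ω ≃ₐ[ℚ] Ω, σ (∏ i, s i) = ∏ i, s i

namespace IsSqrtTower

variable {Ω : Type*} [Field Ω] [CharZero Ω] {θ s : Fin 6 → Ω} (h : IsSqrtTower θ s)
  (σ τ : Ω ≃ₐ[ℚ] Ω)

include h

lemma exists_sgn : ∃ π ∈ alternatingGroup (Fin 6), ∃ e : Fin 6 → ZMod 2, ∑ i, e i = 0 ∧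
    ∀ i, σ (θ i) = θ (π i) ∧ σ (s i) = sgn (e (π i)) * s (π i) := by
  obtain ⟨π, hπ, hσ⟩ := h.exists_perm σ
  have h1 : ∀ j, ∃ a : ZMod 2, σ (s (π⁻¹ j)) = sgn a * s j := fun j => by
    have := (hσ (π⁻¹ j)).2
    have hj : π (π⁻¹ j) = j := π.apply_symm_apply j
    rw [hj] at this
    rcases this with e | e
    · exact ⟨0, by rw [e]; simp [sgn]⟩
    · exact ⟨1, by rw [e]; simp [sgn]⟩
  choose e he using h1
  refine ⟨π, hπ, e, ?_, fun i => ⟨(hσ i).1, by simpa using he (π i)⟩⟩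
  have h2 := h.prod σ
  rw [map_prod, ← Equiv.prod_comp (π⁻¹)] at h2
  simp only [he] at h2
  rw [Finset.prod_mul_distrib] at h2
  have h3 : (∏ i, s i) ≠ 0 := Finset.prod_ne_zero_iff.mpr fun i _ => h.ne_zero i
  have h4 := mul_right_cancel₀ h3 (h2.trans (one_mul _).symm)
  rw [← sgn_eq_one_iff, sgn_sum]
  exact_mod_cast h4

/-- The permutation of the six numbers `θ i` by an automorphism. -/
noncomputable def perm : Equiv.Perm (Fin 6) := (h.exists_sgn σ).choose

lemma perm_mem : h.perm σ ∈ alternatingGroup (Fin 6) := (h.exists_sgn σ).choose_spec.1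

/-- The signs with which an automorphism permutes the numbers `s i`. -/
noncomputable def sign : Fin 6 → ZMod 2 := (h.exists_sgn σ).choose_spec.2.choose

lemma sign_sum : ∑ i, h.sign σ i = 0 := (h.exists_sgn σ).choose_spec.2.choose_spec.1

lemma apply_θ (i : Fin 6) : σ (θ i) = θ (h.perm σ i) :=
  ((h.exists_sgn σ).choose_spec.2.choose_spec.2 i).1

lemma apply_s (i : Fin 6) : σ (s i) = sgn (h.sign σ (h.perm σ i)) * s (h.perm σ i) :=
  ((h.exists_sgn σ).choose_spec.2.choose_spec.2 i).2

lemma perm_eq {π : Equiv.Perm (Fin 6)} (hπ : ∀ i, σ (θ i) = θ (π i)) : h.perm σ = π :=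
  Equiv.ext fun i => h.inj ((h.apply_θ σ i).symm.trans (hπ i))

lemma perm_mul : h.perm (σ * τ) = h.perm σ * h.perm τ :=
  h.perm_eq _ fun i => by
    rw [AlgEquiv.mul_apply, h.apply_θ, h.apply_θ, Equiv.Perm.mul_apply]

lemma sign_mul (i : Fin 6) :
    h.sign (σ * τ) i = h.sign σ i + h.sign τ ((h.perm σ)⁻¹ i) := by
  obtain ⟨j, rfl⟩ := (h.perm (σ * τ)).surjective i
  have h1 := h.apply_s (σ * τ) j
  rw [AlgEquiv.mul_apply, h.apply_s τ, map_mul, map_intCast, h.apply_s σ, ← mul_assoc,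
    h.perm_mul, Equiv.Perm.mul_apply] at h1
  have h2 := mul_right_cancel₀ (h.ne_zero _) h1
  have h3 : (h.perm σ)⁻¹ (h.perm σ (h.perm τ j)) = h.perm τ j := (h.perm σ).symm_apply_apply _
  rw [h.perm_mul, Equiv.Perm.mul_apply, h3]
  refine sgn_injective ?_
  rw [sgn_add, mul_comm]
  exact_mod_cast h2.symm

/-- The action of the absolute Galois group on the numbers `θ i` and `s i`, as a homomorphism
to `T1654`. -/
noncomputable def hom : (Ω ≃ₐ[ℚ] Ω) →* T1654 :=
  MonoidHom.mk' (fun σ => affineElt (h.perm σ) (h.perm_mem σ) (ptClass (h.sign σ))) fun σ τ => by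
    rw [affineElt_mul, affineElt_inj]
    refine ⟨h.perm_mul σ τ, ?_⟩
    rw [coordAct_ptClass _ _ (h.sign_sum τ), add_comm, ← ptClass_add]
    exact congrArg ptClass (funext fun i => h.sign_mul σ τ i)

lemma hom_apply : h.hom σ = affineElt (h.perm σ) (h.perm_mem σ) (ptClass (h.sign σ)) := rfl

lemma apply_s_mul_s (i j : Fin 6) : σ (s i * s j) =
    sgn (h.sign σ (h.perm σ i) + h.sign σ (h.perm σ j)) *
      (s (h.perm σ i) * s (h.perm σ j)) := by
  rw [map_mul, h.apply_s, h.apply_s, sgn_add, Int.cast_mul]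
  ring

lemma hom_eq_one_iff : h.hom σ = 1 ↔
    (∀ i, σ (θ i) = θ i) ∧ ∀ i j, σ (s i * s j) = s i * s j := by
  rw [hom_apply, ← affineElt_one, affineElt_inj, ptClass_eq_zero_iff _ (h.sign_sum σ)]
  have h1 : ∀ i j, s i * s j ≠ 0 := fun i j => mul_ne_zero (h.ne_zero i) (h.ne_zero j)
  have h2 : ∀ a b : ZMod 2, sgn (a + b) = 1 ↔ a = b := by decide
  constructor
  · rintro ⟨hp, hs⟩
    refine ⟨fun i => by rw [h.apply_θ, hp]; rfl, fun i j => ?_⟩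
    rw [h.apply_s_mul_s, (h2 _ _).mpr (hs _ _), hp]
    simp
  · rintro ⟨hp, hs⟩
    have hp' : h.perm σ = 1 := h.perm_eq σ hp
    refine ⟨hp', fun i j => (h2 _ _).mp ?_⟩
    have h3 := hs i j
    rw [h.apply_s_mul_s, hp'] at h3
    have h4 := mul_right_cancel₀ (h1 i j) (h3.trans (one_mul _).symm)
    exact_mod_cast h4

lemma hom_surjective (hπ : ∀ ρ ∈ alternatingGroup (Fin 6), ∃ σ, h.perm σ = ρ)
    {σ : Ω ≃ₐ[ℚ] Ω} (hσ : ∀ i, σ (θ i) = θ i) {i j : Fin 6}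
    (hij : σ (s i * s j) ≠ s i * s j) : Function.Surjective h.hom := by
  rw [← MonoidHom.range_eq_top]
  have hp : h.perm σ = 1 := h.perm_eq σ hσ
  refine eq_top_of_translation_mem _ (fun ρ hρ => ?_) (v := ptClass (h.sign σ)) (fun h0 => ?_)
    ⟨σ, ?_⟩
  · obtain ⟨σ, rfl⟩ := hπ ρ hρ
    exact ⟨_, σ, rfl⟩
  · refine hij (((h.hom_eq_one_iff σ).mp ?_).2 i j)
    rw [hom_apply, ← affineElt_one, affineElt_inj]
    exact ⟨hp, h0⟩
  · rw [hom_apply, affineElt_inj]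
    exact ⟨hp, rfl⟩

/-- If the action on the `θ i` and `s i` gives all of `T1654`, then an extension of `ℚ` that
is fixed by exactly the automorphisms with trivial action has Galois group `T1654`. -/
theorem exists_mulEquiv [IsGalois ℚ Ω] (hs : Function.Surjective h.hom)
    (L : Type*) [Field L] [CharZero L] [Algebra L Ω]
    (hL : ∀ σ : Ω ≃ₐ[ℚ] Ω, (∀ x : L, σ (algebraMap L Ω x) = algebraMap L Ω x) ↔ h.hom σ = 1) :
    IsGalois ℚ L ∧ Nonempty ((L ≃ₐ[ℚ] L) ≃* T1654) := by
  let f := IsScalarTower.toAlgHom ℚ L Ω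
  let N := f.fieldRange
  have hmem : ∀ σ, σ ∈ N.fixingSubgroup ↔ h.hom σ = 1 := fun σ => by
    rw [← hL]
    constructor
    · exact fun hσ x => hσ ⟨f x, x, rfl⟩
    · rintro hσ ⟨_, x, rfl⟩
      exact hσ x
  have hker : N.fixingSubgroup = h.hom.ker := Subgroup.ext fun σ => (hmem σ).trans (by rfl)
  have hN : N.fixingSubgroup.Normal := by rw [hker]; infer_instance
  have hnormal : @Normal ℚ N _ _ N.algebra' := by
    rw [IntermediateField.normal_iff_forall_map_le']
    rintro σ _ ⟨x, hx, rfl⟩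
    rw [← InfiniteGalois.fixedField_fixingSubgroup N]
    rintro ⟨τ, hτ⟩
    have h1 := hN.conj_mem τ hτ σ⁻¹ ⟨x, hx⟩
    change σ⁻¹ (τ (σ⁻¹⁻¹ x)) = x at h1
    rw [inv_inv, AlgEquiv.aut_inv, AlgEquiv.symm_apply_eq] at h1
    exact h1
  have : Normal ℚ L := Normal.of_algEquiv (h := hnormal) (AlgEquiv.ofInjectiveField f).symm
  have hr := AlgEquiv.restrictNormalHom_surjective (F := ℚ) (K₁ := L) Ω
  have hk : (AlgEquiv.restrictNormalHom (F := ℚ) (K₁ := Ω) L).ker = h.hom.ker := by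
    ext σ
    rw [MonoidHom.mem_ker, MonoidHom.mem_ker, ← hL, AlgEquiv.ext_iff]
    refine forall_congr' fun x => ?_
    rw [← AlgEquiv.restrictNormal_commutes σ L x]
    exact ((algebraMap L Ω).injective.eq_iff).symm
  exact ⟨⟨⟩, ⟨(QuotientGroup.quotientKerEquivOfSurjective _ hr).symm.trans
    ((QuotientGroup.quotientMulEquivOfEq hk).trans
      (QuotientGroup.quotientKerEquivOfSurjective _ hs))⟩⟩

end IsSqrtTower

/-! ### Frobenius elements of the absolute Galois group -/

/-- At every prime `q` there are a reduction map from the algebraic integers to a field of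
characteristic `q` and an automorphism that induces the `q`-th power map. -/
theorem exists_frobenius (Ω : Type) [Field Ω] [CharZero Ω] [IsGalois ℚ Ω] (q : ℕ)
    [hq : Fact q.Prime] :
    ∃ (k : Type) (_ : Field k) (_ : CharP k q) (r : integralClosure ℤ Ω →+* k) (σ : Ω ≃ₐ[ℚ] Ω),
      ∀ x y : integralClosure ℤ Ω, (y : Ω) = σ x → r y = r x ^ q := by
  let B := integralClosure ℤ Ω
  have : Algebra.IsAlgebraic ℤ Ω :=
    (IsFractionRing.comap_isAlgebraic_iff (A := ℤ) (K := ℚ) (C := Ω)).mpr inferInstance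
  have hfr : IsFractionRing B Ω := integralClosure.isFractionRing_of_algebraic
    (A := ℤ) (L := Ω) fun x hx => by simpa using hx
  let _ : MulSemiringAction (Ω ≃ₐ[ℚ] Ω) B := IsIntegralClosure.MulSemiringAction ℤ ℚ Ω B
  have hsmul : ∀ (σ : Ω ≃ₐ[ℚ] Ω) (x : B), ((σ • x : B) : Ω) = σ x := fun σ x =>
    algebraMap_galRestrict_apply ℤ σ x
  let _ : TopologicalSpace B := ⊥
  have : DiscreteTopology B := ⟨rfl⟩
  have : ContinuousSMul (Ω ≃ₐ[ℚ] Ω) B := by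
    refine (continuousSMul_iff_stabilizer_isOpen (M := Ω ≃ₐ[ℚ] Ω) (X := B)).mpr fun x => ?_
    have := stabilizer_isOpen_of_isIntegral (K := ℚ) (x : Ω)
    convert this using 1
    ext σ
    simp only [SetLike.mem_coe, MulAction.mem_stabilizer_iff, Subtype.ext_iff, hsmul]
    rfl
  have : Algebra.IsInvariant ℤ B (Ω ≃ₐ[ℚ] Ω) := by
    refine ⟨fun b hb => ?_⟩
    have h1 : (b : Ω) ∈ (⊥ : IntermediateField ℚ Ω) := by
      rw [InfiniteGalois.mem_bot_iff_fixed]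
      intro σ
      rw [← hsmul, hb]
    obtain ⟨x, hx⟩ := IntermediateField.mem_bot.mp h1
    have h2 : IsIntegral ℤ x := by
      rw [← isIntegral_algebraMap_iff (algebraMap ℚ Ω).injective, hx]
      exact b.2
    obtain ⟨n, rfl⟩ := IsIntegrallyClosed.algebraMap_eq_of_integral h2
    exact ⟨n, Subtype.ext (by rw [← hx]; simp)⟩
  let P : Ideal ℤ := Ideal.span {(q : ℤ)}
  have hP : P.IsMaximal := PrincipalIdealRing.isMaximal_of_irreducible
    (Nat.prime_iff_prime_int.mp hq.out).irreducible
  obtain ⟨Q, hQ, hQP⟩ := Ideal.exists_ideal_over_maximal_of_isIntegral (S := B) P (by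
    rw [(RingHom.injective_iff_ker_eq_bot _).mp (algebraMap ℤ B).injective_int]
    exact bot_le)
  have : Q.LiesOver P := ⟨hQP.symm⟩
  let _ : Field (ℤ ⧸ P) := Ideal.Quotient.field P
  let _ : Field (B ⧸ Q) := Ideal.Quotient.field Q
  have hcard : Nat.card (ℤ ⧸ P) = q := by
    rw [Nat.card_congr (Int.quotientSpanNatEquivZMod q).toEquiv, Nat.card_zmod]
  have : Finite (ℤ ⧸ P) := Nat.finite_of_card_ne_zero (by rw [hcard]; exact hq.out.ne_zero)
  let _ : Fintype (ℤ ⧸ P) := Fintype.ofFinite _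
  have : Algebra.IsIntegral (ℤ ⧸ P) (B ⧸ Q) := inferInstance
  have : Algebra.IsAlgebraic (ℤ ⧸ P) (B ⧸ Q) := inferInstance
  obtain ⟨σ, hσ⟩ := Ideal.Quotient.stabilizerHom_surjective_of_profinite (G := Ω ≃ₐ[ℚ] Ω) P Q
    (FiniteField.frobeniusAlgEquivOfAlgebraic (ℤ ⧸ P) (B ⧸ Q))
  refine ⟨B ⧸ Q, inferInstance, ?_, Ideal.Quotient.mk Q, σ, fun x y hxy => ?_⟩
  · have h0 : ((q : ℕ) : B ⧸ Q) = 0 := by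
      have : (q : ℤ) ∈ Q.under ℤ := by
        rw [← Ideal.over_def Q P]
        exact Ideal.mem_span_singleton_self _
      have := Ideal.Quotient.eq_zero_iff_mem.mpr (Ideal.mem_comap.mp this)
      simpa using this
    exact (CharP.charP_iff_prime_eq_zero hq.out).mpr h0
  · have h1 : y = (σ : Ω ≃ₐ[ℚ] Ω) • x := Subtype.ext (by rw [hsmul, hxy])
    have h2 := DFunLike.congr_fun hσ (Ideal.Quotient.mk Q x)
    rw [FiniteField.coe_frobeniusAlgEquivOfAlgebraic, ← Nat.card_eq_fintype_card, hcard] at h2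
    rw [h1]
    exact h2

/-! ### Identification of integers by p-adic approximation -/

/-- An algebraic integer that is fixed by all automorphisms is a rational integer. -/
lemma exists_int_of_fixed {Ω : Type*} [Field Ω] [CharZero Ω] [IsGalois ℚ Ω] {x : Ω}
    (hx : IsIntegral ℤ x) (hfix : ∀ σ : Ω ≃ₐ[ℚ] Ω, σ x = x) : ∃ m : ℤ, x = m := by
  obtain ⟨y, rfl⟩ := IntermediateField.mem_bot.mp ((InfiniteGalois.mem_bot_iff_fixed x).mpr hfix)
  rw [isIntegral_algebraMap_iff (algebraMap ℚ Ω).injective] at hx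
  obtain ⟨n, rfl⟩ := IsIntegrallyClosed.algebraMap_eq_of_integral hx
  exact ⟨n, by simp⟩

/-- A fixed algebraic integer of small absolute value that is `p`-adically small vanishes. -/
lemma eq_zero_of_fixed {Ω : Type*} [Field Ω] [CharZero Ω] [IsGalois ℚ Ω] {p : ℕ}
    [Fact p.Prime] (n : ℕ) {K : Type*} [Field K] (κ : ℤ_[p] →+* K) (hκ : Function.Injective κ)
    (j : Ω →+* K) (ι : Ω →+* ℂ) {x : Ω} (hx : IsIntegral ℤ x)
    (hfix : ∀ σ : Ω ≃ₐ[ℚ] Ω, σ x = x) (hB : ‖ι x‖ < (p : ℝ) ^ n) {y : ℤ_[p]} (hy : j x = κ y)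
    (hy0 : PadicInt.toZModPow n y = 0) : x = 0 := by
  obtain ⟨m, rfl⟩ := exists_int_of_fixed hx hfix
  have h1 : y = m := hκ (by rw [← hy, map_intCast, map_intCast])
  rw [h1, map_intCast, ZMod.intCast_zmod_eq_zero_iff_dvd] at hy0
  rw [map_intCast, Complex.norm_intCast] at hB
  have h2 : m = 0 := Int.eq_zero_of_abs_lt_dvd hy0 (by
    push_cast
    exact_mod_cast hB)
  rw [h2, Int.cast_zero]

/-- Hensel's lemma with control of the approximation: an approximate simple root modulo `pⁿ`
is congruent modulo `pⁿ` to a root. -/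
lemma exists_root_of_approx {p : ℕ} [Fact p.Prime] {n : ℕ} (hn : n ≠ 0) (F : ℤ_[p][X]) {a : ℤ_[p]}
    (ha : PadicInt.toZModPow n (F.eval a) = 0) (hd : IsUnit (F.derivative.eval a)) :
    ∃ z, F.eval z = 0 ∧ PadicInt.toZModPow n z = PadicInt.toZModPow n a := by
  have hmem : ∀ y : ℤ_[p], PadicInt.toZModPow n y = 0 ↔ ‖y‖ ≤ (p : ℝ) ^ (-n : ℤ) := fun y => by
    rw [PadicInt.norm_le_pow_iff_mem_span_pow, ← PadicInt.ker_toZModPow, RingHom.mem_ker]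
  have hd1 := PadicInt.isUnit_iff.mp hd
  have hlt : ‖F.eval a‖ < 1 := by
    refine ((hmem _).mp ha).trans_lt ?_
    have h1 : (1 : ℝ) < p := by exact_mod_cast (Fact.out : p.Prime).one_lt
    exact zpow_lt_one_of_neg₀ h1 (by omega)
  obtain ⟨z, hz, hza, hzd, -⟩ := hensels_lemma (F := F) (a := a) (by
    simpa [Polynomial.aeval_def, Polynomial.eval₂_id, hd1] using hlt)
  simp only [Polynomial.coe_aeval_eq_eval, hd1] at hz hza hzd
  refine ⟨z, hz, sub_eq_zero.mp ?_⟩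
  obtain ⟨k, hk⟩ := Polynomial.binomExpansion F z (a - z)
  rw [add_sub_cancel, hz, zero_add] at hk
  have h2 : F.eval a = (F.derivative.eval z + k * (a - z)) * (a - z) := by rw [hk]; ring
  have h3 : ‖k * (a - z)‖ < 1 := by
    rw [norm_mul, norm_sub_rev]
    exact (mul_le_of_le_one_left (norm_nonneg _) (PadicInt.norm_le_one k)).trans_lt hza
  have h4 : ‖F.derivative.eval z + k * (a - z)‖ = 1 := by
    rw [PadicInt.norm_add_eq_max_of_ne (by rw [hzd]; exact h3.ne'), hzd]
    exact max_eq_left h3.le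
  rw [← map_sub, hmem, norm_sub_rev]
  have h5 := congrArg norm h2
  rw [norm_mul, h4, one_mul] at h5
  rw [← h5]
  exact (hmem _).mp ha

/-- A root in a larger field of a polynomial over an algebraically closed field comes from that
field. -/
lemma exists_preimage_of_root {Ω K : Type*} [Field Ω] [IsAlgClosed Ω] [Field K] (j : Ω →+* K)
    {F : Polynomial Ω} (hF : F ≠ 0) {y : K} (hy : (F.map j).eval y = 0) :
    ∃ x, F.eval x = 0 ∧ j x = y := by
  have hs := (IsAlgClosed.splits F)
  have h1 := hs.eq_prod_roots
  have hy2 := hy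
  rw [h1, Polynomial.map_mul, Polynomial.map_C, Polynomial.eval_mul, Polynomial.eval_C,
    mul_eq_zero, Polynomial.map_multiset_prod, Polynomial.eval_multiset_prod,
    Multiset.prod_eq_zero_iff, Multiset.map_map, Multiset.map_map] at hy2
  rcases hy2 with h | h
  · exact absurd (j.injective (h.trans (map_zero j).symm)) (Polynomial.leadingCoeff_ne_zero.mpr hF)
  · obtain ⟨x, hx, e⟩ := Multiset.mem_map.mp h
    refine ⟨x, (Polynomial.mem_roots'.mp hx).2, ?_⟩
    simp at e
    exact (sub_eq_zero.mp e).symm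

/-! ### The sextic field -/

/-- The sextic polynomial, as a function. -/
def sextic {R : Type*} [CommRing R] (x : R) : R :=
  x ^ 6 - x ^ 5 + x ^ 4 + 4 * x ^ 3 - 6 * x ^ 2 + 2 * x + 2

/-- A unit in the field of a root of the sextic. -/
def sexticUnit {R : Type*} [CommRing R] (x : R) : R :=
  x ^ 5 + 2 * x ^ 3 + 3 * x ^ 2 + 2 * x - 1

section Map

variable {R S : Type*} [CommRing R] [CommRing S] (φ : R →+* S)

lemma map_sextic (x : R) : φ (sextic x) = sextic (φ x) := by simp [sextic, map_ofNat]

lemma map_sexticUnit (x : R) : φ (sexticUnit x) = sexticUnit (φ x) := by simp [sexticUnit, map_ofNat]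

lemma sextic_intCast (m : ℤ) : sextic (m : R) = (sextic m : ℤ) := by
  simp [sextic]

lemma sexticUnit_intCast (m : ℤ) : sexticUnit (m : R) = (sexticUnit m : ℤ) := by
  simp [sexticUnit]

lemma map_det_vandermonde (v : Fin 6 → R) :
    φ (Matrix.vandermonde v).det = (Matrix.vandermonde (φ ∘ v)).det := by
  rw [RingHom.map_det]
  congr 1
  ext i j
  simp [Matrix.vandermonde_apply]

lemma eval_sextic (x : R) : (sextic (X : R[X])).eval x = sextic x := by
  rw [← Polynomial.coe_evalRingHom, map_sextic, Polynomial.coe_evalRingHom, Polynomial.eval_X]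

end Map

lemma monic_sextic (R : Type*) [CommRing R] : (sextic (X : R[X])).Monic := by
  unfold sextic
  monicity!

lemma natDegree_sextic (R : Type*) [CommRing R] [Nontrivial R] :
    (sextic (X : R[X])).natDegree = 6 := by
  unfold sextic
  compute_degree!

/-- Approximations modulo `94057⁴⁰` of the roots of the sextic. -/
def rootApprox : Fin 6 → ℤ :=
  ![8571591048439783225193579546170091687263806146661088570423203213700040597718260755935346103229944998136369465166998671945946497445283560296476303938038668265534404217695741138933736163521901995351723,
    5514520038953175363556331802683933233751297928251304008589993387555583773679035687461346663532442055815908095287666276526724941667810831885947074788887922643465061751962841738191628211463998001830785,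
    8412920497339972532114963795634115568935438894649987394515086438460393824201380992678007586807073197239903338885623907425252079805178972706093702455165358764554273048252779153363996958861477659786352,
    3333844472052272601302625881119094090453727292734410359083868209560201910469487647304757391799942182719156134426480819396105263007258868325430809617865434587398516149125170293858916738752662275597249,
    2085210857649751831868987022719708025713168463361481137924079930209232008565020655714522983510579284684080494416937318977861236783803126890311032249648954406804549315239042638326002587562445764568874,
    6572842243155783970644911747710936405446195235972804587509187493736439718679142437682336554726344052015130092084592485673174015733170795084413820958968558662226782415974893456982367195407907067825022]

/-- Approximations modulo `94057⁴⁰` of square roots, with product one, of the unit at the roots of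
the sextic. -/
def sqrtApprox : Fin 6 → ℤ :=
  ![3956611995714870126760580465859576676247268899297984833569135929017754026952160865258840505486151763605842511813244359568202748443334938133998711626303941861326972461095258333925479695967095343393674,
    5948416595069440570149143936772501619807207684740047576443267400074181344982026958403410916917493000500503027293773848086820876306057255563353925120635549825059916381841670992838741047185667985428426,
    2050764171298313242408425555835540462869862079788545015763983697017769854846426869491999911318589908891017446089556129051254632553363402355942770970171032174164297019870386148461558214073819445470873,
    1226047009534852073805122855681873245958996265756300886675206006165214992509471252947462483944204085172649532665949875025438541229783524896017231376766131680833589266525351558561337036070174928394797,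
    3967313049921938444204491382478090726043713868681345213592979162084825818385695358339999983372733579347115464888327783969695138208137716959818768018607519301897104697159034398317555680764444302662466,
    6203410810303709632180993083353510503402908214775493609760240717191132069882905830430286379434770204026476856519692167016917820790595096360439512400362724481952058079222602005122453850633721792819238]

instance fact_prime_94057 : Fact (Nat.Prime 94057) := ⟨by norm_num⟩

lemma rootApprox_spec : ∀ i, (94057 ^ 40 : ℤ) ∣ sextic (rootApprox i) ∧
    ¬ (94057 : ℤ) ∣ 6 * rootApprox i ^ 5 - 5 * rootApprox i ^ 4 + 4 * rootApprox i ^ 3 +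
      12 * rootApprox i ^ 2 - 12 * rootApprox i + 2 := by
  unfold sextic
  decide +kernel

lemma sqrtApprox_spec : ∀ i,
    (94057 ^ 40 : ℤ) ∣ sqrtApprox i ^ 2 - sexticUnit (rootApprox i) ∧
    ¬ (94057 : ℤ) ∣ 2 * sqrtApprox i := by
  unfold sexticUnit
  decide +kernel

lemma rootApprox_distinct : ∀ i j, (94057 ^ 40 : ℤ) ∣ rootApprox i - rootApprox j → i = j := by
  decide +kernel

lemma vandermonde_rootApprox : (94057 ^ 40 : ℤ) ∣
    (∏ i : Fin 6, ∏ j ∈ Finset.Ioi i, (rootApprox j - rootApprox i)) ^ 2 - 8464 ^ 2 := by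
  decide +kernel

lemma prod_sexticUnit_rootApprox : (94057 ^ 40 : ℤ) ∣
    (∏ i : Fin 6, sexticUnit (rootApprox i)) - 1 := by
  unfold sexticUnit
  decide +kernel

lemma prod_sqrtApprox : (94057 : ℤ) ∣ (∏ i : Fin 6, sqrtApprox i) - 1 := by
  decide +kernel

lemma toZModPow_intCast_eq_zero (p n : ℕ) [Fact p.Prime] {m : ℤ} (h : (p ^ n : ℤ) ∣ m) :
    PadicInt.toZModPow n (m : ℤ_[p]) = 0 := by
  rw [map_intCast, ZMod.intCast_zmod_eq_zero_iff_dvd]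
  exact_mod_cast h

lemma isUnit_intCast {p : ℕ} [Fact p.Prime] {m : ℤ} (h : ¬ (p : ℤ) ∣ m) :
    IsUnit (m : ℤ_[p]) := by
  rw [PadicInt.isUnit_iff]
  refine le_antisymm (PadicInt.norm_le_one _) (not_lt.mp fun hlt => h ?_)
  exact (PadicInt.norm_int_lt_one_iff_dvd m).mp hlt

/-- The sextic splits over the `94057`-adic integers, and the unit is a square at each root. -/
lemma exists_padic_roots : ∃ T S : Fin 6 → ℤ_[94057], ∀ i,
    sextic (T i) = 0 ∧ S i ^ 2 = sexticUnit (T i) ∧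
    PadicInt.toZModPow 40 (T i) = rootApprox i ∧ PadicInt.toZModPow 40 (S i) = sqrtApprox i := by
  have h1 : ∀ i, ∃ t s : ℤ_[94057], sextic t = 0 ∧ s ^ 2 = sexticUnit t ∧
      PadicInt.toZModPow 40 t = rootApprox i ∧ PadicInt.toZModPow 40 s = sqrtApprox i := by
    intro i
    obtain ⟨t, ht, hta⟩ := exists_root_of_approx (p := 94057) (n := 40) (by norm_num)
      (sextic X) (a := (rootApprox i : ℤ_[94057])) (by
        rw [eval_sextic, sextic_intCast]
        exact toZModPow_intCast_eq_zero 94057 40 (rootApprox_spec i).1) (by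
        have := isUnit_intCast (p := 94057) (rootApprox_spec i).2
        convert this using 1
        simp [sextic]
        ring)
    have hu : PadicInt.toZModPow 40 (sexticUnit t) =
        PadicInt.toZModPow 40 ((sexticUnit (rootApprox i) : ℤ) : ℤ_[94057]) := by
      rw [map_sexticUnit, hta, map_intCast, map_intCast, sexticUnit_intCast]
    obtain ⟨s, hs, hsa⟩ := exists_root_of_approx (p := 94057) (n := 40) (by norm_num)
      (X ^ 2 - C (sexticUnit t)) (a := (sqrtApprox i : ℤ_[94057])) (by
        have := toZModPow_intCast_eq_zero 94057 40 (sqrtApprox_spec i).1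
        rw [Polynomial.eval_sub, Polynomial.eval_C, map_sub, hu, ← map_sub]
        rw [← this]
        simp) (by
        have := isUnit_intCast (p := 94057) (sqrtApprox_spec i).2
        convert this using 1
        simp [one_add_one_eq_two])
    rw [map_intCast] at hta hsa
    refine ⟨t, s, by rwa [eval_sextic] at ht, ?_, hta, hsa⟩
    simpa [sub_eq_zero] using hs
  choose T S h using h1
  exact ⟨T, S, h⟩

section Roots

variable {Ω : Type} [Field Ω] [CharZero Ω] {θ : Fin 6 → Ω}

lemma sextic_eq_prod {Ω : Type} [Field Ω] {θ : Fin 6 → Ω} (hθ : ∀ i, sextic (θ i) = 0) (hinj : Function.Injective θ) (x : Ω) :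
    sextic x = ∏ i, (x - θ i) := by
  have h1 : ∏ i, (X - C (θ i)) = sextic (X : Polynomial Ω) := by
    refine (Polynomial.eq_of_monic_of_dvd_of_natDegree_le
      (Polynomial.monic_prod_of_monic _ _ fun i _ => Polynomial.monic_X_sub_C _)
      (monic_sextic Ω) (Finset.prod_dvd_of_coprime ?_ ?_) ?_).symm
    · exact (Polynomial.pairwise_coprime_X_sub_C hinj).set_pairwise _
    · intro i _
      rw [Polynomial.dvd_iff_isRoot, Polynomial.IsRoot.def, eval_sextic, hθ]
    · rw [natDegree_sextic, Polynomial.natDegree_prod_of_monic _ _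
        fun i _ => Polynomial.monic_X_sub_C _]
      simp
  rw [← eval_sextic, ← h1, Polynomial.eval_prod]
  simp

lemma exists_perm_of_roots (hθ : ∀ i, sextic (θ i) = 0) (hinj : Function.Injective θ)
    (σ : Ω ≃ₐ[ℚ] Ω) : ∃ π : Equiv.Perm (Fin 6), ∀ i, σ (θ i) = θ (π i) := by
  have h1 : ∀ i, ∃ k, σ (θ i) = θ k := fun i => by
    have h2 : sextic (σ (θ i)) = 0 := by
      have := map_sextic (σ : Ω →+* Ω) (θ i)
      rw [hθ, map_zero] at this
      exact this.symm
    rw [sextic_eq_prod hθ hinj, Finset.prod_eq_zero_iff] at h2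
    obtain ⟨k, -, hk⟩ := h2
    exact ⟨k, sub_eq_zero.mp hk⟩
  choose f hf using h1
  have hfi : Function.Injective f := fun i k h => hinj (σ.injective (by rw [hf, hf, h]))
  exact ⟨Equiv.ofBijective f (Finite.injective_iff_bijective.mp hfi), hf⟩

lemma map_det_vandermonde_perm (σ : Ω ≃ₐ[ℚ] Ω) {π : Equiv.Perm (Fin 6)}
    (hπ : ∀ i, σ (θ i) = θ (π i)) :
    σ (Matrix.vandermonde θ).det = (Equiv.Perm.sign π : ℤ) * (Matrix.vandermonde θ).det := by
  have h1 := map_det_vandermonde (σ : Ω →+* Ω) θ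
  have h2 : (σ : Ω →+* Ω) ∘ θ = θ ∘ π := funext hπ
  rw [h2] at h1
  rw [← Matrix.det_permute]
  exact h1

lemma isIntegral_of_sextic {Ω : Type} [Field Ω] {x : Ω} (hx : sextic x = 0) : IsIntegral ℤ x := by
  refine ⟨sextic X, monic_sextic ℤ, ?_⟩
  rw [← Polynomial.coe_eval₂RingHom, map_sextic, Polynomial.coe_eval₂RingHom,
    Polynomial.eval₂_X, hx]

lemma norm_le_of_sextic {z : ℂ} (hz : sextic z = 0) : ‖z‖ ≤ 3 := by
  by_contra! h
  have h1 : z ^ 6 = z ^ 5 - z ^ 4 - 4 * z ^ 3 + 6 * z ^ 2 - 2 * z - 2 := by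
    unfold sextic at hz
    linear_combination hz
  have h2 := congrArg norm h1
  rw [norm_pow] at h2
  set r := ‖z‖
  have h3 : ‖z ^ 5 - z ^ 4 - 4 * z ^ 3 + 6 * z ^ 2 - 2 * z - 2‖ ≤
      r ^ 5 + r ^ 4 + 4 * r ^ 3 + 6 * r ^ 2 + 2 * r + 2 := by
    refine (norm_sub_le _ _).trans (add_le_add ((norm_sub_le _ _).trans (add_le_add
      ((norm_add_le _ _).trans (add_le_add ((norm_sub_le _ _).trans (add_le_add
      ((norm_sub_le _ _).trans (add_le_add ?_ ?_)) ?_)) ?_)) ?_)) ?_) <;> simp [r]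
  rw [← h2] at h3
  have h4 : r ^ 5 + r ^ 4 + 4 * r ^ 3 + 6 * r ^ 2 + 2 * r + 2 < r ^ 6 := by
    obtain ⟨d, hd, hr⟩ : ∃ d, 0 < d ∧ r = 3 + d := ⟨r - 3, by linarith, by ring⟩
    have h5 : 0 < 235 + 799 * d + 849 * d ^ 2 + 434 * d ^ 3 + 119 * d ^ 4 + 17 * d ^ 5 + d ^ 6 := by
      positivity
    rw [hr]
    linear_combination h5
  linarith

lemma norm_sexticUnit_le {z : ℂ} (hz : sextic z = 0) : ‖sexticUnit z‖ ≤ 400 := by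
  have h := norm_le_of_sextic hz
  have h1 : ‖z ^ 5 + 2 * z ^ 3 + 3 * z ^ 2 + 2 * z - 1‖ ≤
      ‖z‖ ^ 5 + 2 * ‖z‖ ^ 3 + 3 * ‖z‖ ^ 2 + 2 * ‖z‖ + 1 := by
    refine (norm_sub_le _ _).trans (add_le_add ((norm_add_le _ _).trans (add_le_add
      ((norm_add_le _ _).trans (add_le_add ((norm_add_le _ _).trans (add_le_add ?_ ?_)) ?_)) ?_))
      ?_) <;> simp
  refine h1.trans ?_
  calc _ ≤ (3 : ℝ) ^ 5 + 2 * 3 ^ 3 + 3 * 3 ^ 2 + 2 * 3 + 1 := by gcongr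
    _ ≤ 400 := by norm_num

end Roots

lemma intCast_zmod_eq_zero {m : ℤ} (h : (94057 ^ 40 : ℤ) ∣ m) : (m : ZMod (94057 ^ 40)) = 0 := by
  rw [ZMod.intCast_zmod_eq_zero_iff_dvd]
  exact_mod_cast h

/-- The six roots of the sextic; the last condition says that the discriminant is a square. -/
structure IsSexticRoots {Ω : Type} [Field Ω] (θ : Fin 6 → Ω) : Prop where
  root : ∀ i, sextic (θ i) = 0
  inj : Function.Injective θ
  disc : (Matrix.vandermonde θ).det ^ 2 = 8464 ^ 2

lemma IsSexticRoots.exists_perm {Ω : Type} [Field Ω] [CharZero Ω] {θ : Fin 6 → Ω}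
    (h : IsSexticRoots θ) (σ : Ω ≃ₐ[ℚ] Ω) :
    ∃ π ∈ alternatingGroup (Fin 6), ∀ i, σ (θ i) = θ (π i) := by
  obtain ⟨π, hπ⟩ := exists_perm_of_roots h.root h.inj σ
  refine ⟨π, Equiv.Perm.mem_alternatingGroup.mpr ?_, hπ⟩
  have h1 := map_det_vandermonde_perm σ hπ
  have h2 : σ (Matrix.vandermonde θ).det = (Matrix.vandermonde θ).det := by
    rcases sq_eq_sq_iff_eq_or_eq_neg.mp h.disc with e | e <;> rw [e] <;> simp [map_ofNat]
  have h3 : (Matrix.vandermonde θ).det ≠ 0 := Matrix.det_vandermonde_ne_zero_iff.mpr h.inj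
  rw [h2] at h1
  have h4 := mul_right_cancel₀ h3 ((one_mul _).trans h1)
  rcases Int.units_eq_one_or (Equiv.Perm.sign π) with e | e
  · exact e
  · rw [e] at h4
    norm_num at h4

/-- Roots of the sextic and square roots of the unit at these roots, with product one, together
with their images in the `94057`-adic integers. -/
theorem exists_sexticRoots (Ω : Type) [Field Ω] [CharZero Ω] [IsAlgClosed Ω] [IsGalois ℚ Ω]
    {K : Type} [Field K] (κ : ℤ_[94057] →+* K) (hκ : Function.Injective κ) (j : Ω →+* K)
    (ι : Ω →+* ℂ) :
    ∃ (θ s : Fin 6 → Ω) (T S : Fin 6 → ℤ_[94057]), IsSexticRoots θ ∧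
      (∀ i, s i ^ 2 = sexticUnit (θ i)) ∧ ∏ i, s i = 1 ∧
      (∀ i, j (θ i) = κ (T i)) ∧ (∀ i, j (s i) = κ (S i)) ∧
      (∀ i, PadicInt.toZModPow 40 (T i) = rootApprox i) ∧
      ∀ i, PadicInt.toZModPow 40 (S i) = sqrtApprox i := by
  obtain ⟨T, S, hTS⟩ := exists_padic_roots
  have h1 : ∀ i, ∃ x : Ω, sextic x = 0 ∧ j x = κ (T i) := fun i => by
    have := exists_preimage_of_root j (F := sextic X) (monic_sextic Ω).ne_zero (y := κ (T i)) (by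
      have := map_sextic (Polynomial.mapRingHom j) X
      rw [Polynomial.coe_mapRingHom, Polynomial.map_X] at this
      rw [this, eval_sextic, ← map_sextic, (hTS i).1, map_zero])
    simpa only [eval_sextic] using this
  choose θ hθ hjθ using h1
  have h2 : ∀ i, ∃ x : Ω, x ^ 2 = sexticUnit (θ i) ∧ j x = κ (S i) := fun i => by
    have := exists_preimage_of_root j (F := X ^ 2 - C (sexticUnit (θ i)))
      (Polynomial.X_pow_sub_C_ne_zero (by norm_num) _) (y := κ (S i)) (by
      simp only [Polynomial.map_sub, Polynomial.map_pow, Polynomial.map_X, Polynomial.map_C,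
        Polynomial.eval_sub, Polynomial.eval_pow, Polynomial.eval_X, Polynomial.eval_C]
      rw [map_sexticUnit, hjθ, ← map_sexticUnit, ← (hTS i).2.1, map_pow, sub_self])
    simpa [sub_eq_zero] using this
  choose s hs hjs using h2
  have hinj : Function.Injective θ := fun a b hab => by
    have h3 : T a = T b := hκ (by rw [← hjθ, ← hjθ, hab])
    have h4 := (hTS a).2.2.1
    rw [h3, (hTS b).2.2.1] at h4
    refine rootApprox_distinct a b ?_
    have h5 := (ZMod.intCast_eq_intCast_iff_dvd_sub _ _ _).mp h4
    exact_mod_cast h5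
  have hjT : j ∘ θ = κ ∘ T := funext hjθ
  have hint : ∀ i, θ i ∈ integralClosure ℤ Ω := fun i => isIntegral_of_sextic (hθ i)
  have hαint : ∀ i, sexticUnit (θ i) ∈ integralClosure ℤ Ω := fun i => by
    have := (sexticUnit (⟨θ i, hint i⟩ : integralClosure ℤ Ω)).2
    have e := map_sexticUnit (integralClosure ℤ Ω).val.toRingHom ⟨θ i, hint i⟩
    have e' : ((sexticUnit (⟨θ i, hint i⟩ : integralClosure ℤ Ω) : integralClosure ℤ Ω) : Ω) =
      sexticUnit (θ i) := e
    rwa [e'] at this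
  have hιroot : ∀ i, sextic (ι (θ i)) = 0 := fun i => by rw [← map_sextic, hθ, map_zero]
  have hdisc : (Matrix.vandermonde θ).det ^ 2 = 8464 ^ 2 := by
    rw [← sub_eq_zero]
    refine eq_zero_of_fixed (p := 94057) 40 κ hκ j ι ?_ (fun σ => ?_) ?_
      (y := (Matrix.vandermonde T).det ^ 2 - 8464 ^ 2) ?_ ?_
    · rw [Matrix.det_vandermonde]
      exact sub_mem (pow_mem (prod_mem fun i _ => prod_mem fun k _ =>
        sub_mem (hint _) (hint _)) 2) (pow_mem (ofNat_mem (integralClosure ℤ Ω) 8464) 2)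
    · obtain ⟨π, hπ⟩ := exists_perm_of_roots hθ hinj σ
      rw [map_sub, map_pow, map_pow, map_det_vandermonde_perm σ hπ, mul_pow]
      rcases Int.units_eq_one_or (Equiv.Perm.sign π) with e | e <;> rw [e] <;> simp [map_ofNat]
    · have hb : ∀ i k, ‖ι (θ k) - ι (θ i)‖ ≤ 6 := fun i k =>
        (norm_sub_le _ _).trans (by
          linarith [norm_le_of_sextic (hιroot i), norm_le_of_sextic (hιroot k)])
      have hb2 : ‖ι (Matrix.vandermonde θ).det‖ ≤ 6 ^ 15 := by
        rw [Matrix.det_vandermonde, map_prod, norm_prod]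
        calc _ ≤ ∏ i : Fin 6, ∏ _k ∈ Finset.Ioi i, (6 : ℝ) := by
              refine Finset.prod_le_prod (fun i _ => norm_nonneg _) fun i _ => ?_
              rw [map_prod, norm_prod]
              refine Finset.prod_le_prod (fun k _ => norm_nonneg _) fun k _ => ?_
              rw [map_sub]
              exact hb i k
          _ = 6 ^ 15 := by
              simp [Fin.prod_univ_succ]
              norm_num
      rw [map_sub, map_pow, map_pow, map_ofNat]
      refine (norm_sub_le _ _).trans_lt ?_
      rw [norm_pow, norm_pow]
      calc _ ≤ ((6 : ℝ) ^ 15) ^ 2 + 8464 ^ 2 := by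
            gcongr
            simp
        _ < _ := by norm_num
    · rw [map_sub, map_pow, map_pow, map_ofNat, map_det_vandermonde, hjT, map_sub, map_pow,
        map_pow, map_ofNat, map_det_vandermonde]
    · have h3 : PadicInt.toZModPow 40 ∘ T = Int.castRingHom (ZMod (94057 ^ 40)) ∘ rootApprox :=
        funext fun i => (hTS i).2.2.1
      rw [map_sub, map_pow, map_pow, map_det_vandermonde, h3, ← map_det_vandermonde,
        Matrix.det_vandermonde, ← map_pow, map_ofNat]
      have := intCast_zmod_eq_zero vandermonde_rootApprox
      rw [Int.cast_sub] at this
      rw [← this]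
      simp
      norm_num
  have hα : ∏ i, sexticUnit (θ i) = 1 := by
    rw [← sub_eq_zero]
    refine eq_zero_of_fixed (p := 94057) 40 κ hκ j ι ?_ (fun σ => ?_) ?_
      (y := (∏ i, sexticUnit (T i)) - 1) ?_ ?_
    · exact sub_mem (prod_mem fun i _ => hαint i) (one_mem _)
    · obtain ⟨π, hπ⟩ := exists_perm_of_roots hθ hinj σ
      rw [map_sub, map_one, map_prod, ← Equiv.prod_comp π (fun i => sexticUnit (θ i))]
      congr 2
      ext i
      rw [← hπ]
      exact map_sexticUnit (σ : Ω →+* Ω) _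
    · rw [map_sub, map_one, map_prod]
      refine (norm_sub_le _ _).trans_lt ?_
      rw [norm_prod, norm_one]
      calc _ ≤ (∏ _i : Fin 6, (400 : ℝ)) + 1 := by
            gcongr with i
            rw [map_sexticUnit]
            exact norm_sexticUnit_le (hιroot i)
        _ < _ := by
            simp only [Finset.prod_const, Finset.card_univ, Fintype.card_fin]
            norm_num
    · simp only [map_sub, map_one, map_prod, map_sexticUnit, hjθ]
    · rw [← intCast_zmod_eq_zero prod_sexticUnit_rootApprox]
      simp only [map_sub, map_one, map_prod, map_sexticUnit, (hTS _).2.2.1, Int.cast_sub,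
        Int.cast_prod, Int.cast_one, sexticUnit_intCast]
  refine ⟨θ, s, T, S, ⟨hθ, hinj, hdisc⟩, hs, ?_, hjθ, hjs, fun i => (hTS i).2.2.1,
    fun i => (hTS i).2.2.2⟩
  have h3 : (∏ i, s i) ^ 2 = 1 := by
    rw [← Finset.prod_pow, ← hα]
    exact Finset.prod_congr rfl fun i _ => hs i
  rcases sq_eq_sq_iff_eq_or_eq_neg.mp (h3.trans (one_pow 2).symm) with e | e
  · exact e
  -- the product of the residues is one, so the sign is plus
  · exfalso
    have h4 : ∏ i, S i = -1 := hκ (by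
      rw [map_prod, map_neg, map_one, ← map_one j, ← map_neg, ← e, map_prod]
      exact Finset.prod_congr rfl fun i _ => (hjs i).symm)
    have h5 := congrArg (PadicInt.toZModPow 40) h4
    rw [map_prod, map_neg, map_one] at h5
    simp only [(hTS _).2.2.2] at h5
    have h6 : ((∏ i, sqrtApprox i + 1 : ℤ) : ZMod (94057 ^ 40)) = 0 := by
      rw [Int.cast_add, Int.cast_prod, h5]
      simp
    rw [ZMod.intCast_zmod_eq_zero_iff_dvd] at h6
    have h7 : (94057 : ℤ) ∣ ∏ i, sqrtApprox i + 1 :=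
      (dvd_pow_self (94057 : ℤ) (by norm_num : 40 ≠ 0)).trans (by exact_mod_cast h6)
    have h8 := dvd_sub h7 prod_sqrtApprox
    norm_num at h8

/-! ### The Galois group of the sextic -/

namespace IsSexticRoots

variable {Ω : Type} [Field Ω] {θ : Fin 6 → Ω}

/-- The roots of the sextic as algebraic integers. -/
def toInt (h : IsSexticRoots θ) (i : Fin 6) : integralClosure ℤ Ω :=
  ⟨θ i, isIntegral_of_sextic (h.root i)⟩

lemma sextic_intCast_reduction (h : IsSexticRoots θ) {k : Type*} [Field k]
    (r : integralClosure ℤ Ω →+* k) (m : ℤ) :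
    sextic (m : k) = ∏ i, ((m : k) - r (h.toInt i)) := by
  have h1 : sextic (m : integralClosure ℤ Ω) = ∏ i, ((m : integralClosure ℤ Ω) - h.toInt i) := by
    apply Subtype.val_injective
    have e1 := map_sextic (integralClosure ℤ Ω).val.toRingHom (m : integralClosure ℤ Ω)
    have e2 := map_prod (integralClosure ℤ Ω).val.toRingHom
      (fun i => (m : integralClosure ℤ Ω) - h.toInt i) Finset.univ
    refine e1.trans (Eq.trans ?_ e2.symm)
    simp only [map_intCast, map_sub]
    exact sextic_eq_prod h.root h.inj (m : Ω)
  have h2 := congrArg r h1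
  rw [map_sextic, map_prod] at h2
  simpa only [map_intCast, map_sub] using h2

lemma reduction_injective (h : IsSexticRoots θ) {q : ℕ} {k : Type*} [Field k] [CharP k q]
    (hq : ¬ q ∣ 8464 ^ 2) (r : integralClosure ℤ Ω →+* k) :
    Function.Injective fun i => r (h.toInt i) := by
  rw [← Matrix.det_vandermonde_ne_zero_iff]
  have h1 : (Matrix.vandermonde h.toInt).det ^ 2 = 8464 ^ 2 := by
    apply Subtype.val_injective
    have e1 := map_det_vandermonde (integralClosure ℤ Ω).val.toRingHom h.toInt
    have e2 := congrArg (· ^ 2) e1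
    refine Eq.trans (map_pow (integralClosure ℤ Ω).val.toRingHom _ 2) (e2.trans ?_)
    have e3 : (integralClosure ℤ Ω).val.toRingHom ∘ h.toInt = θ := rfl
    rw [e3]
    exact h.disc
  have h2 := congrArg r h1
  rw [map_pow, map_det_vandermonde, map_pow, map_ofNat] at h2
  intro h0
  rw [show (fun i => r (h.toInt i)) = r ∘ h.toInt from rfl] at h0
  rw [h0, zero_pow two_ne_zero] at h2
  refine hq ((CharP.cast_eq_zero_iff k q _).mp ?_)
  rw [Nat.cast_pow, Nat.cast_ofNat, ← h2]

lemma _root_.exists_natCast_eq {k : Type*} [Field k] (q : ℕ) [Fact q.Prime] [CharP k q] {x : k}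
    (hx : x ^ q = x) : ∃ c < q, (c : k) = x := by
  rw [← Subfield.mem_bot_iff_pow_eq_self k q, ← ZMod.fieldRange_castHom_eq_bot q] at hx
  obtain ⟨c, hc⟩ := hx
  exact ⟨c.val, ZMod.val_lt c, by
    rw [← hc, ← map_natCast (ZMod.castHom (dvd_refl q) k), ZMod.natCast_zmod_val]⟩

variable [CharZero Ω]

/-- The number of roots fixed by a Frobenius element at `q` is the number of roots of the sextic
modulo `q`. -/
lemma card_fixed (h : IsSexticRoots θ) (q : ℕ) [Fact q.Prime] (hq : ¬ q ∣ 8464 ^ 2)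
    {k : Type*} [Field k] [CharP k q] (r : integralClosure ℤ Ω →+* k) (σ : Ω ≃ₐ[ℚ] Ω)
    (hσ : ∀ x y : integralClosure ℤ Ω, (y : Ω) = σ x → r y = r x ^ q)
    {π : Equiv.Perm (Fin 6)} (hπ : ∀ i, σ (θ i) = θ (π i)) :
    (Finset.univ.filter fun i => π i = i).card =
      ((Finset.range q).filter fun c : ℕ => (q : ℤ) ∣ sextic (c : ℤ)).card := by
  have hinj := h.reduction_injective hq r
  have hfix : ∀ i, π i = i ↔ r (h.toInt i) ^ q = r (h.toInt i) := fun i => by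
    have h1 := hσ (h.toInt i) (h.toInt (π i)) (hπ i).symm
    rw [← h1]
    exact ⟨fun e => by rw [e], fun e => hinj e⟩
  have hcast : ∀ c : ℕ, (q : ℤ) ∣ sextic (c : ℤ) ↔ ∃ i, (c : k) = r (h.toInt i) := fun c => by
    have h1 := h.sextic_intCast_reduction r c
    rw [← CharP.intCast_eq_zero_iff k q, ← sextic_intCast, h1, Finset.prod_eq_zero_iff]
    simp [sub_eq_zero]
  classical
  rw [← Finset.card_image_of_injective _ hinj,
    ← Finset.card_image_of_injOn (f := fun c : ℕ => (c : k)) (s := (Finset.range q).filter _)]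
  · congr 1
    ext x
    simp only [Finset.mem_image, Finset.mem_filter, Finset.mem_univ, true_and, Finset.mem_range,
      hfix, hcast]
    constructor
    · rintro ⟨i, hi, rfl⟩
      obtain ⟨c, hc, e⟩ := exists_natCast_eq q hi
      exact ⟨c, ⟨hc, i, e⟩, e⟩
    · rintro ⟨c, ⟨-, i, hi⟩, rfl⟩
      refine ⟨i, ?_, hi.symm⟩
      rw [← hi, ← Subfield.mem_bot_iff_pow_eq_self k q]
      exact natCast_mem _ c
  · intro c hc d hd hcd
    have h1 := Finset.mem_range.mp (Finset.mem_filter.mp hc).1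
    have h2 := Finset.mem_range.mp (Finset.mem_filter.mp hd).1
    have h3 := (CharP.natCast_eq_natCast k q).mp hcd
    rwa [Nat.ModEq, Nat.mod_eq_of_lt h1, Nat.mod_eq_of_lt h2] at h3

end IsSexticRoots

lemma exists_pow_eq_of_card_fixed : ∀ π : Equiv.Perm (Fin 6), Equiv.Perm.sign π = 1 →
    (Finset.univ.filter fun i => π i = i).card = 1 → ∀ x y, π x ≠ x → π y ≠ y →
    ∃ n : Fin 5, (π ^ (n : ℕ)) x = y := by
  decide +kernel

/-- Even permutations with three, with one and with no fixed points generate `A₆`: the second is a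
five-cycle, so together with the third it generates a doubly transitive group, and the first is a
three-cycle. -/
lemma alternatingGroup_le_of_card_fixed {N : Subgroup (Equiv.Perm (Fin 6))}
    {a b c : Equiv.Perm (Fin 6)} (ha : a ∈ N) (hb : b ∈ N) (hc : c ∈ N)
    (hb' : Equiv.Perm.sign b = 1)
    (h3 : (Finset.univ.filter fun i => a i = i).card = 3)
    (h1 : (Finset.univ.filter fun i => b i = i).card = 1)
    (h0 : (Finset.univ.filter fun i => c i = i).card = 0) : alternatingGroup (Fin 6) ≤ N := by
  have ha3 : a.IsThreeCycle := by
    rw [← card_support_eq_three_iff]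
    have h := Finset.card_filter_add_card_filter_not (s := (Finset.univ : Finset (Fin 6)))
      (fun i => a i = i)
    rw [h3, Finset.card_univ, Fintype.card_fin] at h
    have e : a.support = Finset.univ.filter fun i => ¬ a i = i := by
      ext i
      simp
    rw [e]
    omega
  obtain ⟨z, hz⟩ := Finset.card_eq_one.mp h1
  have hbz : ∀ i, b i = i ↔ i = z := fun i => by
    have h : i ∈ (Finset.univ.filter fun i => b i = i) ↔ i ∈ ({z} : Finset (Fin 6)) := by rw [hz]
    simpa using h
  have hcz : c z ≠ z := fun e => by
    have := Finset.card_eq_zero.mp h0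
    have h : z ∈ Finset.univ.filter fun i => c i = i := by simp [e]
    rw [this] at h
    exact absurd h (Finset.notMem_empty z)
  have horb : ∀ x y, x ≠ z → y ≠ z → ∃ g ∈ N, g x = y ∧ g z = z := fun x y hx hy => by
    obtain ⟨n, hn⟩ := exists_pow_eq_of_card_fixed b hb' h1 x y (fun e => hx ((hbz x).mp e))
      (fun e => hy ((hbz y).mp e))
    exact ⟨b ^ (n : ℕ), pow_mem hb _, hn, Equiv.Perm.pow_apply_eq_self_of_apply_eq_self
      ((hbz z).mpr rfl) _⟩
  have htr : ∀ x, ∃ g ∈ N, g x = z := fun x => by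
    by_cases hx : x = z
    · exact ⟨1, one_mem N, hx⟩
    · obtain ⟨g, hg, h, -⟩ := horb x (c z) hx hcz
      exact ⟨c⁻¹ * g, mul_mem (inv_mem hc) hg, by
        rw [Equiv.Perm.mul_apply, h]
        exact c.symm_apply_apply z⟩
  have h2 : MulAction.IsMultiplyPretransitive N (Fin 6) 2 := by
    rw [MulAction.is_two_pretransitive_iff]
    intro x y x' y' hxy hxy'
    obtain ⟨g, hg, hgx⟩ := htr x
    obtain ⟨g', hg', hgx'⟩ := htr x'
    obtain ⟨t, ht, hty, htz⟩ := horb (g y) (g' y') (fun e => hxy (g.injective (hgx.trans e.symm)))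
      (fun e => hxy' (g'.injective (hgx'.trans e.symm)))
    refine ⟨⟨g'⁻¹ * t * g, mul_mem (mul_mem (inv_mem hg') ht) hg⟩, ?_, ?_⟩
    · change g'.symm (t (g x)) = x'
      rw [hgx, htz, ← hgx', Equiv.symm_apply_apply]
    · change g'.symm (t (g y)) = y'
      rw [hty, Equiv.symm_apply_apply]
  exact Equiv.Perm.alternatingGroup_le_of_isPreprimitive_of_isThreeCycle_mem
    (MulAction.isPreprimitive_of_is_two_pretransitive h2) ha3 ha

/-- Every even permutation of the roots of the sextic is induced by an automorphism. -/
theorem IsSexticRoots.exists_auto {Ω : Type} [Field Ω] [CharZero Ω] [IsGalois ℚ Ω]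
    {θ : Fin 6 → Ω} (h : IsSexticRoots θ) {ρ : Equiv.Perm (Fin 6)}
    (hρ : ρ ∈ alternatingGroup (Fin 6)) : ∃ σ : Ω ≃ₐ[ℚ] Ω, ∀ i, σ (θ i) = θ (ρ i) := by
  let N : Subgroup (Equiv.Perm (Fin 6)) :=
    { carrier := {π | ∃ σ : Ω ≃ₐ[ℚ] Ω, ∀ i, σ (θ i) = θ (π i)}
      one_mem' := ⟨1, fun i => rfl⟩
      mul_mem' := by
        rintro π τ ⟨σ, hσ⟩ ⟨σ', hσ'⟩
        exact ⟨σ * σ', fun i => by rw [AlgEquiv.mul_apply, hσ', hσ]; rfl⟩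
      inv_mem' := by
        rintro π ⟨σ, hσ⟩
        refine ⟨σ⁻¹, fun i => ?_⟩
        have h1 : π (π⁻¹ i) = i := π.apply_symm_apply i
        rw [AlgEquiv.aut_inv, AlgEquiv.symm_apply_eq, hσ, h1] }
  have hmem : ∀ q : ℕ, q.Prime → ¬ q ∣ 8464 ^ 2 → ∃ π ∈ N, Equiv.Perm.sign π = 1 ∧
      (Finset.univ.filter fun i => π i = i).card =
        ((Finset.range q).filter fun c : ℕ => (q : ℤ) ∣ sextic (c : ℤ)).card := by
    intro q hq hqd
    have := Fact.mk hq
    obtain ⟨k, _, _, r, σ, hσ⟩ := exists_frobenius Ω q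
    obtain ⟨π, hπ, e⟩ := h.exists_perm σ
    exact ⟨π, ⟨σ, e⟩, Equiv.Perm.mem_alternatingGroup.mp hπ, h.card_fixed q hqd r σ hσ e⟩
  obtain ⟨a, ha, -, ha3⟩ := hmem 17 (by norm_num) (by norm_num)
  obtain ⟨b, hb, hb', hb1⟩ := hmem 3 (by norm_num) (by norm_num)
  obtain ⟨c, hc, -, hc0⟩ := hmem 5 (by norm_num) (by norm_num)
  exact alternatingGroup_le_of_card_fixed ha hb hc hb' (ha3.trans (by unfold sextic; decide +kernel))
    (hb1.trans (by unfold sextic; decide +kernel)) (hc0.trans (by unfold sextic; decide +kernel)) hρ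

/-! ### The sixteen conjugates -/

/-- The coefficients of a symmetric polynomial in two variables. -/
def pairCoeff : Matrix (Fin 5) (Fin 5) ℤ :=
  !![-68, 100, -18, -42, 10; 100, -204, 44, 88, -32; -18, 44, -19, -21, 17;
    -42, 88, -21, -29, 15; 10, -32, 17, 15, -11]

/-- The symmetric polynomial with coefficients `pairCoeff`, as a function. -/
def pairPoly {R : Type*} [CommRing R] (x y : R) : R :=
  ∑ k : Fin 5, ∑ l : Fin 5, (pairCoeff k l : R) * x ^ (k : ℕ) * y ^ (l : ℕ)

/-- The numbers, indexed by the sixteen points, that are `736` times the roots of `poly16` if the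
`θ i` are the roots of the sextic and the `s i` suitable square roots of the unit. The diagonal
terms of the sum contribute the integer `-552`. -/
def bigRoot {R : Type*} [CommRing R] (θ s : Fin 6 → R) (w : Pt) : R :=
  644 + ∑ i, ∑ k, (sgn (evenRep w i + evenRep w k) : R) * pairPoly (θ i) (θ k) * (s i * s k)

/-- The coefficients of `poly16`, the leading one first. -/
def polyCoeff : Fin 17 → ℤ :=
  ![1, -2, 3, -16, 18, 0, -10, 40, -39, 54, 23, 16, -140, -188, -28, 104, -4]

/-- The value `736¹⁶ poly16 (x / 736)`. -/
def scaledPoly {R : Type*} [CommRing R] (x : R) : R :=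
  ∑ k : Fin 17, (polyCoeff k : R) * x ^ (16 - k : ℕ) * 736 ^ (k : ℕ)

section Map

variable {R S : Type*} [CommRing R] [CommRing S] (φ : R →+* S)

lemma map_pairPoly (x y : R) : φ (pairPoly x y) = pairPoly (φ x) (φ y) := by
  simp [pairPoly]

lemma map_bigRoot (θ s : Fin 6 → R) (w : Pt) :
    φ (bigRoot θ s w) = bigRoot (φ ∘ θ) (φ ∘ s) w := by
  simp [bigRoot, map_pairPoly, map_ofNat]

lemma map_scaledPoly (x : R) : φ (scaledPoly x) = scaledPoly (φ x) := by
  simp [scaledPoly, map_ofNat]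

end Map

lemma sqrtApprox_bigRoot : ∀ w : Pt,
    (94057 ^ 40 : ℤ) ∣ scaledPoly (bigRoot rootApprox sqrtApprox w) := by
  unfold scaledPoly bigRoot pairPoly
  decide +kernel

lemma bigRoot_distinct : ∀ v w : Pt, (94057 : ℤ) ∣
    bigRoot rootApprox sqrtApprox v - bigRoot rootApprox sqrtApprox w → v = w := by
  unfold bigRoot pairPoly
  decide +kernel

lemma norm_pairPoly_le {x y : ℂ} (hx : ‖x‖ ≤ 3) (hy : ‖y‖ ≤ 3) : ‖pairPoly x y‖ ≤ 4 * 10 ^ 7 := by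
  have h1 : ∀ k l, |pairCoeff k l| ≤ 204 := by decide +kernel
  have h2 : ∀ k l : Fin 5, ‖(pairCoeff k l : ℂ) * x ^ (k : ℕ) * y ^ (l : ℕ)‖ ≤
      204 * 3 ^ 4 * 3 ^ 4 := fun k l => by
    rw [norm_mul, norm_mul, norm_pow, norm_pow, Complex.norm_intCast]
    have h3 : |(pairCoeff k l : ℝ)| ≤ 204 := by exact_mod_cast h1 k l
    have h4 : ∀ (z : ℂ) (m : Fin 5), ‖z‖ ≤ 3 → ‖z‖ ^ (m : ℕ) ≤ 3 ^ 4 := fun z m hz =>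
      (pow_le_pow_left₀ (norm_nonneg z) hz _).trans (pow_le_pow_right₀ (by norm_num) (by omega))
    have h5 := h4 x k hx
    have h6 := h4 y l hy
    gcongr
  calc _ ≤ ∑ _k : Fin 5, ∑ _l : Fin 5, (204 * 3 ^ 4 * 3 ^ 4 : ℝ) :=
        (norm_sum_le _ _).trans (Finset.sum_le_sum fun k _ =>
          (norm_sum_le _ _).trans (Finset.sum_le_sum fun l _ => h2 k l))
    _ ≤ _ := by
        simp only [Finset.sum_const, Finset.card_univ, Fintype.card_fin]
        norm_num

lemma norm_bigRoot_le {θ s : Fin 6 → ℂ} (hθ : ∀ i, sextic (θ i) = 0)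
    (hs : ∀ i, s i ^ 2 = sexticUnit (θ i)) (w : Pt) : ‖bigRoot θ s w‖ ≤ 10 ^ 12 := by
  have h1 : ∀ i, ‖s i‖ ≤ 20 := fun i => by
    have h := norm_sexticUnit_le (hθ i)
    rw [← hs, norm_pow] at h
    nlinarith [norm_nonneg (s i)]
  have hsgn : ∀ a, |sgn a| ≤ 1 := by decide
  have h2 : ∀ i k, ‖(sgn (evenRep w i + evenRep w k) : ℂ) * pairPoly (θ i) (θ k) * (s i * s k)‖ ≤
      1 * (4 * 10 ^ 7) * (20 * 20) := fun i k => by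
    rw [norm_mul, norm_mul, norm_mul, Complex.norm_intCast]
    have h3 : |(sgn (evenRep w i + evenRep w k) : ℝ)| ≤ 1 := by exact_mod_cast hsgn _
    have h4 := norm_pairPoly_le (norm_le_of_sextic (hθ i)) (norm_le_of_sextic (hθ k))
    have h5 := h1 i
    have h6 := h1 k
    gcongr
  calc _ ≤ (644 : ℝ) + ∑ _i : Fin 6, ∑ _k : Fin 6, (1 * (4 * 10 ^ 7) * (20 * 20) : ℝ) :=
        (norm_add_le _ _).trans (add_le_add (by simp) ((norm_sum_le _ _).trans
          (Finset.sum_le_sum fun k _ => (norm_sum_le _ _).trans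
            (Finset.sum_le_sum fun l _ => h2 k l))))
    _ ≤ _ := by
        simp only [Finset.sum_const, Finset.card_univ, Fintype.card_fin]
        norm_num

lemma norm_scaledPoly_le {x : ℂ} (hx : ‖x‖ ≤ 10 ^ 12) : ‖scaledPoly x‖ ≤ 10 ^ 198 := by
  have h1 : ∀ k, |polyCoeff k| ≤ 188 := by decide +kernel
  have h2 : ∀ k : Fin 17, ‖(polyCoeff k : ℂ) * x ^ (16 - k : ℕ) * 736 ^ (k : ℕ)‖ ≤
      188 * (10 ^ 12) ^ 16 := fun k => by
    rw [norm_mul, norm_mul, norm_pow, norm_pow, Complex.norm_intCast]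
    have h3 : |(polyCoeff k : ℝ)| ≤ 188 := by exact_mod_cast h1 k
    have h4 : ‖(736 : ℂ)‖ ≤ 10 ^ 12 := by simp; norm_num
    calc _ ≤ 188 * (10 ^ 12 : ℝ) ^ (16 - k : ℕ) * (10 ^ 12) ^ (k : ℕ) := by gcongr
      _ = 188 * (10 ^ 12) ^ 16 := by
        rw [mul_assoc, ← pow_add]
        congr 2
        omega
  calc _ ≤ ∑ _k : Fin 17, (188 * (10 ^ 12) ^ 16 : ℝ) :=
        (norm_sum_le _ _).trans (Finset.sum_le_sum fun k _ => h2 k)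
    _ ≤ _ := by
        simp only [Finset.sum_const, Finset.card_univ, Fintype.card_fin]
        norm_num

lemma eval_poly16 {Ω : Type*} [Field Ω] [CharZero Ω] (x : Ω) :
    (736 : Ω) ^ 16 * aeval (x / 736) poly16 = scaledPoly x := by
  simp [poly16, scaledPoly, polyCoeff, Fin.sum_univ_succ, map_ofNat]
  field_simp
  ring

/-- The numbers `bigRoot` are permuted in the same way as the sixteen points. -/
lemma IsSqrtTower.apply_bigRoot {Ω : Type*} [Field Ω] [CharZero Ω] {θ s : Fin 6 → Ω}
    (h : IsSqrtTower θ s) (σ : Ω ≃ₐ[ℚ] Ω) (w : Pt) :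
    σ (bigRoot θ s w) = bigRoot θ s (h.hom σ • w) := by
  rw [h.hom_apply, affineElt_smul]
  set π := h.perm σ
  set e := h.sign σ
  have h1 : ∀ i k, evenRep (coordAct π w + ptClass e) (π i) +
      evenRep (coordAct π w + ptClass e) (π k) =
      (evenRep w i + evenRep w k) + (e (π i) + e (π k)) := by
    have ha : ∀ v v' : Pt, ∀ i, evenRep (v + v') i = evenRep v i + evenRep v' i := by
      decide +kernel
    have hb : ∀ i, evenRep (coordAct π w) (π i) = evenRep w i - evenRep w (π⁻¹ 5) := fun i => by
      rw [coordAct, evenRep_ptClass _ (by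
        rw [Equiv.sum_comp π⁻¹ (evenRep w)]
        exact evenRep_sum w)]
      congr 2
      exact π.symm_apply_apply i
    have hc : ∀ a b c d x y : ZMod 2, (a - x + (b - y)) + (c - x + (d - y)) = a + c + (b + d) := by
      decide +kernel
    intro i k
    rw [ha, ha, hb, hb, evenRep_ptClass _ (h.sign_sum σ), evenRep_ptClass _ (h.sign_sum σ), hc]
  unfold bigRoot
  rw [map_add, map_ofNat, map_sum, ← Equiv.sum_comp π (fun i => ∑ k, _ * _ * (s i * s k))]
  congr 1
  refine Finset.sum_congr rfl fun i _ => ?_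
  rw [map_sum]
  refine (Finset.sum_congr rfl fun k _ => ?_).trans (Equiv.sum_comp π _)
  have h2 : σ (pairPoly (θ i) (θ k)) = pairPoly (θ (π i)) (θ (π k)) := by
    rw [← h.apply_θ, ← h.apply_θ]
    exact map_pairPoly (σ : Ω →+* Ω) _ _
  rw [map_mul, map_mul, map_intCast, h2, h.apply_s_mul_s, h1, sgn_add (evenRep w i + evenRep w k),
    Int.cast_mul]
  ring

/-! ### The splitting field of the polynomial of degree sixteen -/

instance isGalois_algebraicClosure_rat : IsGalois ℚ (AlgebraicClosure ℚ) :=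
  have : Normal ℚ (AlgebraicClosure ℚ) :=
    @IsAlgClosure.normal ℚ (AlgebraicClosure ℚ) _ _ (AlgebraicClosure.instAlgebra ℚ) inferInstance
  ⟨⟩

lemma card_roots_mod_641 :
    ((Finset.range 641).filter fun c : ℕ => ((641 : ℕ) : ℤ) ∣ sextic (c : ℤ)).card = 6 := by
  unfold sextic
  decide +kernel

lemma sexticUnit_mod_641 : ((641 : ℕ) : ℤ) ∣ sextic 210 ∧ ((641 : ℕ) : ℤ) ∣ sextic 367 ∧
    ∀ c : Fin 641, ¬ ((641 : ℕ) : ℤ) ∣ ((c : ℕ) : ℤ) ^ 2 - sexticUnit 210 * sexticUnit 367 := by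
  unfold sextic sexticUnit
  decide +kernel

/-- A Frobenius element at `641` fixes the roots of the sextic but not all products of two square
roots of the unit: modulo `641` the sextic has six roots, and the unit takes a nonsquare value at
one of them and a nonzero square value at another. -/
lemma IsSexticRoots.exists_moving_sqrt {Ω : Type} [Field Ω] [CharZero Ω] [IsGalois ℚ Ω]
    {θ s : Fin 6 → Ω} (h : IsSexticRoots θ) (hs : ∀ i, s i ^ 2 = sexticUnit (θ i)) :
    ∃ σ : Ω ≃ₐ[ℚ] Ω, (∀ i, σ (θ i) = θ i) ∧ ∃ i j, σ (s i * s j) ≠ s i * s j := by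
  have : Fact (Nat.Prime 641) := ⟨by norm_num⟩
  obtain ⟨k, _, _, r, σ, hσ⟩ := exists_frobenius Ω 641
  obtain ⟨π, -, hπ⟩ := h.exists_perm σ
  have h1 := h.card_fixed 641 (by norm_num) r σ hσ hπ
  rw [card_roots_mod_641] at h1
  have h2 := Finset.filter_eq_self.mp (Finset.eq_univ_of_card _ (h1.trans (Fintype.card_fin 6).symm))
  refine ⟨σ, fun i => by rw [hπ, h2 i (Finset.mem_univ i)], ?_⟩
  by_contra! hfix
  have hroot : ∀ c : ℤ, ((641 : ℕ) : ℤ) ∣ sextic c → ∃ i, (c : k) = r (h.toInt i) := fun c hc => by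
    have h3 := h.sextic_intCast_reduction r c
    rw [sextic_intCast, (CharP.intCast_eq_zero_iff k 641 _).mpr hc] at h3
    obtain ⟨i, -, hi⟩ := Finset.prod_eq_zero_iff.mp h3.symm
    exact ⟨i, sub_eq_zero.mp hi⟩
  obtain ⟨hr1, hr2, hns⟩ := sexticUnit_mod_641
  obtain ⟨i, hi⟩ := hroot 210 hr1
  obtain ⟨j, hj⟩ := hroot 367 hr2
  have hu2 : (s i * s j) ^ 2 = ((sexticUnit (h.toInt i) * sexticUnit (h.toInt j) :
      integralClosure ℤ Ω) : Ω) := by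
    have e : ∀ i, sexticUnit (θ i) = ((sexticUnit (h.toInt i) : integralClosure ℤ Ω) : Ω) :=
      fun i => (map_sexticUnit (integralClosure ℤ Ω).val.toRingHom (h.toInt i)).symm
    rw [mul_pow, hs, hs, e, e]
    rfl
  have hint : IsIntegral ℤ (s i * s j) :=
    IsIntegral.of_pow (n := 2) (by norm_num) (by rw [hu2]; exact Subtype.property _)
  let u : integralClosure ℤ Ω := ⟨s i * s j, hint⟩
  have hu : u ^ 2 = sexticUnit (h.toInt i) * sexticUnit (h.toInt j) := Subtype.ext hu2
  obtain ⟨c, hc, hcu⟩ := exists_natCast_eq 641 (hσ u u (hfix i j).symm).symm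
  refine hns ⟨c, hc⟩ ?_
  rw [← CharP.intCast_eq_zero_iff k 641]
  have h4 := congrArg r hu
  rw [map_pow, ← hcu, map_mul, map_sexticUnit, map_sexticUnit, ← hi, ← hj, sexticUnit_intCast,
    sexticUnit_intCast] at h4
  push_cast
  rw [h4, sub_self]

lemma isSqrtTower_of_sq {Ω : Type} [Field Ω] [CharZero Ω] {θ s : Fin 6 → Ω} (h : IsSexticRoots θ)
    (f : Fin 6 → Ω) (hs : ∀ i, s i ^ 2 = f i)
    (hf : ∀ (σ : Ω ≃ₐ[ℚ] Ω) (π : Equiv.Perm (Fin 6)), (∀ i, σ (θ i) = θ (π i)) →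
      ∀ i, σ (f i) = f (π i))
    (hne : ∀ i, s i ≠ 0) (hprod : ∀ σ : Ω ≃ₐ[ℚ] Ω, σ (∏ i, s i) = ∏ i, s i) :
    IsSqrtTower θ s where
  inj := h.inj
  ne_zero := hne
  exists_perm σ := by
    obtain ⟨π, hπ, e⟩ := h.exists_perm σ
    refine ⟨π, hπ, fun i => ⟨e i, sq_eq_sq_iff_eq_or_eq_neg.mp ?_⟩⟩
    rw [← map_pow, hs, hs, hf σ π e]
  prod := hprod

lemma natDegree_poly16 : poly16.natDegree = 16 := by
  unfold poly16
  compute_degree!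

/-- There are six numbers and square roots on which the absolute Galois group acts through all of
`T1654` and for which the sixteen numbers `bigRoot` are distinct multiples by `736` of roots of
`poly16`. -/
theorem exists_sqrtTower_bigRoot (Ω : Type) [Field Ω] [CharZero Ω] [IsAlgClosed Ω]
    [IsGalois ℚ Ω] : ∃ (θ s : Fin 6 → Ω) (h : IsSqrtTower θ s), Function.Surjective h.hom ∧
      Function.Injective (bigRoot θ s) ∧ ∀ w, scaledPoly (bigRoot θ s w) = 0 := by
  let κ : ℤ_[94057] →+* AlgebraicClosure ℚ_[94057] :=
    (algebraMap ℚ_[94057] _).comp PadicInt.Coe.ringHom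
  have hκ : Function.Injective κ := (algebraMap ℚ_[94057] _).injective.comp Subtype.val_injective
  let j : Ω →+* AlgebraicClosure ℚ_[94057] := (IsAlgClosed.lift : Ω →ₐ[ℚ] _).toRingHom
  let ι : Ω →+* ℂ := (IsAlgClosed.lift : Ω →ₐ[ℚ] ℂ).toRingHom
  obtain ⟨θ, s, T, S, hθ, hs, hprod, hjθ, hjs, hT, hS⟩ := exists_sexticRoots Ω κ hκ j ι
  have ht : IsSqrtTower θ s := by
    refine isSqrtTower_of_sq hθ _ hs (fun σ π e i => ?_) (fun i hi => ?_) (fun σ => ?_)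
    · rw [← e]
      exact map_sexticUnit (σ : Ω →+* Ω) _
    · rw [Finset.prod_eq_zero (Finset.mem_univ i) hi] at hprod
      exact zero_ne_one hprod
    · rw [hprod, map_one]
  have hsurj : Function.Surjective ht.hom := by
    obtain ⟨σ, hσ, i, k, hik⟩ := hθ.exists_moving_sqrt hs
    refine ht.hom_surjective (fun ρ hρ => ?_) hσ hik
    obtain ⟨σ, hσ⟩ := hθ.exists_auto hρ
    exact ⟨σ, ht.perm_eq σ hσ⟩
  have hjb : ∀ w, j (bigRoot θ s w) = κ (bigRoot T S w) := fun w => by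
    have h1 := map_bigRoot j θ s w
    have h2 : j ∘ θ = κ ∘ T := funext hjθ
    have h3 : j ∘ s = κ ∘ S := funext hjs
    rw [h2, h3, ← map_bigRoot] at h1
    exact h1
  have hred : ∀ w, PadicInt.toZModPow 40 (bigRoot T S w) =
      (bigRoot rootApprox sqrtApprox w : ℤ) := fun w => by
    have h2 : PadicInt.toZModPow 40 ∘ T = Int.castRingHom (ZMod (94057 ^ 40)) ∘ rootApprox :=
      funext hT
    have h3 : PadicInt.toZModPow 40 ∘ S = Int.castRingHom (ZMod (94057 ^ 40)) ∘ sqrtApprox :=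
      funext hS
    rw [map_bigRoot, h2, h3, ← map_bigRoot]
    rfl
  have hinj : Function.Injective (bigRoot θ s) := fun v w hvw => by
    have h1 : bigRoot T S v = bigRoot T S w := hκ (by rw [← hjb, ← hjb, hvw])
    have h2 := hred v
    rw [h1, hred w] at h2
    refine bigRoot_distinct v w ((dvd_pow_self (94057 : ℤ) (by norm_num : 40 ≠ 0)).trans ?_)
    have h5 := (ZMod.intCast_eq_intCast_iff_dvd_sub _ _ _).mp h2
    exact_mod_cast h5
  have hfix : ∀ w, scaledPoly (bigRoot θ s w) = 0 := by
    -- the product over all points is a rational integer divisible by a high power of `94057`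
    have hmap : ∀ (σ : Ω ≃ₐ[ℚ] Ω) w, σ (scaledPoly (bigRoot θ s w)) =
        scaledPoly (bigRoot θ s (ht.hom σ • w)) := fun σ w => by
      rw [← ht.apply_bigRoot]
      exact map_scaledPoly (σ : Ω →+* Ω) _
    have hp : ∏ w, scaledPoly (bigRoot θ s w) = 0 := by
      refine eq_zero_of_fixed (p := 94057) (40 * 16) κ hκ j ι ?_ (fun σ => ?_) ?_
        (y := ∏ w, scaledPoly (bigRoot T S w)) ?_ ?_
      · have hsi : ∀ i, IsIntegral ℤ (s i) := fun i => by
          refine IsIntegral.of_pow (n := 2) (by norm_num) ?_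
          rw [hs]
          have e := map_sexticUnit (integralClosure ℤ Ω).val.toRingHom (hθ.toInt i)
          have e' : sexticUnit (θ i) =
            ((sexticUnit (hθ.toInt i) : integralClosure ℤ Ω) : Ω) := e.symm
          rw [e']
          exact Subtype.property _
        refine prod_mem (S := integralClosure ℤ Ω) fun w _ => ?_
        have e := map_scaledPoly (integralClosure ℤ Ω).val.toRingHom
          (bigRoot hθ.toInt (fun i => ⟨s i, hsi i⟩) w)
        have e2 := map_bigRoot (integralClosure ℤ Ω).val.toRingHom hθ.toInt (fun i => ⟨s i, hsi i⟩) w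
        rw [e2] at e
        have e' : ((scaledPoly (bigRoot hθ.toInt (fun i => ⟨s i, hsi i⟩) w) :
          integralClosure ℤ Ω) : Ω) = scaledPoly (bigRoot θ s w) := e
        rw [← e']
        exact Subtype.property _
      · rw [map_prod]
        refine (Finset.prod_congr rfl fun w _ => hmap σ w).trans ?_
        exact Equiv.prod_comp (MulAction.toPerm (ht.hom σ))
          (fun w => scaledPoly (bigRoot θ s w))
      · rw [map_prod, norm_prod]
        have hb : ∀ w, ‖ι (scaledPoly (bigRoot θ s w))‖ ≤ 10 ^ 198 := fun w => by
          rw [map_scaledPoly, map_bigRoot]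
          refine norm_scaledPoly_le (norm_bigRoot_le (fun i => ?_) (fun i => ?_) w)
          · rw [Function.comp_apply, ← map_sextic, hθ.root, map_zero]
          · rw [Function.comp_apply, Function.comp_apply, ← map_pow, hs, map_sexticUnit]
        calc _ ≤ ∏ _w : Pt, (10 ^ 198 : ℝ) :=
              Finset.prod_le_prod (fun w _ => norm_nonneg _) fun w _ => hb w
          _ = (10 ^ 198) ^ 16 := by
              rw [Finset.prod_const, Finset.card_univ, ← Nat.card_eq_fintype_card, card_pt]
          _ < ((94057 : ℕ) ^ 40) ^ 16 := by
              refine pow_lt_pow_left₀ ?_ (by positivity) (by norm_num)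
              norm_num
          _ = _ := (pow_mul _ _ _).symm
      · rw [map_prod, map_prod]
        refine Finset.prod_congr rfl fun w _ => ?_
        rw [map_scaledPoly, map_scaledPoly, hjb]
      · have hd : ∀ w, (94057 ^ 40 : ℤ_[94057]) ∣ scaledPoly (bigRoot T S w) := fun w => by
          have h1 : PadicInt.toZModPow 40 (scaledPoly (bigRoot T S w)) = 0 := by
            have h2 := map_scaledPoly (Int.castRingHom (ZMod (94057 ^ 40)))
              (bigRoot rootApprox sqrtApprox w)
            rw [map_scaledPoly, hred]
            exact h2.symm.trans (intCast_zmod_eq_zero (sqrtApprox_bigRoot w))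
          rw [← RingHom.mem_ker, PadicInt.ker_toZModPow, Ideal.mem_span_singleton] at h1
          exact_mod_cast h1
        rw [← RingHom.mem_ker, PadicInt.ker_toZModPow, Ideal.mem_span_singleton]
        have h1 := Finset.prod_dvd_prod_of_dvd (s := (Finset.univ : Finset Pt)) _ _
          fun w _ => hd w
        rw [Finset.prod_const, Finset.card_univ, ← Nat.card_eq_fintype_card, card_pt,
          ← pow_mul] at h1
        exact_mod_cast h1
    obtain ⟨v, -, hv⟩ := Finset.prod_eq_zero_iff.mp hp
    intro w
    obtain ⟨g, hg⟩ := MulAction.exists_smul_eq T1654 v w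
    obtain ⟨σ, rfl⟩ := hsurj g
    rw [← hg, ← hmap, hv, map_zero]
  exact ⟨θ, s, ht, hsurj, hinj, hfix⟩

/-- The splitting field of a polynomial, as the field generated by the roots of the polynomial in
an algebraically closed field. -/
lemma exists_splittingField_embedding (Ω : Type) [Field Ω] [CharZero Ω] [IsAlgClosed Ω] (P : ℚ[X])
    (hP : P ≠ 0) : ∃ f : P.SplittingField →+* Ω, (∀ x : Ω, aeval x P = 0 → ∃ y, f y = x) ∧
      ∀ σ : Ω ≃ₐ[ℚ] Ω, (∀ x : Ω, aeval x P = 0 → σ x = x) → ∀ y, σ (f y) = f y := by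
  let f : P.SplittingField →ₐ[ℚ] Ω := Polynomial.SplittingField.lift P (IsAlgClosed.splits _)
  refine ⟨f.toRingHom, fun x hx => ?_, fun σ hσ y => ?_⟩
  · have h1 : x ∈ P.rootSet Ω := (Polynomial.mem_rootSet_of_ne hP).mpr hx
    rw [← (Polynomial.SplittingField.splits P).image_rootSet f] at h1
    obtain ⟨y, -, hy⟩ := h1
    exact ⟨y, hy⟩
  · have h1 : (σ : Ω →ₐ[ℚ] Ω).comp f = f := by
      refine AlgHom.ext_of_adjoin_eq_top (Polynomial.SplittingField.adjoin_rootSet P) ?_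
      intro y hy
      have h2 : f y ∈ P.rootSet Ω := by
        rw [← (Polynomial.SplittingField.splits P).image_rootSet f]
        exact ⟨y, hy, rfl⟩
      exact hσ (f y) ((Polynomial.mem_rootSet_of_ne hP).mp h2)
    exact DFunLike.congr_fun h1 y

/-- The splitting field of `poly16` is generated by the numbers `bigRoot`, and an automorphism that
fixes these numbers acts trivially on the sixteen points. -/
theorem realizesPair_splittingField :
    RealizesPair (a5Sub 0) (a5Sub 1) poly16.SplittingField := by
  let Ω := AlgebraicClosure ℚ
  obtain ⟨θ, s, ht, hsurj, hinj, hfix⟩ := exists_sqrtTower_bigRoot Ω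
  have hroot : ∀ w, aeval (bigRoot θ s w / 736) poly16 = 0 := fun w => by
    have h1 := eval_poly16 (bigRoot θ s w)
    rw [hfix] at h1
    exact (mul_eq_zero.mp h1).resolve_left (by norm_num)
  have hne : poly16 ≠ 0 := fun h0 => by
    have := natDegree_poly16
    rw [h0] at this
    norm_num at this
  have hall : ∀ x : Ω, aeval x poly16 = 0 → ∃ w, x = bigRoot θ s w / 736 := fun x hx => by
    classical
    have hinj' : Function.Injective fun w => bigRoot θ s w / 736 := fun v w hvw =>
      hinj ((div_left_inj' (by norm_num)).mp hvw)
    have h1 : Finset.univ.image (fun w => bigRoot θ s w / 736) =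
        (poly16.aroots Ω).toFinset := by
      refine Finset.eq_of_subset_of_card_le (fun y hy => ?_) ?_
      · obtain ⟨w, -, rfl⟩ := Finset.mem_image.mp hy
        rw [Multiset.mem_toFinset, Polynomial.mem_aroots]
        exact ⟨hne, hroot w⟩
      · rw [Finset.card_image_of_injective _ hinj', Finset.card_univ,
          ← Nat.card_eq_fintype_card, card_pt]
        exact (Multiset.toFinset_card_le _).trans
          ((Polynomial.card_roots' _).trans (by rw [Polynomial.natDegree_map, natDegree_poly16]))
    have h2 : x ∈ (poly16.aroots Ω).toFinset := by
      rw [Multiset.mem_toFinset, Polynomial.mem_aroots]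
      exact ⟨hne, hx⟩
    rw [← h1] at h2
    obtain ⟨w, -, hw⟩ := Finset.mem_image.mp h2
    exact ⟨w, hw.symm⟩
  have : NumberField poly16.SplittingField := ⟨⟩
  obtain ⟨f, hf1, hf2⟩ := exists_splittingField_embedding Ω poly16 hne
  let _ : Algebra poly16.SplittingField Ω := f.toAlgebra
  obtain ⟨hG, ⟨φ⟩⟩ := ht.exists_mulEquiv hsurj poly16.SplittingField fun σ => by
    rw [RingHom.algebraMap_toAlgebra]
    have hdiv : ∀ w, σ (bigRoot θ s w / 736) = bigRoot θ s (ht.hom σ • w) / 736 := fun w => by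
      rw [map_div₀, map_ofNat, ht.apply_bigRoot]
    constructor
    · intro hσ
      refine Subtype.ext (Equiv.ext fun w => hinj ?_)
      obtain ⟨y, hy⟩ := hf1 _ (hroot w)
      have h2 := hσ y
      rw [hy, hdiv, div_left_inj' (by norm_num)] at h2
      exact h2
    · intro hσ
      refine hf2 σ fun x hx => ?_
      obtain ⟨w, rfl⟩ := hall x hx
      rw [hdiv, hσ, one_smul]
  exact realizesPair_of_mulEquiv _ φ

/-! ### Embedding number fields in p-adic fields -/

/-- A nonconstant polynomial has values divisible by primes outside any finite set. -/
lemma exists_prime_dvd_eval {G : ℤ[X]} (hG : 0 < G.natDegree) {m : ℤ} (hm : m ≠ 0) :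
    ∃ (p : ℕ) (n : ℤ), p.Prime ∧ ¬ (p : ℤ) ∣ m ∧ (p : ℤ) ∣ G.eval n := by
  set a := G.eval 0 with ha
  by_cases h0 : a = 0
  · obtain ⟨p, hp, hpp⟩ := Nat.exists_infinite_primes (m.natAbs + 1)
    refine ⟨p, 0, hpp, fun h => ?_, by rw [← ha, h0]; exact dvd_zero _⟩
    have := Nat.le_of_dvd (Int.natAbs_pos.mpr hm) (Int.natCast_dvd.mp h)
    omega
  · have hfin : ∀ c : ℤ, {x : ℤ | G.eval (a * m * x) = c}.Finite := fun c => by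
      have hne : G - C c ≠ 0 := fun h => by
        rw [sub_eq_zero.mp h, Polynomial.natDegree_C] at hG
        exact lt_irrefl _ hG
      refine ((G - C c).roots.toFinset.finite_toSet.preimage (f := fun x => a * m * x)
        (fun x _ y _ h => mul_left_cancel₀ (mul_ne_zero h0 hm) h)).subset fun x hx => ?_
      rw [Set.mem_preimage, Finset.mem_coe, Multiset.mem_toFinset, Polynomial.mem_roots hne]
      simpa [sub_eq_zero] using hx
    obtain ⟨x, hx⟩ := ((hfin a).union (hfin (-a))).infinite_compl.nonempty
    have hx1 : G.eval (a * m * x) ≠ a := fun h => hx (Or.inl h)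
    have hx2 : G.eval (a * m * x) ≠ -a := fun h => hx (Or.inr h)
    obtain ⟨k, hk⟩ := Polynomial.sub_dvd_eval_sub (a * m * x) 0 G
    have hv : G.eval (a * m * x) = a * (1 + m * x * k) := by
      rw [← ha] at hk
      linear_combination hk
    have hw : (1 + m * x * k).natAbs ≠ 1 := fun h => by
      rcases Int.natAbs_eq_iff.mp h with e | e
      · exact hx1 (by rw [hv, e]; simp)
      · exact hx2 (by rw [hv, e]; simp)
    obtain ⟨p, hp, hpd⟩ := Nat.exists_prime_and_dvd hw
    have hpd' := Int.natCast_dvd.mpr hpd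
    refine ⟨p, a * m * x, hp, fun h => ?_, hv ▸ dvd_mul_of_dvd_right hpd' a⟩
    have h1 : (p : ℤ) ∣ 1 := by
      have := dvd_sub hpd' (dvd_mul_of_dvd_left (dvd_mul_of_dvd_left h x) k)
      simpa using this
    exact hp.one_lt.ne' (by exact_mod_cast Int.eq_one_of_dvd_one (by positivity) h1)

lemma exists_int_polynomial (P : ℚ[X]) :
    ∃ (Q : ℤ[X]) (b : ℤ), b ≠ 0 ∧ Q.map (Int.castRingHom ℚ) = C (b : ℚ) * P := by
  obtain ⟨b, hb, h⟩ := IsLocalization.integerNormalization_spec (nonZeroDivisors ℤ) P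
  refine ⟨_, b, nonZeroDivisors.ne_zero hb, h.trans ?_⟩
  ext n
  simp

/-- A number field embeds in `ℚ_p` for primes `p` outside any finite set: this holds if a defining
polynomial has a simple zero modulo `p`. -/
lemma exists_padic_embedding (M : Type) [Field M] [NumberField M] {m : ℤ} (hm : m ≠ 0) :
    ∃ (p : ℕ) (_ : Fact p.Prime), ¬ (p : ℤ) ∣ m ∧ Nonempty (M →+* ℚ_[p]) := by
  let B := Field.powerBasisOfFiniteOfSeparable ℚ M
  set g := minpoly ℚ B.gen with hg
  have hirr : Irreducible g := minpoly.irreducible B.isIntegral_gen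
  obtain ⟨u, v, huv⟩ := hirr.separable
  obtain ⟨G, b, hb, hG⟩ := exists_int_polynomial g
  obtain ⟨U, b₁, hb₁, hU⟩ := exists_int_polynomial u
  obtain ⟨V, b₂, hb₂, hV⟩ := exists_int_polynomial v
  have hbez : C b₂ * U * G + C b₁ * V * derivative G = C (b₁ * b₂ * b) := by
    apply Polynomial.map_injective (Int.castRingHom ℚ) Int.cast_injective
    have hC : ∀ c : ℤ, (C c).map (Int.castRingHom ℚ) = C (c : ℚ) := fun c => Polynomial.map_C _
    simp only [Polynomial.map_add, Polynomial.map_mul, hC, hU, hV, hG,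
      ← Polynomial.derivative_map, Polynomial.derivative_C_mul, C_mul]
    linear_combination (C (b₁ : ℚ) * C (b₂ : ℚ) * C (b : ℚ)) * huv
  have hGdeg : 0 < G.natDegree := by
    rw [← Polynomial.natDegree_map_eq_of_injective (f := Int.castRingHom ℚ) Int.cast_injective, hG,
      Polynomial.natDegree_C_mul (by exact_mod_cast hb)]
    exact hirr.natDegree_pos
  obtain ⟨p, n, hp, hpm, hpn⟩ := exists_prime_dvd_eval hGdeg
    (mul_ne_zero hm (mul_ne_zero (mul_ne_zero hb₁ hb₂) hb))
  have hfact := Fact.mk hp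
  refine ⟨p, hfact, fun h => hpm (dvd_mul_of_dvd_left h _), ?_⟩
  have hd : ¬ (p : ℤ) ∣ (derivative G).eval n := fun h => by
    refine hpm (dvd_mul_of_dvd_right ?_ m)
    have h1 := congrArg (Polynomial.eval n) hbez
    simp only [Polynomial.eval_add, Polynomial.eval_mul, Polynomial.eval_C] at h1
    rw [← h1]
    exact dvd_add (dvd_mul_of_dvd_right hpn _) (dvd_mul_of_dvd_right h _)
  obtain ⟨z, hz, -⟩ := exists_root_of_approx (p := p) one_ne_zero (G.map (Int.castRingHom ℤ_[p]))
    (a := n) (by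
      rw [Polynomial.eval_intCast_map]
      exact toZModPow_intCast_eq_zero p 1 (by rwa [pow_one])) (by
      rw [Polynomial.derivative_map, Polynomial.eval_intCast_map]
      exact isUnit_intCast hd)
  have hroot : aeval (z : ℚ_[p]) g = 0 := by
    have h1 : (G.map (Int.castRingHom ℚ)).eval₂ (algebraMap ℚ ℚ_[p]) (z : ℚ_[p]) = 0 := by
      have h2 := congrArg (PadicInt.Coe.ringHom (p := p)) hz
      rw [Polynomial.eval_map, Polynomial.hom_eval₂, map_zero] at h2
      have e : (algebraMap ℚ ℚ_[p]).comp (Int.castRingHom ℚ) =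
        (PadicInt.Coe.ringHom (p := p)).comp (Int.castRingHom ℤ_[p]) := RingHom.ext_int _ _
      rw [Polynomial.eval₂_map, e]
      exact h2
    rw [hG, Polynomial.eval₂_mul, Polynomial.eval₂_C] at h1
    refine (mul_eq_zero.mp h1).resolve_left ?_
    simpa using hb
  exact ⟨(B.lift (z : ℚ_[p]) hroot).toRingHom⟩

/-- Algebraic integers are mapped to `p`-adic integers. -/
lemma norm_le_one_of_isIntegral {M : Type} [Field M] {p : ℕ} [Fact p.Prime] (j : M →+* ℚ_[p])
    {x : M} (hx : IsIntegral ℤ x) : ‖j x‖ ≤ 1 := by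
  have h1 : IsIntegral ℤ (j x) := hx.map j.toIntAlgHom
  have h2 : IsIntegral ℤ_[p] (j x) := h1.tower_top
  obtain ⟨y, hy⟩ := IsIntegrallyClosed.algebraMap_eq_of_integral h2
  rw [← hy]
  exact PadicInt.norm_le_one y

/-- Finitely many nonzero algebraic integers become units in a suitable `ℚ_p`. -/
lemma exists_padic_embedding_norm_eq_one (M : Type) [Field M] [NumberField M] {ι : Type*}
    [Fintype ι] {x : ι → M} (hx : ∀ i, IsIntegral ℤ (x i)) (h0 : ∀ i, x i ≠ 0) :
    ∃ (p : ℕ) (_ : Fact p.Prime) (j : M →+* ℚ_[p]), ∀ i, ‖j (x i)‖ = 1 := by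
  have hE : ∏ i, x i ≠ 0 := Finset.prod_ne_zero_iff.mpr fun i _ => h0 i
  have hEinv : IsAlgebraic ℤ (∏ i, x i)⁻¹ :=
    (IsAlgebraic.inv_iff).mpr (IsIntegral.prod _ fun i _ => hx i).isAlgebraic
  obtain ⟨m, hm, hint⟩ := hEinv.exists_integral_multiple
  obtain ⟨p, hp, hpm, ⟨j⟩⟩ := exists_padic_embedding M hm
  refine ⟨p, hp, j, fun i => le_antisymm (norm_le_one_of_isIntegral j (hx i)) ?_⟩
  have h1 : ‖j (m • (∏ i, x i)⁻¹)‖ * ‖j (∏ i, x i)‖ = 1 := by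
    rw [← norm_mul, ← map_mul, smul_mul_assoc, inv_mul_cancel₀ hE, zsmul_one, map_intCast]
    exact (lt_or_eq_of_le (Padic.norm_int_le_one m)).resolve_left fun h =>
      hpm (Padic.norm_intCast_lt_one_iff.mp h)
  have h2 := norm_le_one_of_isIntegral j hint
  have h3 : ‖j (∏ i, x i)‖ ≤ ‖j (x i)‖ := by
    classical
    rw [← Finset.mul_prod_erase _ _ (Finset.mem_univ i), map_mul, norm_mul]
    exact mul_le_of_le_one_right (norm_nonneg _) (norm_le_one_of_isIntegral j
      (IsIntegral.prod _ fun i _ => hx i))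
  nlinarith [norm_nonneg (j (∏ i, x i)), norm_nonneg (j (x i))]

/-! ### Infinitely many fields -/

/-- The product of the numbers `t - (θ i + θ c)` over all `c ≠ i`. -/
def pairProd {R : Type*} [CommRing R] (θ : Fin 6 → R) (t : R) (i : Fin 6) : R :=
  ∏ c, if c = i then 1 else t - (θ i + θ c)

lemma prod_zero_mul_prod_one {R : Type*} [CommRing R] {g : Fin 6 → Fin 6 → R}
    (hg : g 1 0 = g 0 1) :
    (∏ c, if c = 0 then 1 else g 0 c) * (∏ c, if c = 1 then 1 else g 1 c) =
      g 0 2 * (g 0 1 ^ 2 * g 0 3 * g 0 4 * g 0 5 * g 1 2 * g 1 3 * g 1 4 * g 1 5) := by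
  simp only [Fin.prod_univ_six, Fin.reduceEq, if_true, if_false]
  rw [hg]
  ring

lemma pairProd_zero_mul_one {R : Type*} [CommRing R] (θ : Fin 6 → R) (t : R) :
    pairProd θ t 0 * pairProd θ t 1 = (t - (θ 0 + θ 2)) *
      ((t - (θ 0 + θ 1)) ^ 2 * (t - (θ 0 + θ 3)) * (t - (θ 0 + θ 4)) * (t - (θ 0 + θ 5)) *
        (t - (θ 1 + θ 2)) * (t - (θ 1 + θ 3)) * (t - (θ 1 + θ 4)) * (t - (θ 1 + θ 5))) :=
  prod_zero_mul_prod_one (g := fun a b => t - (θ a + θ b)) (by rw [add_comm (θ 1)])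

lemma prod_symm_eq_sq {R : Type*} [CommRing R] {g : Fin 6 → Fin 6 → R}
    (hg : ∀ a b, g a b = g b a) : ∏ i, ∏ c, (if c = i then 1 else g i c) =
      (g 0 1 * (g 0 2 * (g 0 3 * (g 0 4 * (g 0 5 * (g 1 2 * (g 1 3 * (g 1 4 * (g 1 5 *
        (g 2 3 * (g 2 4 * (g 2 5 * (g 3 4 * (g 3 5 * g 4 5)))))))))))))) ^ 2 := by
  simp only [Fin.prod_univ_six, Fin.reduceEq, if_true, if_false]
  rw [hg 1 0, hg 2 0, hg 3 0, hg 4 0, hg 5 0, hg 2 1, hg 3 1, hg 4 1, hg 5 1, hg 3 2, hg 4 2,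
    hg 5 2, hg 4 3, hg 5 3, hg 5 4]
  ring

/-- Each of the fifteen pair sums occurs in two of the six products. -/
lemma prod_pairProd {R : Type*} [CommRing R] (θ : Fin 6 → R) (t : R) :
    ∏ i, pairProd θ t i =
      (∏ p ∈ Finset.powersetCard 2 Finset.univ, (t - ∑ a ∈ p, θ a)) ^ 2 := by
  have h : Finset.powersetCard 2 (Finset.univ : Finset (Fin 6)) =
      {{0, 1}, {0, 2}, {0, 3}, {0, 4}, {0, 5}, {1, 2}, {1, 3}, {1, 4}, {1, 5}, {2, 3}, {2, 4},
        {2, 5}, {3, 4}, {3, 5}, {4, 5}} := by decide +kernel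
  have h2 : ∀ a b : Fin 6, a ≠ b → ∑ c ∈ ({a, b} : Finset (Fin 6)), θ c = θ a + θ b :=
    fun a b hab => Finset.sum_pair hab
  rw [h]
  repeat rw [Finset.prod_insert (by decide +kernel)]
  rw [Finset.prod_singleton]
  repeat rw [h2 _ _ (by decide)]
  exact prod_symm_eq_sq (g := fun a b => t - (θ a + θ b)) fun a b => by rw [add_comm (θ a)]

/-- For suitable integers `t`, the product of the first two of the numbers `pairProd` is not a
square in `M`: there is a `p`-adic embedding of `M` in which `t - (θ 0 + θ 2)` has valuation one while
the other factors are units. -/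
lemma exists_not_isSquare (M : Type) [Field M] [NumberField M] {θ : Fin 6 → M}
    (hint : ∀ i, IsIntegral ℤ (θ i)) (hinj : Function.Injective θ)
    (hne : ∀ c, c = 3 ∨ c = 4 ∨ c = 5 → θ 0 + θ 2 ≠ θ 1 + θ c) :
    ∃ t : ℤ, (∀ a c, (t : M) ≠ θ a + θ c) ∧ ¬ IsSquare (pairProd θ t 0 * pairProd θ t 1) := by
  have hd : ∀ {a b : Fin 6}, a ≠ b → θ a - θ b ≠ 0 := fun hab h => hab (hinj (sub_eq_zero.mp h))
  obtain ⟨p, hp, j, hj⟩ := exists_padic_embedding_norm_eq_one M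
    (x := ![θ 2 - θ 1, θ 2 - θ 3, θ 2 - θ 4, θ 2 - θ 5, θ 0 - θ 1, θ 0 + θ 2 - (θ 1 + θ 3),
      θ 0 + θ 2 - (θ 1 + θ 4), θ 0 + θ 2 - (θ 1 + θ 5)])
    (by
      have hs : ∀ a b, IsIntegral ℤ (θ a - θ b) := fun a b => (hint a).sub (hint b)
      have hs' : ∀ c, IsIntegral ℤ (θ 0 + θ 2 - (θ 1 + θ c)) := fun c =>
        ((hint 0).add (hint 2)).sub ((hint 1).add (hint c))
      simp [Fin.forall_fin_succ, hs, hs'])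
    (by
      have hs : ∀ c, c = 3 ∨ c = 4 ∨ c = 5 → θ 0 + θ 2 - (θ 1 + θ c) ≠ 0 := fun c hc h =>
        hne c hc (sub_eq_zero.mp h)
      have h1 := hs 3 (by decide)
      have h2 := hs 4 (by decide)
      have h3 := hs 5 (by decide)
      have h4 := @hd 2 1 (by decide)
      have h5 := @hd 2 3 (by decide)
      have h6 := @hd 2 4 (by decide)
      have h7 := @hd 2 5 (by decide)
      have h8 := @hd 0 1 (by decide)
      simp [Fin.forall_fin_succ, h1, h2, h3, h4, h5, h6, h7, h8])
  have hp1 : (1 : ℝ) < p := by exact_mod_cast hp.out.one_lt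
  have hp0 : (0 : ℝ) < p := by linarith
  obtain ⟨z, hz⟩ : ∃ z : ℤ_[p], (z : ℚ_[p]) = j (θ 0 + θ 2) + p :=
    ⟨⟨j (θ 0 + θ 2) + p, (Padic.nonarchimedean _ _).trans (max_le
      (norm_le_one_of_isIntegral j ((hint 0).add (hint 2)))
      (by rw [Padic.norm_p]; exact inv_le_one_of_one_le₀ hp1.le))⟩, rfl⟩
  -- an integer congruent to `z` modulo `p²` that is none of the pair sums
  obtain ⟨t, ht, htz⟩ : ∃ t : ℤ, (∀ a c, (t : M) ≠ θ a + θ c) ∧ ‖(t - z : ℚ_[p])‖ < (p : ℝ)⁻¹ := by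
    have hfin : (Set.range fun q : Fin 6 × Fin 6 => θ q.1 + θ q.2).Finite := Set.finite_range _
    have hinf : (Set.range fun k : ℕ => ((z.appr 2 + p ^ 2 * k : ℕ) : M)).Infinite := by
      refine Set.infinite_range_of_injective fun k l hkl => ?_
      have h1 := Nat.cast_injective hkl
      exact Nat.eq_of_mul_eq_mul_left (pow_pos hp.out.pos 2) (by simpa using h1)
    obtain ⟨_, ⟨k, rfl⟩, hk⟩ := hinf.exists_notMem_finite hfin
    refine ⟨(z.appr 2 + p ^ 2 * k : ℕ), fun a c e => hk ⟨(a, c), ?_⟩, ?_⟩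
    · exact e.symm.trans (Int.cast_natCast _)
    · have h1 : (((z.appr 2 + p ^ 2 * k : ℕ) : ℤ) : ℤ_[p]) - z ∈
          Ideal.span {(p : ℤ_[p]) ^ 2} := by
        have h2 := PadicInt.appr_spec 2 z
        have h3 := Ideal.mul_mem_right (k : ℤ_[p]) _ (Ideal.mem_span_singleton_self ((p : ℤ_[p]) ^ 2))
        have h4 := sub_mem h3 h2
        convert h4 using 1
        push_cast
        ring
      rw [← PadicInt.norm_le_pow_iff_mem_span_pow] at h1
      have h2 : ‖((((z.appr 2 + p ^ 2 * k : ℕ) : ℤ) : ℤ_[p]) - z : ℤ_[p])‖ < (p : ℝ)⁻¹ := by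
        refine h1.trans_lt ?_
        rw [← zpow_neg_one]
        exact zpow_lt_zpow_right₀ hp1 (by norm_num)
      rw [PadicInt.norm_def] at h2
      simpa using h2
  refine ⟨t, ht, ?_⟩
  have hu : ‖j (t - (θ 0 + θ 2))‖ = (p : ℝ)⁻¹ := by
    have e : j (t - (θ 0 + θ 2)) = (t - z : ℚ_[p]) + p := by
      rw [hz]
      simp only [map_sub, map_add, map_intCast]
      ring
    rw [e, Padic.add_eq_max_of_ne (by rw [Padic.norm_p]; exact htz.ne), Padic.norm_p]
    exact max_eq_right htz.le
  have hu1 : ∀ a c : Fin 6, ‖j (θ 0 + θ 2 - (θ a + θ c))‖ = 1 → ‖j (t - (θ a + θ c))‖ = 1 :=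
    fun a c h => by
      have e : j (t - (θ a + θ c)) = j (t - (θ 0 + θ 2)) + j (θ 0 + θ 2 - (θ a + θ c)) := by
        rw [← map_add]
        congr 1
        ring
      have hlt : (p : ℝ)⁻¹ < 1 := inv_lt_one_of_one_lt₀ hp1
      rw [e, Padic.add_eq_max_of_ne (by rw [hu, h]; exact hlt.ne), hu, h]
      exact max_eq_right hlt.le
  simp only [Fin.forall_fin_succ, Matrix.cons_val_zero, Matrix.cons_val_succ, IsEmpty.forall_iff,
    and_true] at hj
  obtain ⟨j1, j2, j3, j4, j5, j6, j7, j8⟩ := hj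
  have hnorm : ‖j (pairProd θ t 0 * pairProd θ t 1)‖ = (p : ℝ)⁻¹ := by
    rw [pairProd_zero_mul_one]
    simp only [map_mul, map_pow, norm_mul, norm_pow]
    rw [hu, hu1 0 1 (by rw [← j1]; congr 2; ring), hu1 0 3 (by rw [← j2]; congr 2; ring),
      hu1 0 4 (by rw [← j3]; congr 2; ring), hu1 0 5 (by rw [← j4]; congr 2; ring),
      hu1 1 2 (by rw [← j5]; congr 2; ring), hu1 1 3 j6, hu1 1 4 j7, hu1 1 5 j8]
    norm_num
  rintro ⟨y, hy⟩
  rw [hy, map_mul, norm_mul] at hnorm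
  have hy0 : j y ≠ 0 := fun h => by
    rw [h, norm_zero, zero_mul] at hnorm
    exact (inv_pos.mpr hp0).ne hnorm
  rw [Padic.norm_eq_zpow_neg_valuation hy0, ← zpow_add₀ hp0.ne', ← zpow_neg_one] at hnorm
  have := zpow_right_injective₀ hp0 hp1.ne' hnorm
  omega

section Family

variable {Ω : Type} [Field Ω] [CharZero Ω]

lemma map_pairProd {θ : Fin 6 → Ω} (t : ℤ) (σ : Ω ≃ₐ[ℚ] Ω) {π : Equiv.Perm (Fin 6)}
    (hπ : ∀ i, σ (θ i) = θ (π i)) (i : Fin 6) :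
    σ (pairProd θ t i) = pairProd θ t (π i) := by
  unfold pairProd
  rw [map_prod, ← Equiv.prod_comp π (fun c => if c = π i then 1 else (t : Ω) - (θ (π i) + θ c))]
  refine Finset.prod_congr rfl fun c _ => ?_
  rw [apply_ite σ, map_one, map_sub, map_add, hπ, hπ, map_intCast]
  by_cases h : c = i
  · rw [if_pos h, if_pos (congrArg π h)]
  · rw [if_neg h, if_neg (π.injective.ne h)]

lemma map_prod_pairSum {θ : Fin 6 → Ω} (t : ℤ) (σ : Ω ≃ₐ[ℚ] Ω) {π : Equiv.Perm (Fin 6)}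
    (hπ : ∀ i, σ (θ i) = θ (π i)) :
    σ (∏ p ∈ Finset.powersetCard 2 Finset.univ, ((t : Ω) - ∑ a ∈ p, θ a)) =
      ∏ p ∈ Finset.powersetCard 2 Finset.univ, ((t : Ω) - ∑ a ∈ p, θ a) := by
  rw [map_prod]
  refine Finset.prod_nbij' (fun p => p.map π.toEmbedding) (fun p => p.map π.symm.toEmbedding)
    (fun p hp => ?_) (fun p hp => ?_) (fun p _ => ?_) (fun p _ => ?_) fun p _ => ?_
  · simpa [Finset.mem_powersetCard] using hp
  · simpa [Finset.mem_powersetCard] using hp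
  · ext; simp
  · ext; simp
  · simp [hπ]

lemma pairProd_ne_zero {θ : Fin 6 → Ω} {t : ℤ} (ht : ∀ a c, (t : Ω) ≠ θ a + θ c) (i : Fin 6) :
    pairProd θ (t : Ω) i ≠ 0 := by
  refine Finset.prod_ne_zero_iff.mpr fun c _ => ?_
  split_ifs
  · exact one_ne_zero
  · exact sub_ne_zero.mpr (ht i c)

/-- Square roots of the numbers `pairProd`, with signs chosen such that their product is the
product of `t` minus the fifteen pair sums. -/
lemma IsSexticRoots.exists_sqrt_pairProd [IsAlgClosed Ω] {θ : Fin 6 → Ω} (h : IsSexticRoots θ)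
    {t : ℤ} (ht : ∀ a c, (t : Ω) ≠ θ a + θ c) :
    ∃ s : Fin 6 → Ω, IsSqrtTower θ s ∧ ∀ i, s i ^ 2 = pairProd θ t i := by
  set R := ∏ p ∈ Finset.powersetCard 2 Finset.univ, ((t : Ω) - ∑ a ∈ p, θ a) with hR
  have h1 : ∀ i, ∃ x : Ω, x ^ 2 = pairProd θ t i := fun i =>
    IsAlgClosed.exists_pow_nat_eq _ (by norm_num)
  choose s hs using h1
  obtain ⟨s', hs', hprod⟩ : ∃ s' : Fin 6 → Ω, (∀ i, s' i ^ 2 = pairProd θ t i) ∧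
      ∏ i, s' i = R := by
    have h2 : (∏ i, s i) ^ 2 = R ^ 2 := by
      rw [← Finset.prod_pow, Finset.prod_congr rfl fun i _ => hs i, prod_pairProd]
    rcases sq_eq_sq_iff_eq_or_eq_neg.mp h2 with e | e
    · exact ⟨s, hs, e⟩
    · refine ⟨Function.update s 0 (-s 0), fun i => ?_, ?_⟩
      · rcases eq_or_ne i 0 with rfl | hi
        · rw [Function.update_self, neg_sq, hs]
        · rw [Function.update_of_ne hi, hs]
      · rw [Fin.prod_univ_succ] at e ⊢
        simp only [Function.update_self, ne_eq, Fin.succ_ne_zero, not_false_eq_true,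
          Function.update_of_ne]
        rw [neg_mul, e, neg_neg]
  refine ⟨s', isSqrtTower_of_sq h (pairProd θ t) hs' (fun σ π => map_pairProd t σ)
    (fun i hi => pairProd_ne_zero ht i ?_) (fun σ => ?_), hs'⟩
  · rw [← hs', hi, zero_pow two_ne_zero]
  · obtain ⟨π, -, hπ⟩ := h.exists_perm σ
    rw [hprod]
    exact map_prod_pairSum t σ hπ

variable [IsGalois ℚ Ω]

/-- A relation `θ 0 + θ 2 = θ 1 + θ c` would remain true after permuting `θ 3, θ 4, θ 5`
cyclically. -/
lemma IsSexticRoots.pairSum_ne {θ : Fin 6 → Ω} (h : IsSexticRoots θ) (c : Fin 6)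
    (hc : c = 3 ∨ c = 4 ∨ c = 5) : θ 0 + θ 2 ≠ θ 1 + θ c := by
  intro e
  obtain ⟨σ, hσ⟩ := h.exists_auto (ρ := Equiv.swap 3 4 * Equiv.swap 4 5)
    (Equiv.Perm.mem_alternatingGroup.mpr (by decide +kernel))
  have h1 := congrArg σ e
  rw [map_add, map_add, hσ, hσ, hσ, hσ] at h1
  have h2 : θ ((Equiv.swap 3 4 * Equiv.swap 4 5 : Equiv.Perm (Fin 6)) c) = θ c := by
    have e0 : (Equiv.swap 3 4 * Equiv.swap 4 5 : Equiv.Perm (Fin 6)) 0 = 0 := by decide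
    have e1 : (Equiv.swap 3 4 * Equiv.swap 4 5 : Equiv.Perm (Fin 6)) 1 = 1 := by decide
    have e2 : (Equiv.swap 3 4 * Equiv.swap 4 5 : Equiv.Perm (Fin 6)) 2 = 2 := by decide
    rw [e0, e1, e2, e] at h1
    exact (add_left_cancel h1).symm
  have h3 := h.inj h2
  revert h3
  rcases hc with rfl | rfl | rfl <;> decide

/-- The field generated by the `θ i` and the products `s i * s j`. -/
lemma realizesPair_of_sqrtTower {θ s : Fin 6 → Ω} (ht : IsSqrtTower θ s)
    (hs : Function.Surjective ht.hom) :
    ∃ L : IntermediateField ℚ Ω, RealizesPair (a5Sub 0) (a5Sub 1) L ∧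
      ∀ i j, s i * s j ∈ L := by
  let S : Set Ω := Set.range θ ∪ Set.range fun q : Fin 6 × Fin 6 => s q.1 * s q.2
  let L := IntermediateField.adjoin ℚ S
  have hθ : ∀ i, θ i ∈ L := fun i => IntermediateField.subset_adjoin ℚ S (Or.inl ⟨i, rfl⟩)
  have hss : ∀ i j, s i * s j ∈ L := fun i j =>
    IntermediateField.subset_adjoin ℚ S (Or.inr ⟨(i, j), rfl⟩)
  have hfin : FiniteDimensional ℚ L :=
    IntermediateField.finiteDimensional_adjoin fun x _ => Algebra.IsIntegral.isIntegral x
  have : NumberField L := { to_finiteDimensional := by convert hfin }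
  obtain ⟨hG, ⟨φ⟩⟩ := ht.exists_mulEquiv hs L fun σ => by
    rw [ht.hom_eq_one_iff]
    refine ⟨fun hσ => ⟨fun i => hσ ⟨_, hθ i⟩, fun i j => hσ ⟨_, hss i j⟩⟩, fun hσ x => ?_⟩
    refine IntermediateField.adjoin_induction ℚ (p := fun y _ => σ y = y) (fun y hy => ?_)
      (fun y => σ.commutes y) (fun y z _ _ hy hz => by rw [map_add, hy, hz])
      (fun y _ hy => by rw [map_inv₀, hy]) (fun y z _ _ hy hz => by rw [map_mul, hy, hz]) x.2
    rcases hy with ⟨i, rfl⟩ | ⟨q, rfl⟩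
    · exact hσ.1 i
    · exact hσ.2 q.1 q.2
  exact ⟨L, realizesPair_of_mulEquiv L φ, hss⟩

variable [IsAlgClosed Ω]

/-- A tower with group `T1654` whose field is not contained in the number field `M`. -/
lemma IsSexticRoots.exists_sqrtTower_notMem {θ : Fin 6 → Ω} (h : IsSexticRoots θ)
    (M : IntermediateField ℚ Ω) [FiniteDimensional ℚ M] (hM : ∀ i, θ i ∈ M) :
    ∃ (s : Fin 6 → Ω) (ht : IsSqrtTower θ s), Function.Surjective ht.hom ∧ s 0 * s 1 ∉ M := by
  have : NumberField M := { to_finiteDimensional := by convert ‹FiniteDimensional ℚ M› }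
  let θ' : Fin 6 → M := fun i => ⟨θ i, hM i⟩
  have hval : Function.Injective (algebraMap M Ω) := (algebraMap M Ω).injective
  obtain ⟨t, ht, hsq⟩ := exists_not_isSquare M (θ := θ')
    (fun i => (isIntegral_algebraMap_iff hval).mp (isIntegral_of_sextic (h.root i)))
    (fun i k e => h.inj (congrArg (algebraMap M Ω) e))
    (fun c hc e => h.pairSum_ne c hc (congrArg (algebraMap M Ω) e))
  obtain ⟨s, hs, hs2⟩ := h.exists_sqrt_pairProd (t := t) fun a c e => ht a c (hval (by
    rw [map_intCast]
    exact e))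
  have hnot : s 0 * s 1 ∉ M := fun hmem => by
    refine hsq ⟨⟨_, hmem⟩, hval ?_⟩
    have e : ∀ i, algebraMap M Ω (pairProd θ' t i) = pairProd θ t i := fun i => by
      unfold pairProd
      rw [map_prod]
      refine Finset.prod_congr rfl fun c _ => ?_
      rw [apply_ite (algebraMap M Ω), map_one, map_sub, map_add, map_intCast]
      rfl
    rw [map_mul, map_mul, e, e, ← hs2, ← hs2]
    change _ = (s 0 * s 1) * (s 0 * s 1)
    ring
  refine ⟨s, hs, ?_, hnot⟩
  have h1 : ∃ σ ∈ M.fixingSubgroup, σ (s 0 * s 1) ≠ s 0 * s 1 := by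
    by_contra! hfix
    refine hnot ?_
    rw [← InfiniteGalois.fixedField_fixingSubgroup M]
    rintro ⟨τ, hτ⟩
    exact hfix τ hτ
  obtain ⟨σ, hσ, hne⟩ := h1
  refine hs.hom_surjective (fun ρ hρ => ?_) (fun i => hσ ⟨θ i, hM i⟩) hne
  obtain ⟨σ, hσ⟩ := h.exists_auto hρ
  exact ⟨σ, hs.perm_eq σ hσ⟩

/-- There is no number field that contains all the fields that realize the pair. -/
theorem infinite_realizesPair :
    {L : IntermediateField ℚ Ω | RealizesPair (a5Sub 0) (a5Sub 1) L}.Infinite := by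
  intro hfin
  let κ : ℤ_[94057] →+* AlgebraicClosure ℚ_[94057] :=
    (algebraMap ℚ_[94057] _).comp PadicInt.Coe.ringHom
  have hκ : Function.Injective κ := (algebraMap ℚ_[94057] _).injective.comp Subtype.val_injective
  obtain ⟨θ, -, -, -, hθ, -⟩ := exists_sexticRoots Ω κ hκ
    (IsAlgClosed.lift : Ω →ₐ[ℚ] _).toRingHom (IsAlgClosed.lift : Ω →ₐ[ℚ] ℂ).toRingHom
  let 𝒮 := {L : IntermediateField ℚ Ω | RealizesPair (a5Sub 0) (a5Sub 1) L}
  have : Finite 𝒮 := hfin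
  have hL : ∀ L : 𝒮, FiniteDimensional ℚ L.1 := fun L => by
    have := L.2.1.to_finiteDimensional
    convert this
  have hK : FiniteDimensional ℚ (IntermediateField.adjoin ℚ (Set.range θ)) :=
    IntermediateField.finiteDimensional_adjoin fun x _ => Algebra.IsIntegral.isIntegral x
  have hM : FiniteDimensional ℚ (⨆ L : 𝒮, L.1 : IntermediateField ℚ Ω) :=
    IntermediateField.finiteDimensional_iSup_of_finite
  obtain ⟨s, ht, hs, hnot⟩ := hθ.exists_sqrtTower_notMem
    (IntermediateField.adjoin ℚ (Set.range θ) ⊔ ⨆ L : 𝒮, L.1) fun i =>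
      le_sup_left (a := IntermediateField.adjoin ℚ (Set.range θ))
        (IntermediateField.subset_adjoin ℚ _ ⟨i, rfl⟩)
  obtain ⟨L, hL, hss⟩ := realizesPair_of_sqrtTower ht hs
  exact hnot (le_sup_right (a := IntermediateField.adjoin ℚ (Set.range θ))
    (le_iSup (fun L : 𝒮 => L.1) ⟨L, hL⟩ (hss 0 1)))

end Family

theorem mainTheorem3 :
    -- the group: transitive of order 5760 on 16 points
    Nat.card Pt = 16 ∧ MulAction.IsPretransitive T1654 Pt ∧ Nat.card T1654 = 5760 ∧
    ∃ H₁ H₂ : Subgroup T1654,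
      -- two nonconjugate subgroups isomorphic to `A₅`, of index 96
      Nonempty (H₁ ≃* alternatingGroup (Fin 5)) ∧
      Nonempty (H₂ ≃* alternatingGroup (Fin 5)) ∧
      ¬ ConjSubgroups H₁ H₂ ∧ H₁.index = 96 ∧ H₂.index = 96 ∧
      -- there are five classes of subgroups `A₅`; those of `H₁` and `H₂` are the only two distinct
      -- ones for which the proper subgroups of the one embed, up to conjugacy, in the other
      (∃ A : Fin 5 → Subgroup T1654, A 0 = H₁ ∧ A 1 = H₂ ∧
        (∀ i, Nonempty (A i ≃* alternatingGroup (Fin 5))) ∧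
        (∀ i j, i ≠ j → ¬ ConjSubgroups (A i) (A j)) ∧
        (∀ H : Subgroup T1654, Nonempty (H ≃* alternatingGroup (Fin 5)) →
          ∃ i, ConjSubgroups H (A i)) ∧
        (∀ i j, i ≠ j →
          ((∀ K < A i, ∃ K' < A j, ConjSubgroups K K') ↔ (i = 0 ∧ j = 1 ∨ i = 1 ∧ j = 0)))) ∧
      -- solvably, but not integrally equivalent
      SolvablyEquivalent H₁ H₂ ∧
      ¬ IntegrallyEquivalent H₁ H₂ ∧
      -- the general homomorphism and its determinant
      (∃ (c : Fin 5 ≃ DoubleCoset.Quotient (H₁ : Set T1654) (H₂ : Set T1654))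
        (e₁ : Fin 96 ≃ T1654 ⧸ H₁) (e₂ : Fin 96 ≃ T1654 ⧸ H₂)
        (Ψ : (Fin 5 → ℤ) ≃+
          (PermModule ℤ H₁ →ₗ[MonoidAlgebra ℤ T1654] PermModule ℤ H₂)),
        (∀ (k : Fin 5) (g : T1654), DoubleCoset.mk H₁ H₂ g = c k →
          (rightCosetsIn H₁ (DoubleCoset.doubleCoset g H₁ H₂)).ncard = cosetCounts k) ∧
        ∀ x : Fin 5 → ℤ,
          (∀ g h : T1654, homMatrix (Ψ x) (g : T1654 ⧸ H₁) (h : T1654 ⧸ H₂) =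
            x (c.symm (DoubleCoset.mk H₁ H₂ (g⁻¹ * h)))) ∧
          ((homMatrix (Ψ x)).submatrix e₁ e₂).det =
            -(linForm x 0 * linForm x 1 ^ 5 * linForm x 2 ^ 15 * linForm x 3 ^ 30 *
              linForm x 4 ^ 45)) ∧
      (¬ ∃ x : Fin 5 → ℤ, ∀ k, linForm x k = 1 ∨ linForm x k = -1) ∧
      -- number fields: infinitely many realizations, and an explicit one
      {L : IntermediateField ℚ (AlgebraicClosure ℚ) | RealizesPair H₁ H₂ L}.Infinite ∧
      RealizesPair H₁ H₂ poly16.SplittingField ∧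
      -- rank 5: permutation modules in the same genus, but nonisomorphic `G`-sets
      actionRank T1654 (T1654 ⧸ H₁) = 5 ∧ actionRank T1654 (T1654 ⧸ H₂) = 5 ∧
      LocallyIntegrallyEquivalent H₁ H₂ ∧
      ¬ IsoGSets T1654 (T1654 ⧸ H₁) (T1654 ⧸ H₂) := by
  obtain ⟨e₁, e₂, hdet⟩ := det_colMatrix
  refine ⟨card_pt, inferInstance, card_T1654, a5Sub 0, a5Sub 1, nonempty_a5Sub_mulEquiv 0,
    nonempty_a5Sub_mulEquiv 1, not_conj_a5Sub (by decide), index_eq_96 (card_a5Sub 0),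
    index_eq_96 (card_a5Sub 1),
    ⟨a5Sub, rfl, rfl, nonempty_a5Sub_mulEquiv, fun i j => not_conj_a5Sub, fun H ⟨e⟩ =>
      exists_conj_a5Sub e, proper_subgroups_iff⟩,
    solvablyEquivalent_a5Sub, not_integrallyEquivalent_a5Sub,
    ⟨colEquiv, e₁, e₂, colHom, ncard_rightCosetsIn, fun x => ⟨fun g h => ?_, ?_⟩⟩,
    not_forall_linForm_eq, infinite_realizesPair, realizesPair_splittingField,
    actionRank_a5Sub (Or.inl rfl), actionRank_a5Sub (Or.inr rfl),
    locallyIntegrallyEquivalent_a5Sub, not_isoGSets_a5Sub⟩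
  · rw [homMatrix_colHom, colEquiv_symm_mk_inv_mul]
    rfl
  · rw [homMatrix_colHom]
    exact hdet x
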